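/- Setting. Either (a) $\mathbb F=\mathbb F_0=\mathbb H$, $V$ is a two-sided quaternionic Banach space (with $\|av\|=|a|\,\|v\|$ and $\|va\|=\|v\|\,|a|$), and $T$ is a closed right linear operator on $V$; or (b) $n\ge 1$, $\mathbb F=\mathbb R_n$ is the real Clifford algebra with units $e_1,\dots,e_n$, $e_i^2=-1$, $e_ie_j=-e_je_i$ $(i\ne j)$, $\mathbb F_0=\{\xi_0+\sum_i\xi_ie_i:\xi_i\in\mathbb R\}$ is the set of paravectors, $V=V_{\mathbb R}\otimes\mathbb R_n$ for a real Banach space $V_{\mathbb R}$ (with $\|\sum_A v_A\otimes e_A\|=\sum_A\|v_A\|$), and $T=T_0+\sum_{i=1}^nT_ie_i$ with closed operators $T_i$ on $V_{\mathbb R}$ and $\operatorname{dom}(T)=(\bigcap_i\operatorname{dom}(T_i))\otimes\mathbb R_n$. Let $\mathcal B(V)$ be the set of all bounded right linear operators on $V$, with $(aB)v=a(Bv)$, $(Ba)v=B(av)$ for $a\in\mathbb F$. Let $\mathbb S=\{I\in\mathbb F_0:\operatorname{Re}I=0,\ |I|=1\}$ and $\mathbb C_I=\{x_0+Ix_1:x_0,x_1\in\mathbb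 R\}$. A set $U\subset\mathbb F_0$ is axially symmetric if $x_0+Ix_1\in U$ implies $x_0+Jx_1\in U$ for all $J\in\mathbb S$. A function $f$ on an axially symmetric open set $D\subset\mathbb F_0$ is left (right) slice hyperholomorphic if it is real differentiable and $f(x_0+Ix_1)=\alpha(x_0,x_1)+I\beta(x_0,x_1)$ (resp. $\alpha(x_0,x_1)+\beta(x_0,x_1)I$), where $\alpha$ is even and $\beta$ odd in $x_1$ and $\partial_{x_0}\alpha=\partial_{x_1}\beta$, $\partial_{x_0}\beta=-\partial_{x_1}\alpha$. For $s\in\mathbb F_0$ put $\mathcal Q_s(T)=T^2-2\operatorname{Re}(s)T+|s|^2\mathcal I$ on $\operatorname{dom}(T^2)$, and let $\rho_S(T)=\{s\in\mathbb F_0:\mathcal Q_s(T)^{-1}\in\mathcal B(V)\}$, $\sigma_S(T)=\mathbb F_0\setminus\rho_S(T)$. For $s\in\rho_S(T)$ let $$S_L^{-1}(s,T)=\mathcal Q_s(T)^{-1}\overline s-T\mathcal Q_s(T)^{-1},\qquad S_R^{-1}(s,T)=-(T-\mathcal I\overline s)\mathcal Q_s(T)^{-1}.$$ Write $f\in\mathcal{SH}_L(\sigma_S(T)\cup\{\infty\})$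 (resp. $\mathcal{SH}_R$) with domain $\mathcal D(f)$ if $f$ is left (resp. right) slice hyperholomorphic on the axially symmetric open set $\mathcal D(f)\supset\sigma_S(T)$, $\{s\in\mathbb F_0:|s|>r\}\subset\mathcal D(f)$ for some $r>0$, and the limit $f(\infty)=\lim_{s\to\infty}f(s)$ exists in $\mathbb F$. A slice Cauchy domain is an axially symmetric set $U\subset\mathbb F_0$ such that for every $I\in\mathbb S$ the set $U\cap\mathbb C_I$ is open in $\mathbb C_I$, has finitely many components, with pairwise disjoint closures, and its boundary $\partial(U\cap\mathbb C_I)$ in $\mathbb C_I$ consists of a finite positive number of pairwise disjoint closed piecewise continuously differentiable Jordan curves. Integrals over $\partial(U\cap\mathbb C_I)$ are taken with the positive orientation (if $U$ is unbounded: total winding number $0$ about points of $U\cap\mathbb C_I$ and $-1$ about points of $\mathbb C_I$ outside its closure), and $ds_I=-I\,ds$. Theorem. Assume $\rho_S(T)\ne\emptyset$ and let $f\in\mathcal{SH}_L(\sigma_S(T)\cup\{\infty\})$ with domain $\mathcal D(f)$. Then there exists an unbounded slice Cauchy domain $U$ with $\sigma_S(T)\subset U$ and $\overline U\subset\mathcal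 D(f)$, and $$\frac1{2\pi}\int_{\partial(U\cap\mathbb C_I)}S_L^{-1}(s,T)\,ds_I\,f(s)\in\mathcal B(V),$$ where the integral exists and has the same value for every $I\in\mathbb S$ and every such $U$. Consequently $$f(T)=f(\infty)\mathcal I+\frac1{2\pi}\int_{\partial(U\cap\mathbb C_I)}S_L^{-1}(s,T)\,ds_I\,f(s)$$ is a well-defined operator in $\mathcal B(V)$. Likewise, if $f\in\mathcal{SH}_R(\sigma_S(T)\cup\{\infty\})$, such a $U$ exists, the integral $\frac1{2\pi}\int_{\partial(U\cap\mathbb C_I)}f(s)\,ds_I\,S_R^{-1}(s,T)\in\mathcal B(V)$ exists and is the same for every $I\in\mathbb S$ and every such $U$, and $f(T)=f(\infty)\mathcal I+\frac1{2\pi}\int_{\partial(U\cap\mathbb C_I)}f(s)\,ds_I\,S_R^{-1}(s,T)$ is a well-defined operator in $\mathcal B(V)$. -/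

import Mathlib

open scoped symmDiff

noncomputable section

set_option linter.unusedSectionVars false

/-! ### The real Clifford algebra `ℝₙ` in the basis `e_A` -/

/-- The sign in `e_A e_B = ± e_{A ∆ B}`: each pair `(i, j) ∈ A × B` with `j < i` contributes a
transposition of two anticommuting generators, each pair `j = i` a factor `eᵢ² = -1`. -/
def cliffSign {n : ℕ} (A B : Finset (Fin n)) : ℝ :=
  ∏ i ∈ A, ∏ j ∈ B, if j ≤ i then -1 else 1

/-- The real Clifford algebra over `n` units `e₁, …, eₙ` with `eᵢ² = -1`. Its elements are the
`∑_A ξ_A e_A`, `A ⊆ {1, …, n}`, with modulus `|∑_A ξ_A e_A|² = ∑_A ξ_A²`. -/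
def Cliff (n : ℕ) : Type := EuclideanSpace ℝ (Finset (Fin n))

namespace Cliff
variable {n : ℕ}

instance : NormedAddCommGroup (Cliff n) :=
  inferInstanceAs (NormedAddCommGroup (EuclideanSpace ℝ (Finset (Fin n))))
instance : NormedSpace ℝ (Cliff n) :=
  inferInstanceAs (NormedSpace ℝ (EuclideanSpace ℝ (Finset (Fin n))))

/-- The coefficient `ξ_A` of `x = ∑_A ξ_A e_A`. -/
def coord (x : Cliff n) (A : Finset (Fin n)) : ℝ := WithLp.ofLp x A
/-- The element `∑_A c_A e_A`. -/
def ofCoord (c : Finset (Fin n) → ℝ) : Cliff n := WithLp.toLp 2 c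
/-- The basis element `e_A`. -/
def e (A : Finset (Fin n)) : Cliff n := ofCoord fun B => if B = A then 1 else 0

instance : One (Cliff n) := ⟨e ∅⟩
/-- The bilinear product with `e_A e_B = cliffSign A B • e_{A ∆ B}`. -/
instance : Mul (Cliff n) :=
  ⟨fun x y => ofCoord fun C => ∑ A, cliffSign A (A ∆ C) * x.coord A * y.coord (A ∆ C)⟩

@[ext] theorem ext {x y : Cliff n} (h : ∀ A, x.coord A = y.coord A) : x = y :=
  WithLp.ofLp_injective 2 (funext h)
@[simp] theorem coord_ofCoord (c : Finset (Fin n) → ℝ) (A) : (ofCoord c).coord A = c A := rfl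
@[simp] theorem coord_add (x y : Cliff n) (A) : (x + y).coord A = x.coord A + y.coord A := rfl
@[simp] theorem coord_smul (r : ℝ) (x : Cliff n) (A) : (r • x).coord A = r * x.coord A := rfl
@[simp] theorem coord_zero (A) : (0 : Cliff n).coord A = 0 := rfl
theorem coord_one (A : Finset (Fin n)) : (1 : Cliff n).coord A = if A = ∅ then 1 else 0 := rfl
theorem coord_e (A B : Finset (Fin n)) : (e A).coord B = if B = A then 1 else 0 := rfl
theorem coord_mul (x y : Cliff n) (C) :
    (x * y).coord C = ∑ A, cliffSign A (A ∆ C) * x.coord A * y.coord (A ∆ C) := rfl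

theorem cliffSign_mul_self (A B : Finset (Fin n)) : cliffSign A B * cliffSign A B = 1 := by
  simp only [cliffSign, ← Finset.prod_mul_distrib]
  exact Finset.prod_eq_one fun i _ => Finset.prod_eq_one fun j _ => by split_ifs <;> norm_num

theorem prod_symmDiff {ι : Type*} [DecidableEq ι] (g : ι → ℝ) (hg : ∀ i, g i * g i = 1)
    (A B : Finset ι) : ∏ i ∈ A ∆ B, g i = (∏ i ∈ A, g i) * ∏ i ∈ B, g i := by
  have h1 := Finset.prod_sdiff (f := g) (Finset.inter_subset_left : A ∩ B ⊆ A)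
  have h2 := Finset.prod_sdiff (f := g) (Finset.inter_subset_right : A ∩ B ⊆ B)
  have h3 : (∏ i ∈ A ∩ B, g i) * (∏ i ∈ A ∩ B, g i) = 1 := by
    rw [← Finset.prod_mul_distrib]; exact Finset.prod_eq_one fun i _ => hg i
  have h4 : A ∆ B = (A \ (A ∩ B)) ∪ (B \ (A ∩ B)) := by
    ext i; simp only [Finset.mem_symmDiff, Finset.mem_union, Finset.mem_sdiff, Finset.mem_inter]
    tauto
  have h5 : Disjoint (A \ (A ∩ B)) (B \ (A ∩ B)) := by
    rw [Finset.disjoint_left]; intro i; simp only [Finset.mem_sdiff, Finset.mem_inter]; tauto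
  rw [h4, Finset.prod_union h5, ← h1, ← h2]
  linear_combination (-(∏ i ∈ A \ (A ∩ B), g i) * ∏ i ∈ B \ (A ∩ B), g i) * h3

theorem cliffSign_symmDiff_left (A B C : Finset (Fin n)) :
    cliffSign (A ∆ B) C = cliffSign A C * cliffSign B C := by
  refine prod_symmDiff _ (fun i => ?_) A B
  rw [← Finset.prod_mul_distrib]
  exact Finset.prod_eq_one fun j _ => by split_ifs <;> norm_num

theorem cliffSign_symmDiff_right (A B C : Finset (Fin n)) :
    cliffSign A (B ∆ C) = cliffSign A B * cliffSign A C := by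
  simp only [cliffSign, ← Finset.prod_mul_distrib]
  exact Finset.prod_congr rfl fun i _ => prod_symmDiff _ (fun j => by split_ifs <;> norm_num) B C

theorem e_mul_e (A B : Finset (Fin n)) : e A * e B = cliffSign A B • e (A ∆ B) := by
  ext C
  rw [coord_mul, Finset.sum_eq_single A]
  · simp only [coord_e, if_true, coord_smul]
    by_cases h : C = A ∆ B
    · subst h; simp [symmDiff_symmDiff_cancel_left]
    · have : A ∆ C ≠ B := fun h' => h (by rw [← h', symmDiff_symmDiff_cancel_left])
      simp [h, this]
  · intro D _ hD; simp [coord_e, hD]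
  · simp

theorem mul_assoc' (x y z : Cliff n) : x * y * z = x * (y * z) := by
  ext D
  simp only [coord_mul, Finset.sum_mul, Finset.mul_sum]
  rw [Finset.sum_comm]
  refine Finset.sum_congr rfl fun A _ => ?_
  rw [← Equiv.sum_comp (Equiv.mk (fun B : Finset (Fin n) => A ∆ B) (fun B => A ∆ B)
    (fun B => symmDiff_symmDiff_cancel_left _ _) (fun B => symmDiff_symmDiff_cancel_left _ _))]
  refine Finset.sum_congr rfl fun B _ => ?_
  simp only [Equiv.coe_fn_mk, symmDiff_symmDiff_cancel_left]
  have h1 : (A ∆ B) ∆ D = B ∆ (A ∆ D) := by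
    rw [symmDiff_comm A B, symmDiff_assoc]
  have h2 : A ∆ D = B ∆ (B ∆ (A ∆ D)) := (symmDiff_symmDiff_cancel_left _ _).symm
  have h3 : cliffSign A (A ∆ D) = cliffSign A B * cliffSign A (B ∆ (A ∆ D)) := by
    rw [← cliffSign_symmDiff_right, ← h2]
  rw [h1, h3, cliffSign_symmDiff_left]
  ring

instance : Ring (Cliff n) :=
  { (inferInstance : AddCommGroup (Cliff n)) with
    mul := (· * ·)
    one := 1
    mul_assoc := mul_assoc'
    one_mul := fun x => by
      ext C
      have h : (∅ : Finset (Fin n)) ∆ C = C := bot_symmDiff C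
      rw [coord_mul, Finset.sum_eq_single ∅] <;> simp +contextual [coord_one, cliffSign, h]
    mul_one := fun x => by
      ext C
      rw [coord_mul, Finset.sum_eq_single C]
      · simp [coord_one, cliffSign]
      · intro A _ hA
        have : A ∆ C ≠ ∅ := fun h => hA (symmDiff_eq_bot.1 h)
        simp [coord_one, this]
      · simp
    left_distrib := fun x y z => by
      ext C; simp only [coord_mul, coord_add, mul_add, Finset.sum_add_distrib]
    right_distrib := fun x y z => by
      ext C; simp only [coord_mul, coord_add, mul_add, add_mul, Finset.sum_add_distrib]
    zero_mul := fun x => by ext C; simp [coord_mul]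
    mul_zero := fun x => by ext C; simp [coord_mul] }

instance : Algebra ℝ (Cliff n) :=
  Algebra.ofModule
    (fun r x y => by
      ext C; simp only [coord_mul, coord_smul, Finset.mul_sum]
      exact Finset.sum_congr rfl fun A _ => by ring)
    (fun r x y => by
      ext C; simp only [coord_mul, coord_smul, Finset.mul_sum]
      exact Finset.sum_congr rfl fun A _ => by ring)


/-- The quadratic form `x ↦ -∑ xᵢ²` on `ℝⁿ`. -/
def negForm (n : ℕ) : QuadraticForm ℝ (Fin n → ℝ) := QuadraticMap.weightedSumSquares ℝ fun _ : Fin n => (-1 : ℝ)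

/-- The vector `∑ vᵢ eᵢ`. -/
def vec : (Fin n → ℝ) →ₗ[ℝ] Cliff n := ∑ i, (LinearMap.proj i : (Fin n → ℝ) →ₗ[ℝ] ℝ).smulRight (e {i})

theorem vec_apply (v : Fin n → ℝ) : vec v = ∑ i, v i • e {i} := by simp [vec]

theorem e_sq (i : Fin n) : e {i} * e {i} = (-1 : Cliff n) := by
  rw [e_mul_e, symmDiff_self, neg_eq_neg_one_mul, mul_one]
  simp only [cliffSign, Finset.prod_singleton, le_refl, if_true, Finset.bot_eq_empty]
  exact neg_one_smul ℝ (1 : Cliff n)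

theorem e_anticomm {i j : Fin n} (h : i ≠ j) : e {i} * e {j} = -(e {j} * e {i} : Cliff n) := by
  rw [e_mul_e, e_mul_e, symmDiff_comm, ← neg_smul]
  congr 1
  simp only [cliffSign, Finset.prod_singleton]
  rcases lt_or_gt_of_ne h with h | h <;> simp [h.le, h.not_ge]

theorem vec_sq (v : Fin n → ℝ) : vec v * vec v = algebraMap ℝ (Cliff n) (negForm n v) := by
  have key : ∀ i j : Fin n, e {i} * e {j} + e {j} * e {i} = (if i = j then (-2 : ℝ) else 0) • (1 : Cliff n) := by
    intro i j
    split_ifs with h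
    · subst h; rw [e_sq]; module
    · rw [e_anticomm h]; simp
  have h2 : (2:ℝ) • (vec v * vec v) = (2:ℝ) • algebraMap ℝ (Cliff n) (negForm n v) := by
    have : vec v * vec v = ∑ i, ∑ j, (v i * v j) • (e {i} * e {j}) := by
      simp only [vec_apply, Finset.sum_mul, Finset.mul_sum, smul_mul_smul_comm]
      rw [Finset.sum_comm]
    have h' : vec v * vec v = ∑ i, ∑ j, (v i * v j) • (e {j} * e {i}) := by
      rw [this, Finset.sum_comm]
      simp only [mul_comm]
    rw [two_smul]
    nth_rewrite 1 [this]
    rw [h', ← Finset.sum_add_distrib]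
    simp only [← Finset.sum_add_distrib, ← smul_add, key, smul_smul, ← Finset.sum_smul]
    rw [Algebra.algebraMap_eq_smul_one, smul_smul]
    congr 1
    simp [negForm, QuadraticMap.weightedSumSquares_apply, Finset.mul_sum]
    exact Finset.sum_congr rfl fun i _ => by ring
  exact smul_right_injective _ (two_ne_zero) h2

/-- The algebra map from Mathlib's Clifford algebra of `-∑ xᵢ²` that sends the `i`-th generator to
`eᵢ`; it is bijective by `ofClifford_bijective`. -/
def ofClifford (n : ℕ) : CliffordAlgebra (negForm n) →ₐ[ℝ] Cliff n :=
  CliffordAlgebra.lift (negForm n) ⟨vec, vec_sq⟩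

/-- The `i`-th generator of Mathlib's Clifford algebra. -/
def gen (i : Fin n) : CliffordAlgebra (negForm n) :=
  CliffordAlgebra.ι (negForm n) (Pi.single i 1)

/-- The ordered product `e_{i₁} ⋯ e_{iₖ}` for `A = {i₁ < ⋯ < iₖ}`. -/
def word (A : Finset (Fin n)) : CliffordAlgebra (negForm n) := ((A.sort (· ≤ ·)).map gen).prod

theorem word_insert {i : Fin n} {A : Finset (Fin n)} (h : ∀ j ∈ A, i < j) :
    word (insert i A) = gen i * word A := by
  have hi : i ∉ A := fun hi => lt_irrefl _ (h i hi)
  rw [word, Finset.sort_insert _ (fun b hb => (h b hb).le) hi]; simp [word]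

theorem gen_sq (i : Fin n) : gen i * gen i = (-1 : CliffordAlgebra (negForm n)) := by
  have h : negForm n (Pi.single i 1) = -1 := by
    simp [negForm, QuadraticMap.weightedSumSquares_apply, Pi.single_apply]
  rw [gen, CliffordAlgebra.ι_sq_scalar, h, map_neg, map_one]

theorem gen_anticomm {i j : Fin n} (h : i ≠ j) :
    gen i * gen j = -(gen j * gen i : CliffordAlgebra (negForm n)) := by
  rw [eq_neg_iff_add_eq_zero, gen, gen, CliffordAlgebra.ι_mul_ι_add_swap]
  have : QuadraticMap.polar (negForm n) (Pi.single i 1) (Pi.single j 1) = 0 := by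
    simp only [QuadraticMap.polar, negForm, QuadraticMap.weightedSumSquares_apply,
      ← Finset.sum_sub_distrib]
    refine Finset.sum_eq_zero fun k _ => ?_
    by_cases hi : k = i
    · subst hi; simp [h]
    · simp [Pi.single_apply, hi]
  rw [this, map_zero]

theorem ofClifford_gen (i : Fin n) : ofClifford n (gen i) = e {i} := by
  rw [ofClifford, gen, CliffordAlgebra.lift_ι_apply]
  simp only [vec_apply, Pi.single_apply]
  simp

theorem e_insert {i : Fin n} {A : Finset (Fin n)} (h : ∀ j ∈ A, i < j) :
    (e (insert i A) : Cliff n) = e {i} * e A := by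
  have hi : i ∉ A := fun hi => lt_irrefl _ (h i hi)
  have h1 : {i} ∆ A = insert i A := by
    ext k; simp only [Finset.mem_symmDiff, Finset.mem_singleton, Finset.mem_insert]
    by_cases hk : k = i
    · subst hk; simp [hi]
    · simp [hk]
  have h2 : cliffSign {i} A = 1 := by
    rw [cliffSign, Finset.prod_singleton]
    exact Finset.prod_eq_one fun j hj => by simp [h j hj]
  rw [e_mul_e, h1, h2, one_smul]

theorem ofClifford_word (A : Finset (Fin n)) : ofClifford n (word A) = e A := by
  induction A using Finset.induction_on_min with
  | empty => simp [word]; rfl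
  | insert i A h ih => rw [word_insert h, map_mul, ih, ofClifford_gen, e_insert h]

theorem gen_mul_word (i : Fin n) (A : Finset (Fin n)) :
    gen i * word A = cliffSign {i} A • word ({i} ∆ A) := by
  induction A using Finset.induction_on_min with
  | empty =>
    have : ({i} : Finset (Fin n)) ∆ ∅ = {i} := symmDiff_bot _
    rw [this]; simp [word, cliffSign]
  | insert a A h ih =>
    have ha : a ∉ A := fun hi => lt_irrefl _ (h a hi)
    have hs : cliffSign {i} (insert a A) = (if a ≤ i then -1 else 1) * cliffSign {i} A := by
      simp [cliffSign, Finset.prod_insert ha]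
    rw [word_insert h, hs]
    rcases lt_trichotomy i a with hia | rfl | hia
    · have hlt : ∀ j ∈ insert a A, i < j := by
        intro j hj
        rcases Finset.mem_insert.1 hj with rfl | hj
        · exact hia
        · exact hia.trans (h j hj)
      have h1 : {i} ∆ insert a A = insert i (insert a A) := by
        ext k; simp only [Finset.mem_symmDiff, Finset.mem_singleton, Finset.mem_insert]
        by_cases hk : k = i
        · subst hk; have := fun hk => lt_irrefl _ (hlt k hk); simp at this; simp [this]
        · simp [hk]
      have h2 : cliffSign {i} A = 1 := by
        rw [cliffSign, Finset.prod_singleton]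
        exact Finset.prod_eq_one fun j hj => by simp [hia.trans (h j hj)]
      rw [h1, word_insert hlt, word_insert h, h2]; simp [hia.not_ge]
    · have h1 : {i} ∆ insert i A = A := by
        ext k; simp only [Finset.mem_symmDiff, Finset.mem_singleton, Finset.mem_insert]
        by_cases hk : k = i
        · subst hk; simp [ha]
        · simp [hk]
      have h2 : cliffSign {i} A = 1 := by
        rw [cliffSign, Finset.prod_singleton]
        exact Finset.prod_eq_one fun j hj => by simp [h j hj]
      rw [h1, h2, ← mul_assoc, gen_sq]; simp
    · have h1 : {i} ∆ insert a A = insert a ({i} ∆ A) := by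
        ext k; simp only [Finset.mem_symmDiff, Finset.mem_singleton, Finset.mem_insert]
        by_cases hk : k = a
        · subst hk; simp [ha, hia.ne]
        · simp [hk]
      have hlt : ∀ j ∈ {i} ∆ A, a < j := by
        intro j hj
        simp only [Finset.mem_symmDiff, Finset.mem_singleton] at hj
        rcases hj with ⟨rfl, _⟩ | ⟨hj, _⟩
        · exact hia
        · exact h j hj
      rw [h1, word_insert hlt, ← mul_assoc, gen_anticomm hia.ne', neg_mul, mul_assoc, ih]
      simp [hia.le]

/-- `Cliff n` is Mathlib's Clifford algebra of the quadratic form `-∑ xᵢ²`. -/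
theorem ofClifford_bijective (n : ℕ) : Function.Bijective (ofClifford n) := by
  let g : Cliff n →ₗ[ℝ] CliffordAlgebra (negForm n) :=
    { toFun := fun x => ∑ A, x.coord A • word A
      map_add' := fun x y => by simp [add_smul, Finset.sum_add_distrib]
      map_smul' := fun r x => by simp [mul_smul, Finset.smul_sum] }
  have hge : ∀ A, g (e A) = word A := fun A => by simp [g, coord_e]
  have hsum : ∀ x : Cliff n, x = ∑ A, x.coord A • e A := fun x => by
    have hc : ∀ (s : Finset (Finset (Fin n))) (F : Finset (Fin n) → Cliff n) (B),
        (∑ A ∈ s, F A).coord B = ∑ A ∈ s, (F A).coord B := fun s F B => by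
      induction s using Finset.cons_induction with
      | empty => simp
      | cons a s ha ih => rw [Finset.sum_cons, Finset.sum_cons, coord_add, ih]
    ext B; simp [hc, coord_e]
  have hfg : ∀ x, ofClifford n (g x) = x := fun x => by
    conv_rhs => rw [hsum x]
    simp [g, ofClifford_word]
  have hmul : ∀ i x, g (e {i} * x) = gen i * g x := fun i x => by
    conv_lhs => rw [hsum x]
    rw [Finset.mul_sum, map_sum]
    simp only [mul_smul_comm, map_smul, e_mul_e, hge, ← gen_mul_word]
    simp [g, Finset.mul_sum]
  have hvec : ∀ v : Fin n → ℝ, CliffordAlgebra.ι (negForm n) v = ∑ i, v i • gen i := fun v => by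
    conv_lhs => rw [pi_eq_sum_univ' v]
    simp [gen, map_sum]
  have hsurj : ∀ y, ∃ x, ∀ z, g (x * z) = y * g z := fun y => by
    induction y using CliffordAlgebra.induction with
    | algebraMap r => exact ⟨algebraMap ℝ _ r, fun z => by rw [← Algebra.smul_def, map_smul, Algebra.smul_def]⟩
    | ι v => exact ⟨vec v, fun z => by
        rw [vec_apply, hvec, Finset.sum_mul, Finset.sum_mul, map_sum]
        simp [hmul]⟩
    | mul a b ha hb =>
      obtain ⟨x, hx⟩ := ha
      obtain ⟨y, hy⟩ := hb
      exact ⟨x * y, fun z => by rw [mul_assoc, hx, hy, mul_assoc]⟩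
    | add a b ha hb =>
      obtain ⟨x, hx⟩ := ha
      obtain ⟨y, hy⟩ := hb
      exact ⟨x + y, fun z => by rw [add_mul, map_add, hx, hy, add_mul]⟩
  have hg1 : g 1 = 1 := (hge ∅).trans (by simp [word])
  have hgs : Function.Surjective g := fun y => by
    obtain ⟨x, hx⟩ := hsurj y
    exact ⟨x, by have := hx 1; rwa [mul_one, hg1, mul_one] at this⟩
  refine ⟨fun a b hab => ?_, fun x => ⟨g x, hfg x⟩⟩
  obtain ⟨x, rfl⟩ := hgs a
  obtain ⟨y, rfl⟩ := hgs b
  rw [hfg, hfg] at hab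
  rw [hab]

end Cliff

/-! ### The two-sided Clifford module `V = V_ℝ ⊗ ℝₙ` -/

/-- `V = V_ℝ ⊗ ℝₙ`: an element is `∑_A v_A ⊗ e_A` with `v_A ∈ V_ℝ`, its norm is `∑_A ‖v_A‖`. -/
def CliffMod (n : ℕ) (E : Type*) : Type _ := PiLp 1 fun _ : Finset (Fin n) => E

namespace CliffMod
variable {n : ℕ} {E : Type*} [NormedAddCommGroup E] [NormedSpace ℝ E]

instance : NormedAddCommGroup (CliffMod n E) :=
  inferInstanceAs (NormedAddCommGroup (PiLp 1 fun _ : Finset (Fin n) => E))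
instance : NormedSpace ℝ (CliffMod n E) :=
  inferInstanceAs (NormedSpace ℝ (PiLp 1 fun _ : Finset (Fin n) => E))

/-- The component `v_A` of `v = ∑_A v_A ⊗ e_A`. -/
def coord (v : CliffMod n E) (A : Finset (Fin n)) : E := WithLp.ofLp v A
/-- The element `∑_A c_A ⊗ e_A`. -/
def ofCoord (c : Finset (Fin n) → E) : CliffMod n E := WithLp.toLp 1 c
/-- The elementary tensor `x ⊗ a`. -/
def tmul (x : E) (a : Cliff n) : CliffMod n E := ofCoord fun A => a.coord A • x

/-- `a v = ∑_{A,B} (a_A v_B) ⊗ (e_A e_B)`, written in components. -/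
instance : SMul (Cliff n) (CliffMod n E) :=
  ⟨fun a v => ofCoord fun C => ∑ A, (cliffSign A (A ∆ C) * a.coord A) • v.coord (A ∆ C)⟩
/-- `v a = ∑_{A,B} (a_B v_A) ⊗ (e_A e_B)`, written in components. -/
instance : SMul (Cliff n)ᵐᵒᵖ (CliffMod n E) :=
  ⟨fun a v => ofCoord fun C => ∑ A, (cliffSign A (A ∆ C) * a.unop.coord (A ∆ C)) • v.coord A⟩

@[ext] theorem ext {v w : CliffMod n E} (h : ∀ A, v.coord A = w.coord A) : v = w :=
  WithLp.ofLp_injective 1 (funext h)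
@[simp] theorem coord_ofCoord (c : Finset (Fin n) → E) (A) : (ofCoord c).coord A = c A := rfl
@[simp] theorem coord_add (v w : CliffMod n E) (A) :
    (v + w).coord A = v.coord A + w.coord A := rfl
@[simp] theorem coord_smul (r : ℝ) (v : CliffMod n E) (A) : (r • v).coord A = r • v.coord A := rfl
@[simp] theorem coord_zero (A) : (0 : CliffMod n E).coord A = 0 := rfl

theorem add_tmul (x y : E) (a : Cliff n) : tmul (x + y) a = tmul x a + tmul y a := by
  ext A; simp [tmul]
theorem smul_tmul (r : ℝ) (x : E) (a : Cliff n) : tmul (r • x) a = r • tmul x a := by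
  ext A; simp [tmul, smul_comm r]

theorem left_smul_tmul (a b : Cliff n) (x : E) : a • tmul x b = tmul x (a * b) := by
  ext C
  change ∑ A, (cliffSign A (A ∆ C) * a.coord A) • (b.coord (A ∆ C) • x) = (a * b).coord C • x
  simp only [Cliff.coord_mul, Finset.sum_smul, smul_smul]

theorem right_smul_tmul (a b : Cliff n) (x : E) :
    MulOpposite.op a • tmul x b = tmul x (b * a) := by
  ext C
  change ∑ A, (cliffSign A (A ∆ C) * a.coord (A ∆ C)) • (b.coord A • x) = (b * a).coord C • x
  simp only [Cliff.coord_mul, Finset.sum_smul, smul_smul]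
  exact Finset.sum_congr rfl fun A _ => by rw [mul_right_comm]

/-- The paravector operator `T = T₀ + ∑ᵢ Tᵢ eᵢ`, defined on the `v = ∑_A v_A ⊗ e_A` all of whose
components lie in `dom T₀ ∩ ⋂ᵢ dom Tᵢ`, with
`T v = ∑_A T₀(v_A) ⊗ e_A + ∑ᵢ ∑_A Tᵢ(v_A) ⊗ (eᵢ e_A)`. -/
def paravectorOp (T₀ : E →ₗ.[ℝ] E) (T : Fin n → E →ₗ.[ℝ] E) :
    CliffMod n E →ₗ.[ℝ] CliffMod n E where
  domain :=
    { carrier := {v | ∀ A, v.coord A ∈ T₀.domain ∧ ∀ i, v.coord A ∈ (T i).domain}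
      add_mem' := fun hv hw A =>
        ⟨add_mem (hv A).1 (hw A).1, fun i => add_mem ((hv A).2 i) ((hw A).2 i)⟩
      zero_mem' := fun _ => ⟨zero_mem _, fun _ => zero_mem _⟩
      smul_mem' := fun r _ hv A =>
        ⟨Submodule.smul_mem _ r (hv A).1, fun i => Submodule.smul_mem _ r ((hv A).2 i)⟩ }
  toFun :=
    { toFun := fun v =>
        ∑ A, tmul (T₀ ⟨v.1.coord A, (v.2 A).1⟩) (Cliff.e A) +
          ∑ i, ∑ A, tmul (T i ⟨v.1.coord A, (v.2 A).2 i⟩) (Cliff.e {i} * Cliff.e A)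
      map_add' := fun v w => by
        have h₀ : ∀ A, T₀ ⟨(v + w).1.coord A, ((v + w).2 A).1⟩ =
            T₀ ⟨v.1.coord A, (v.2 A).1⟩ + T₀ ⟨w.1.coord A, (w.2 A).1⟩ :=
          fun A => T₀.map_add ⟨v.1.coord A, (v.2 A).1⟩ ⟨w.1.coord A, (w.2 A).1⟩
        have h : ∀ i A, T i ⟨(v + w).1.coord A, ((v + w).2 A).2 i⟩ =
            T i ⟨v.1.coord A, (v.2 A).2 i⟩ + T i ⟨w.1.coord A, (w.2 A).2 i⟩ :=
          fun i A => (T i).map_add ⟨v.1.coord A, (v.2 A).2 i⟩ ⟨w.1.coord A, (w.2 A).2 i⟩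
        simp only [h₀, h, add_tmul, Finset.sum_add_distrib]
        abel
      map_smul' := fun r v => by
        have h₀ : ∀ A, T₀ ⟨(r • v).1.coord A, ((r • v).2 A).1⟩ =
            r • T₀ ⟨v.1.coord A, (v.2 A).1⟩ :=
          fun A => T₀.map_smul r ⟨v.1.coord A, (v.2 A).1⟩
        have h : ∀ i A, T i ⟨(r • v).1.coord A, ((r • v).2 A).2 i⟩ =
            r • T i ⟨v.1.coord A, (v.2 A).2 i⟩ :=
          fun i A => (T i).map_smul r ⟨v.1.coord A, (v.2 A).2 i⟩
        simp only [h₀, h, smul_tmul, ← Finset.smul_sum, ← smul_add, RingHom.id_apply] }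

end CliffMod

/-! ### Paravectors and slices -/

/-- The data that distinguish the quaternionic from the Clifford setting: the real part and the set
`𝔽₀` of (para)vectors inside the algebra `𝔽 = A`. There are exactly the two instances below. -/
class ParavectorData (A : Type*) where
  re : A → ℝ
  carrier : Set A

/-- `𝔽 = 𝔽₀ = ℍ`. -/
instance : ParavectorData (Quaternion ℝ) := ⟨fun x => x.re, Set.univ⟩

/-- `𝔽 = ℝₙ`, and `𝔽₀ = ℝⁿ⁺¹` consists of the `ξ₀ + ∑ᵢ ξᵢ eᵢ`. -/
instance (n : ℕ) : ParavectorData (Cliff n) :=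
  ⟨fun x => x.coord ∅, {x | ∃ (ξ₀ : ℝ) (ξ : Fin n → ℝ), x = ξ₀ • 1 + ∑ i, ξ i • Cliff.e {i}}⟩

section Slice
variable {A : Type*} [NormedAddCommGroup A] [NormedSpace ℝ A] [Mul A] [One A] [ParavectorData A]

/-- The real part. -/
def rePart (x : A) : ℝ := ParavectorData.re x

variable (A) in
/-- The set `𝔽₀`. -/
def paravec : Set A := ParavectorData.carrier

/-- The conjugate `Re x - x̲` of `x = Re x + x̲ ∈ 𝔽₀`. -/
def conjPara (x : A) : A := (2 * rePart x) • (1 : A) - x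

variable (A) in
/-- The set `𝕊` of imaginary units. -/
def imagUnits : Set A := {I | I ∈ paravec A ∧ rePart I = 0 ∧ ‖I‖ = 1}

/-- The sphere `[x] = {Re x + I |x̲| : I ∈ 𝕊}`. -/
def sphereOf (x : A) : Set A :=
  {y | ∃ I ∈ imagUnits A, y = rePart x • (1 : A) + ‖x - rePart x • (1 : A)‖ • I}

/-- Axially symmetric subsets of `𝔽₀`. -/
def IsAxiallySymmetric (U : Set A) : Prop := U ⊆ paravec A ∧ ∀ x ∈ U, sphereOf x ⊆ U

/-- Open subsets of `𝔽₀` (for the topology of `𝔽₀` as a subspace of `𝔽`). -/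
def IsOpenInParavec (U : Set A) : Prop := ∃ O : Set A, IsOpen O ∧ U = O ∩ paravec A

/-- The identification `x₀ + i x₁ ↦ x₀ + I x₁` of `ℂ` with the plane `ℂ_I`. -/
def toPlane (I : A) (z : ℂ) : A := z.re • (1 : A) + z.im • I

/-- `U ∩ ℂ_I`, regarded as a subset of `ℂ`. -/
def planeSlice (I : A) (U : Set A) : Set ℂ := toPlane I ⁻¹' U

/-- `f ∈ SH_L(D)`, where `D` is an open axially symmetric subset of `𝔽₀`; the values of `f` outside
`D` play no role. The derivatives in the Cauchy-Riemann equations exist since `f` is real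
differentiable. -/
structure IsLeftSliceHyperholomorphic (D : Set A) (f : A → A) : Prop where
  isOpen : IsOpenInParavec D
  symmetric : IsAxiallySymmetric D
  differentiable : DifferentiableOn ℝ f D
  slice : ∃ α β : ℝ → ℝ → A, ∀ x₀ x₁ : ℝ, ∀ I ∈ imagUnits A, x₀ • (1 : A) + x₁ • I ∈ D →
    f (x₀ • (1 : A) + x₁ • I) = α x₀ x₁ + I * β x₀ x₁ ∧
    α x₀ (-x₁) = α x₀ x₁ ∧ β x₀ (-x₁) = -β x₀ x₁ ∧
    deriv (fun t => α t x₁) x₀ = deriv (fun t => β x₀ t) x₁ ∧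
    deriv (fun t => β t x₁) x₀ = -deriv (fun t => α x₀ t) x₁

/-- `f ∈ SH_R(D)`. -/
structure IsRightSliceHyperholomorphic (D : Set A) (f : A → A) : Prop where
  isOpen : IsOpenInParavec D
  symmetric : IsAxiallySymmetric D
  differentiable : DifferentiableOn ℝ f D
  slice : ∃ α β : ℝ → ℝ → A, ∀ x₀ x₁ : ℝ, ∀ I ∈ imagUnits A, x₀ • (1 : A) + x₁ • I ∈ D →
    f (x₀ • (1 : A) + x₁ • I) = α x₀ x₁ + β x₀ x₁ * I ∧
    α x₀ (-x₁) = α x₀ x₁ ∧ β x₀ (-x₁) = -β x₀ x₁ ∧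
    deriv (fun t => α t x₁) x₀ = deriv (fun t => β x₀ t) x₁ ∧
    deriv (fun t => β t x₁) x₀ = -deriv (fun t => α x₀ t) x₁

/-- `lim_{s → ∞} f(s) = c`, where `s` runs through `𝔽₀`. -/
def HasLimitAtInfinity (f : A → A) (c : A) : Prop :=
  Filter.Tendsto f (Bornology.cobounded A ⊓ Filter.principal (paravec A)) (nhds c)

/-- `f ∈ SH_L(K ∪ {∞})` with domain `𝒟(f) = D`. -/
def IsLeftSHWithInfinity (K D : Set A) (f : A → A) : Prop :=
  IsLeftSliceHyperholomorphic D f ∧ K ⊆ D ∧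
    (∃ r > 0, {s ∈ paravec A | r < ‖s‖} ⊆ D) ∧ ∃ c, HasLimitAtInfinity f c

/-- `f ∈ SH_R(K ∪ {∞})` with domain `𝒟(f) = D`. -/
def IsRightSHWithInfinity (K D : Set A) (f : A → A) : Prop :=
  IsRightSliceHyperholomorphic D f ∧ K ⊆ D ∧
    (∃ r > 0, {s ∈ paravec A | r < ‖s‖} ⊆ D) ∧ ∃ c, HasLimitAtInfinity f c

end Slice

/-! ### Cauchy domains and their oriented boundaries -/

/-- `γ|_[0,1]` is a closed piecewise continuously differentiable Jordan curve. -/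
structure IsPiecewiseC1Jordan (γ : ℝ → ℂ) : Prop where
  continuous : ContinuousOn γ (Set.Icc 0 1)
  piecewise : ∃ (m : ℕ) (p : Fin (m + 1) → ℝ), StrictMono p ∧ p 0 = 0 ∧ p (Fin.last m) = 1 ∧
    ∀ k : Fin m, ContDiffOn ℝ 1 γ (Set.Icc (p k.castSucc) (p k.succ))
  closed : γ 0 = γ 1
  simple : Set.InjOn γ (Set.Ico 0 1)

/-- The boundary of `D ⊆ ℂ` consists of the Jordan curves `γ₁, …, γ_N` (`N ≥ 1`), no two of which
intersect. -/
structure IsBoundaryCurves (D : Set ℂ) {N : ℕ} (γ : Fin N → ℝ → ℂ) : Prop where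
  pos : 0 < N
  jordan : ∀ j, IsPiecewiseC1Jordan (γ j)
  disjoint : ∀ j k, j ≠ k → Disjoint (γ j '' Set.Icc 0 1) (γ k '' Set.Icc 0 1)
  frontier_eq : frontier D = ⋃ j, γ j '' Set.Icc 0 1

/-- Cauchy domains in `ℂ`. -/
structure IsCauchyDomain (D : Set ℂ) : Prop where
  isOpen : IsOpen D
  finite_components : {C | ∃ z ∈ D, C = connectedComponentIn D z}.Finite
  disjoint_closures : {C | ∃ z ∈ D, C = connectedComponentIn D z}.Pairwise
    fun C C' => Disjoint (closure C) (closure C')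
  boundary : ∃ (N : ℕ) (γ : Fin N → ℝ → ℂ), IsBoundaryCurves D γ

/-- The winding number `∑ⱼ (2πi)⁻¹ ∫_{γⱼ} dw / (w - z)` of `γ₁, …, γ_N` about `z`. -/
def windingNumber {N : ℕ} (γ : Fin N → ℝ → ℂ) (z : ℂ) : ℂ :=
  (2 * Real.pi * Complex.I)⁻¹ * ∑ j, ∫ t in (0 : ℝ)..1, deriv (γ j) t / (γ j t - z)

open Classical in
/-- `∂D = γ₁ ∪ ⋯ ∪ γ_N` with the positive orientation: the curves wind once around the points of `D`
and do not wind around the points outside `closure D` if `D` is bounded; if `D` is unbounded, they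
do not wind around the points of `D` and wind `-1` times around the points outside `closure D`. -/
structure IsPositiveBoundary (D : Set ℂ) {N : ℕ} (γ : Fin N → ℝ → ℂ) : Prop where
  boundary : IsBoundaryCurves D γ
  winding_inside : ∀ z ∈ D, windingNumber γ z = if Bornology.IsBounded D then 1 else 0
  winding_outside : ∀ z ∉ closure D, windingNumber γ z = if Bornology.IsBounded D then 0 else -1

section Operators
variable {A : Type*} [NormedAddCommGroup A] [NormedSpace ℝ A] [Mul A] [One A] [ParavectorData A]

/-- Slice Cauchy domains in `𝔽₀`. -/
def IsSliceCauchyDomain (U : Set A) : Prop :=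
  IsAxiallySymmetric U ∧ ∀ I ∈ imagUnits A, IsCauchyDomain (planeSlice I U)

/-- `U` is an unbounded slice Cauchy domain with `K ⊆ U` and `closure U ⊆ D`. -/
def IsAdmissibleDomain (K D U : Set A) : Prop :=
  IsSliceCauchyDomain U ∧ ¬ Bornology.IsBounded U ∧ K ⊆ U ∧ closure U ⊆ D

/-! ### The `S`-spectrum and the `S`-resolvent operators -/

variable {V : Type*} [NormedAddCommGroup V] [NormedSpace ℝ V] [SMul A V] [SMul Aᵐᵒᵖ V]

variable (A) in
/-- `T` is right linear (over `A`) on its domain, which is a right subspace. -/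
def IsRightLinear (T : V →ₗ.[ℝ] V) : Prop :=
  ∀ (v : T.domain) (a : A), ∃ h : MulOpposite.op a • (v : V) ∈ T.domain,
    T ⟨MulOpposite.op a • (v : V), h⟩ = MulOpposite.op a • T v

variable (A V) in
/-- The set `ℬ(V)` of all bounded right linear operators on `V`. -/
def boundedOps : Set (V →L[ℝ] V) :=
  {L | ∀ (v : V) (a : A), L (MulOpposite.op a • v) = MulOpposite.op a • L v}

/-- `𝒬_s(T) = T² - 2 Re(s) T + |s|²`, with domain `dom(T²) = {v ∈ dom T | T v ∈ dom T}`. -/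
def qOp (T : V →ₗ.[ℝ] V) (s : A) : V →ₗ.[ℝ] V where
  domain :=
    { carrier := {v | ∃ h : v ∈ T.domain, T ⟨v, h⟩ ∈ T.domain}
      add_mem' := by
        rintro v w ⟨hv, hv'⟩ ⟨hw, hw'⟩
        refine ⟨add_mem hv hw, ?_⟩
        have h := T.map_add ⟨v, hv⟩ ⟨w, hw⟩
        exact h.symm ▸ add_mem hv' hw'
      zero_mem' := ⟨zero_mem _, by
        have h := T.map_zero
        exact h.symm ▸ zero_mem _⟩
      smul_mem' := by
        rintro r v ⟨hv, hv'⟩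
        refine ⟨Submodule.smul_mem _ r hv, ?_⟩
        have h := T.map_smul r ⟨v, hv⟩
        exact h.symm ▸ Submodule.smul_mem _ r hv' }
  toFun :=
    { toFun := fun v =>
        T ⟨T ⟨v.1, v.2.1⟩, v.2.2⟩ - (2 * rePart s) • T ⟨v.1, v.2.1⟩ + ‖s‖ ^ 2 • v.1
      map_add' := fun v w => by
        have h := T.map_add ⟨v.1, v.2.1⟩ ⟨w.1, w.2.1⟩
        have h' := T.map_add ⟨T ⟨v.1, v.2.1⟩, v.2.2⟩ ⟨T ⟨w.1, w.2.1⟩, w.2.2⟩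
        have h1 : T ⟨(v + w).1, (v + w).2.1⟩ = T ⟨v.1, v.2.1⟩ + T ⟨w.1, w.2.1⟩ := h
        have h2 : T ⟨T ⟨(v + w).1, (v + w).2.1⟩, (v + w).2.2⟩ =
            T ⟨T ⟨v.1, v.2.1⟩, v.2.2⟩ + T ⟨T ⟨w.1, w.2.1⟩, w.2.2⟩ := by
          rw [← h']; exact congrArg T (Subtype.ext h)
        rw [h2, h1, Submodule.coe_add, smul_add, smul_add]
        abel
      map_smul' := fun r v => by
        have h := T.map_smul r ⟨v.1, v.2.1⟩
        have h' := T.map_smul r ⟨T ⟨v.1, v.2.1⟩, v.2.2⟩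
        have h1 : T ⟨(r • v).1, (r • v).2.1⟩ = r • T ⟨v.1, v.2.1⟩ := h
        have h2 : T ⟨T ⟨(r • v).1, (r • v).2.1⟩, (r • v).2.2⟩ =
            r • T ⟨T ⟨v.1, v.2.1⟩, v.2.2⟩ := by
          rw [← h']; exact congrArg T (Subtype.ext h)
        rw [h2, h1, Submodule.coe_smul, smul_comm _ r, smul_comm _ r, RingHom.id_apply,
          smul_add, smul_sub] }

/-- `R = 𝒬_s(T)⁻¹ ∈ ℬ(V)`. -/
def IsPseudoResolvent (T : V →ₗ.[ℝ] V) (s : A) (R : V →L[ℝ] V) : Prop :=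
  R ∈ boundedOps A V ∧
    (∀ v, ∃ h : R v ∈ (qOp T s).domain, qOp T s ⟨R v, h⟩ = v) ∧
    ∀ u : (qOp T s).domain, R (qOp T s u) = u

variable (A) in
/-- The `S`-resolvent set `ρ_S(T)`. -/
def sResolventSet (T : V →ₗ.[ℝ] V) : Set A :=
  {s | s ∈ paravec A ∧ ∃ R : V →L[ℝ] V, IsPseudoResolvent T s R}

variable (A) in
/-- The `S`-spectrum `σ_S(T) = 𝔽₀ \ ρ_S(T)`. -/
def sSpectrum (T : V →ₗ.[ℝ] V) : Set A := paravec A \ sResolventSet A T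

open Classical in
/-- The operator `𝒬_s(T)⁻¹` for `s ∈ ρ_S(T)`. -/
def pseudoResolvent (T : V →ₗ.[ℝ] V) (s : A) : V →L[ℝ] V :=
  if h : ∃ R : V →L[ℝ] V, IsPseudoResolvent T s R then h.choose else 0

open Classical in
/-- `T v` for `v ∈ dom T`. -/
def opApply (T : V →ₗ.[ℝ] V) (v : V) : V := if h : v ∈ T.domain then T ⟨v, h⟩ else 0

/-- `S_L⁻¹(s,T) v = 𝒬_s(T)⁻¹ s̄ v - T 𝒬_s(T)⁻¹ v`. -/
def leftSResolvent (T : V →ₗ.[ℝ] V) (s : A) (v : V) : V :=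
  pseudoResolvent T s (conjPara s • v) - opApply T (pseudoResolvent T s v)

/-- `S_R⁻¹(s,T) v = -(T - s̄) 𝒬_s(T)⁻¹ v`. -/
def rightSResolvent (T : V →ₗ.[ℝ] V) (s : A) (v : V) : V :=
  -(opApply T (pseudoResolvent T s v) - conjPara s • pseudoResolvent T s v)

/-! ### The Cauchy integrals and the functional calculus -/

/-- The operator valued integral `∑ⱼ ∫₀¹ Fⱼ(t) dt` exists in the Banach space of bounded operators
on `V`, and its value is `L`. -/
def HasOperatorIntegral {N : ℕ} (F : Fin N → ℝ → V → V) (L : V →L[ℝ] V) : Prop :=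
  ∃ W : Fin N → ℝ → V →L[ℝ] V, (∀ j, ∀ t ∈ Set.Icc (0 : ℝ) 1, ⇑(W j t) = F j t) ∧
    (∀ j, IntervalIntegrable (W j) MeasureTheory.volume 0 1) ∧
    L = ∑ j, ∫ t in (0 : ℝ)..1, W j t

/-- `∑ⱼ ∫_{γⱼ} S_L⁻¹(s,T) ds_I f(s) = L` with `ds_I = -I ds`, where the curves `γⱼ` in `ℂ` are
transported to `ℂ_I` and `(B a) v = B (a v)` for an operator `B` and a scalar `a`. -/
def HasLeftIntegral (T : V →ₗ.[ℝ] V) (f : A → A) (I : A) {N : ℕ} (γ : Fin N → ℝ → ℂ)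
    (L : V →L[ℝ] V) : Prop :=
  HasOperatorIntegral (fun j t v => leftSResolvent T (toPlane I (γ j t))
    ((-I * toPlane I (deriv (γ j) t) * f (toPlane I (γ j t))) • v)) L

/-- `∑ⱼ ∫_{γⱼ} f(s) ds_I S_R⁻¹(s,T) = L`, with `(a B) v = a (B v)`. -/
def HasRightIntegral (T : V →ₗ.[ℝ] V) (f : A → A) (I : A) {N : ℕ} (γ : Fin N → ℝ → ℂ)
    (L : V →L[ℝ] V) : Prop :=
  HasOperatorIntegral (fun j t v =>
    (f (toPlane I (γ j t)) * -I * toPlane I (deriv (γ j) t)) •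
      rightSResolvent T (toPlane I (γ j t)) v) L

/-- `F = f(∞) 𝓘 + (2π)⁻¹ ∫_{∂(U ∩ ℂ_I)} S_L⁻¹(s,T) ds_I f(s)` for some admissible slice Cauchy domain
`U` and some imaginary unit `I`, that is, `F` is a value of `f(T)`. -/
def IsLeftSCalculusValue (T : V →ₗ.[ℝ] V) (D : Set A) (f : A → A) (F : V →L[ℝ] V) : Prop :=
  ∃ U, IsAdmissibleDomain (sSpectrum A T) D U ∧ ∃ I ∈ imagUnits A,
    ∃ (N : ℕ) (γ : Fin N → ℝ → ℂ) (L : V →L[ℝ] V) (c : A),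
      IsPositiveBoundary (planeSlice I U) γ ∧ HasLeftIntegral T f I γ L ∧
      HasLimitAtInfinity f c ∧ ∀ v, F v = c • v + (2 * Real.pi)⁻¹ • L v

/-- `F = f(∞) 𝓘 + (2π)⁻¹ ∫_{∂(U ∩ ℂ_I)} f(s) ds_I S_R⁻¹(s,T)` for some admissible slice Cauchy domain
`U` and some imaginary unit `I`. -/
def IsRightSCalculusValue (T : V →ₗ.[ℝ] V) (D : Set A) (f : A → A) (F : V →L[ℝ] V) : Prop :=
  ∃ U, IsAdmissibleDomain (sSpectrum A T) D U ∧ ∃ I ∈ imagUnits A,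
    ∃ (N : ℕ) (γ : Fin N → ℝ → ℂ) (L : V →L[ℝ] V) (c : A),
      IsPositiveBoundary (planeSlice I U) γ ∧ HasRightIntegral T f I γ L ∧
      HasLimitAtInfinity f c ∧ ∀ v, F v = c • v + (2 * Real.pi)⁻¹ • L v

end Operators

end

/-!
The proof moves the whole problem to the complex parameter plane, where `z = x₀ + i x₁` stands for
all the points `x₀ + I x₁`, `I ∈ 𝕊`, at once. Axially symmetric sets become sets symmetric under
complex conjugation, and a slice hyperholomorphic function becomes a pair `(α, β)`, even and odd
under conjugation, that satisfies the Cauchy-Riemann equations (`isCauchyRiemannAt_stem`).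

The `S`-resolvents have the same shape: with `Q = 𝒬_s(T)⁻¹` and `Y = T Q`,
`S_L⁻¹(x₀ + I x₁, T) = P + R I` and `S_R⁻¹(x₀ + I x₁, T) = P + I R` for `P = x₀ Q - Y` and
`R = -x₁ Q`. The pair `(P, R)` satisfies the Cauchy-Riemann equations, because a Neumann series
gives the derivatives of `Q` and `Y`, and `Q`, `Y` commute with
`Y² = Q + 2 x₀ Y Q - |z|² Q²` (`IsPlanarResolvent.isCauchyRiemannAt`). Boundedness of `Y` comes from
the closed graph theorem: for `T` itself in the quaternionic setting, and for the components `Tᵢ`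
in the Clifford setting, where `T` need not be closed.

The integrand `S_L⁻¹(s, T) ds_I f(s)` therefore comes from the product `(P + i R)(α + i β)` of two
holomorphic stem functions. It splits into a part that does not involve `I` and a part with a factor
`I` between the two stem functions (`stemForm`). After composition with a real functional both parts
are complex line integrals of holomorphic functions `g` with `g(z̄) = conj (g z)`. Conjugation
maps the positively oriented boundary of a symmetric domain to a cycle homologous to its reverse,
which makes the part with `I` vanish (`IsPositiveBoundary.sum_integral_re_eq_zero`); hence the
value does not depend on `I`. The boundaries of two admissible domains are homologous in the
intersection of the slice of `𝒟(f)` with the resolvent set, so the value does not depend on the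
domain either. The homology form of Cauchy's theorem that is used is proved by Dixon's argument
(`sum_integral_eq_zero_of_index_eq_zero`).

For the existence of an admissible domain, a fine hexagonal tiling of the plane is used
(`exists_unbounded_cauchyDomain`): the domain is the complement of the union of the tiles that meet
the complement of the slice of `𝒟(f)`, enlarged by a pair of conjugate points of the resolvent set
so that it is not empty. Three tiles meet at each vertex, so at most two boundary edges do, and the
boundary is a disjoint union of polygonal Jordan curves.
-/

noncomputable section

set_option linter.unusedSectionVars false

/-! ### Cauchy's theorem for weighted families of curves -/

open MeasureTheory Filter Topology in
/-- A parameter integral of locally bounded holomorphic functions is holomorphic. -/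
theorem differentiableAt_integral_of_bounded {α : Type*} [MeasurableSpace α] {μ : Measure α}
    {F : ℂ → α → ℂ} {g : α → ℂ} (hg : Integrable g μ) {z₀ : ℂ} {r M : ℝ} (hr : 0 < r)
    (hmeas : ∀ z ∈ Metric.ball z₀ r, AEStronglyMeasurable (F z) μ)
    (hdiff : ∀ᵐ a ∂μ, DifferentiableOn ℂ (fun z => F z a) (Metric.ball z₀ r))
    (hbd : ∀ᵐ a ∂μ, ∀ z ∈ Metric.ball z₀ r, ‖F z a‖ ≤ M) :
    DifferentiableAt ℂ (fun z => ∫ a, F z a * g a ∂μ) z₀ := by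
  have hz₀ : z₀ ∈ Metric.ball z₀ r := Metric.mem_ball_self hr
  have hint : ∀ z ∈ Metric.ball z₀ r, Integrable (fun a => F z a * g a) μ := fun z hz =>
    hg.bdd_mul (hmeas z hz) (hbd.mono fun a ha => ha z hz)
  have hder : ∀ᵐ a ∂μ, ∀ z ∈ Metric.ball z₀ r,
      HasDerivAt (fun z => F z a) (deriv (fun z => F z a) z) z := by
    filter_upwards [hdiff] with a ha z hz
    exact (ha.differentiableAt (Metric.isOpen_ball.mem_nhds hz)).hasDerivAt
  -- the derivative in the parameter is a pointwise limit of difference quotients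
  have hF' : AEStronglyMeasurable (fun a => deriv (fun z => F z a) z₀) μ := by
    set u : ℕ → ℂ := fun n => ((r / (2 * (n + 1)) : ℝ) : ℂ) with hu
    have hupos : ∀ n : ℕ, 0 < r / (2 * ((n : ℝ) + 1)) := fun n => by positivity
    have hu0 : Tendsto u atTop (𝓝 0) := by
      have : Tendsto (fun n : ℕ => r / (2 * ((n : ℝ) + 1))) atTop (𝓝 0) := by
        have h := (tendsto_one_div_add_atTop_nhds_zero_nat (𝕜 := ℝ)).const_mul (r / 2)
        rw [mul_zero] at h
        refine h.congr fun n => ?_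
        field_simp
      have h2 := (Complex.continuous_ofReal.tendsto 0).comp this
      simpa [hu, Function.comp_def] using h2
    have humem : ∀ n, z₀ + u n ∈ Metric.ball z₀ r := fun n => by
      rw [Metric.mem_ball, dist_eq_norm, add_sub_cancel_left, hu]
      simp only [Complex.norm_real, Real.norm_eq_abs, abs_of_pos (hupos n)]
      rw [div_lt_iff₀ (by positivity)]
      nlinarith [(Nat.cast_nonneg n : (0 : ℝ) ≤ n)]
    refine aestronglyMeasurable_of_tendsto_ae atTop
      (f := fun n a => (u n)⁻¹ * (F (z₀ + u n) a - F z₀ a))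
      (fun n => ((hmeas _ (humem n)).sub (hmeas _ hz₀)).const_mul _) ?_
    filter_upwards [hder] with a ha
    have h := (ha z₀ hz₀).tendsto_slope_zero
    refine (h.comp (f := u) (x := atTop) ?_).congr fun n => ?_
    · refine tendsto_nhdsWithin_iff.2 ⟨hu0, Eventually.of_forall fun n => ?_⟩
      have h0 : ((r / (2 * ((n : ℝ) + 1)) : ℝ) : ℂ) ≠ 0 := by
        have := hupos n
        exact_mod_cast this.ne'
      simpa [hu] using h0
    · simp
  refine (hasDerivAt_integral_of_dominated_loc_of_deriv_le (F := fun z a => F z a * g a)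
    (F' := fun z a => deriv (fun z => F z a) z * g a) (bound := fun a => M / (r / 2) * ‖g a‖)
    (Metric.ball_mem_nhds z₀ (half_pos hr))
    (Filter.eventually_of_mem (Metric.ball_mem_nhds z₀ hr) fun z hz => (hint z hz).aestronglyMeasurable)
    (hint z₀ hz₀) (hF'.mul hg.aestronglyMeasurable) ?_ (hg.norm.const_mul _) ?_).2.differentiableAt
  · filter_upwards [hdiff, hbd] with a ha hb z hz
    rw [norm_mul]
    refine mul_le_mul_of_nonneg_right ?_ (norm_nonneg _)
    have hsub : Metric.ball z (r / 2) ⊆ Metric.ball z₀ r :=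
      Metric.ball_subset_ball' (by rw [Metric.mem_ball] at hz; linarith)
    -- Cauchy's estimate on slightly smaller circles
    refine le_of_forall_gt_imp_ge_of_dense (fun c hc => ?_)
    have hM : 0 ≤ M := (norm_nonneg _).trans (hb z₀ hz₀)
    have hev : ∀ᶠ ρ in 𝓝[<] (r / 2), M / ρ < c := by
      have : ContinuousAt (fun ρ => M / ρ) (r / 2) :=
        continuousAt_const.div continuousAt_id (by positivity)
      exact (this.tendsto.eventually_lt_const hc).filter_mono nhdsWithin_le_nhds
    have hev2 : ∀ᶠ ρ in 𝓝[<] (r / 2), 0 < ρ ∧ ρ < r / 2 :=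
      (((lt_mem_nhds (half_pos hr))).filter_mono nhdsWithin_le_nhds).and self_mem_nhdsWithin
    obtain ⟨ρ, hρ, hρ0, hρ1⟩ := (hev.and hev2).exists
    refine le_trans (Complex.norm_deriv_le_of_forall_mem_sphere_norm_le hρ0 ?_ ?_) hρ.le
    · refine DifferentiableOn.diffContOnCl (ha.mono ?_)
      exact (Metric.closure_ball_subset_closedBall.trans (Metric.closedBall_subset_ball hρ1)).trans hsub
    · intro ζ hζ
      exact hb ζ (hsub (Metric.sphere_subset_closedBall.trans (Metric.closedBall_subset_ball hρ1) hζ))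
  · filter_upwards [hder] with a ha z hz
    exact (ha z (Metric.ball_subset_ball (by linarith) hz)).mul_const _

theorem dslope_swap (f : ℂ → ℂ) (a b : ℂ) : dslope f a b = dslope f b a := by
  rcases eq_or_ne a b with rfl | h
  · rfl
  · rw [dslope_of_ne f h.symm, dslope_of_ne f h, slope_comm]

/-- On a compact subset of the domain, the divided differences of a holomorphic function are
uniformly bounded for one argument near a given point. -/
theorem exists_norm_dslope_le {Ω : Set ℂ} (hΩ : IsOpen Ω) {f : ℂ → ℂ} (hf : DifferentiableOn ℂ f Ω)
    {K : Set ℂ} (hK : IsCompact K) (hKΩ : K ⊆ Ω) {z₀ : ℂ} (hz₀ : z₀ ∈ Ω) :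
    ∃ r > 0, Metric.ball z₀ r ⊆ Ω ∧ ∃ M, ∀ w ∈ K, ∀ z ∈ Metric.ball z₀ r, ‖dslope f w z‖ ≤ M := by
  obtain ⟨R, hR, hRΩ⟩ := Metric.isOpen_iff.1 hΩ z₀ hz₀
  have hcb : Metric.closedBall z₀ (R / 2) ⊆ Ω :=
    (Metric.closedBall_subset_ball (by linarith)).trans hRΩ
  obtain ⟨M₁, hM₁⟩ := (isCompact_closedBall z₀ (R / 2)).exists_bound_of_continuousOn
    ((hf.deriv hΩ).continuousOn.mono hcb)
  obtain ⟨M₂, hM₂⟩ := (isCompact_closedBall z₀ (R / 2)).exists_bound_of_continuousOn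
    (hf.continuousOn.mono hcb)
  obtain ⟨M₃, hM₃⟩ := hK.exists_bound_of_continuousOn (hf.continuousOn.mono hKΩ)
  refine ⟨R / 4, by positivity, (Metric.ball_subset_ball (by linarith)).trans hRΩ,
    max M₁ ((M₂ + M₃) / (R / 4)), fun w hw z hz => ?_⟩
  have hz' : z ∈ Metric.closedBall z₀ (R / 2) :=
    Metric.ball_subset_closedBall (Metric.ball_subset_ball (by linarith) hz)
  rcases eq_or_ne z w with rfl | hzw
  · rw [dslope_same]; exact (hM₁ z hz').trans (le_max_left _ _)
  rw [dslope_of_ne f hzw, slope_def_field, norm_div]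
  by_cases hwb : w ∈ Metric.closedBall z₀ (R / 2)
  · refine le_trans ?_ (le_max_left _ _)
    rw [div_le_iff₀ (norm_pos_iff.2 (sub_ne_zero.2 hzw))]
    exact (convex_closedBall z₀ (R / 2)).norm_image_sub_le_of_norm_deriv_le
      (fun x hx => hf.differentiableAt (hΩ.mem_nhds (hcb hx))) hM₁ hwb hz'
  · refine le_trans ?_ (le_max_right _ _)
    have h1 : R / 4 ≤ ‖z - w‖ := by
      rw [Metric.mem_closedBall, not_le] at hwb
      rw [Metric.mem_ball] at hz
      have := dist_triangle w z z₀
      rw [← dist_eq_norm, dist_comm]; linarith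
    have h2 : ‖f z - f w‖ ≤ M₂ + M₃ := (norm_sub_le _ _).trans (add_le_add (hM₂ z hz') (hM₃ w hw))
    exact div_le_div₀ ((norm_nonneg _).trans h2) h2 (by positivity) h1

open MeasureTheory Filter Topology in
/-- Cauchy's theorem in homological form (Dixon's proof). The family `wⱼ` with the complex
densities `gⱼ` stands for a cycle; the hypothesis `hZ` says that it has index zero about the points
of `Z`, a set that contains everything outside the domain `Ω` of `f`. -/
theorem sum_integral_eq_zero_of_index_eq_zero {ι : Type*} [Fintype ι] {w g : ι → ℝ → ℂ}
    (hw : ∀ j, ContinuousOn (w j) (Set.Icc 0 1))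
    (hg : ∀ j, IntervalIntegrable (g j) volume 0 1) {Ω Z : Set ℂ} (hΩ : IsOpen Ω)
    (hwΩ : ∀ j, ∀ t ∈ Set.Icc (0 : ℝ) 1, w j t ∈ Ω) (hZo : IsOpen Z)
    (hcover : Zᶜ ⊆ Ω) (hZbdd : Bornology.IsBounded Zᶜ)
    (hwZ : ∀ j, ∀ t ∈ Set.Icc (0 : ℝ) 1, w j t ∉ Z)
    (hZ : ∀ z ∈ Z, ∑ j, ∫ t in (0 : ℝ)..1, g j t / (w j t - z) = 0)
    {f : ℂ → ℂ} (hf : DifferentiableOn ℂ f Ω) :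
    ∑ j, ∫ t in (0 : ℝ)..1, f (w j t) * g j t = 0 := by
  classical
  set μ : Measure ℝ := volume.restrict (Set.Ioc 0 1) with hμ
  have hI : ∀ F : ℝ → ℂ, ∫ t in (0 : ℝ)..1, F t = ∫ t, F t ∂μ := fun F =>
    intervalIntegral.integral_of_le zero_le_one
  have hgi : ∀ j, Integrable (g j) μ := fun j =>
    (intervalIntegrable_iff_integrableOn_Ioc_of_le zero_le_one).1 (hg j)
  have hmem : ∀ᵐ t ∂μ, t ∈ Set.Icc (0 : ℝ) 1 :=
    (ae_restrict_mem measurableSet_Ioc).mono fun t ht => Set.Ioc_subset_Icc_self ht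
  have hK : ∀ j, IsCompact (w j '' Set.Icc 0 1) := fun j => isCompact_Icc.image_of_continuousOn (hw j)
  have hKΩ : ∀ j, w j '' Set.Icc 0 1 ⊆ Ω := by rintro j _ ⟨t, ht, rfl⟩; exact hwΩ j t ht
  have hmeas : ∀ j (F : ℂ → ℂ), ContinuousOn F (w j '' Set.Icc 0 1) →
      AEStronglyMeasurable (fun t => F (w j t)) μ := fun j F hF => by
    have : ContinuousOn (fun t => F (w j t)) (Set.Icc 0 1) :=
      hF.comp (hw j) (Set.mapsTo_image _ _)
    exact (this.mono Set.Ioc_subset_Icc_self).aestronglyMeasurable measurableSet_Ioc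
  set h₁ : ℂ → ℂ := fun z => ∑ j, ∫ t, dslope f (w j t) z * g j t ∂μ with hh₁
  set h₂ : ℂ → ℂ := fun z => ∑ j, ∫ t, f (w j t) / (w j t - z) * g j t ∂μ with hh₂
  have hd₁ : ∀ z ∈ Ω, DifferentiableAt ℂ h₁ z := fun z hz => by
    refine DifferentiableAt.fun_sum fun j _ => ?_
    obtain ⟨r, hr, hrΩ, M, hM⟩ := exists_norm_dslope_le hΩ hf (hK j) (hKΩ j) hz
    refine differentiableAt_integral_of_bounded (hgi j) hr (fun z' hz' => ?_) ?_
      (hmem.mono fun t ht z' hz' => hM _ ⟨t, ht, rfl⟩ z' hz')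
    · simp_rw [fun a => dslope_swap f a z']
      exact hmeas j (fun x => dslope f z' x) (((Complex.differentiableOn_dslope
        (hΩ.mem_nhds (hrΩ hz'))).2 hf).continuousOn.mono (hKΩ j))
    · filter_upwards [hmem] with t ht
      exact ((Complex.differentiableOn_dslope (hΩ.mem_nhds (hwΩ j t ht))).2 hf).mono hrΩ
  have hsep : ∀ z ∈ Z, ∃ r > 0, ∀ z' ∈ Metric.ball z r, ∀ j, ∀ t ∈ Set.Icc (0 : ℝ) 1,
      r ≤ ‖w j t - z'‖ := fun z hz => by
    obtain ⟨R, hR, hRZ⟩ := Metric.isOpen_iff.1 hZo z hz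
    refine ⟨R / 2, half_pos hR, fun z' hz' j t ht => ?_⟩
    by_contra! hlt
    refine hwZ j t ht (hRZ ?_)
    rw [Metric.mem_ball] at hz' ⊢
    rw [← dist_eq_norm] at hlt
    linarith [dist_triangle (w j t) z' z]
  have hd₂ : ∀ z ∈ Z, DifferentiableAt ℂ h₂ z := fun z hz => by
    refine DifferentiableAt.fun_sum fun j _ => ?_
    obtain ⟨r, hr, hrw⟩ := hsep z hz
    obtain ⟨M, hM⟩ := (hK j).exists_bound_of_continuousOn (hf.continuousOn.mono (hKΩ j))
    have hne : ∀ t ∈ Set.Icc (0 : ℝ) 1, ∀ z' ∈ Metric.ball z r, w j t - z' ≠ 0 :=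
      fun t ht z' hz' => norm_pos_iff.1 (hr.trans_le (hrw z' hz' j t ht))
    refine differentiableAt_integral_of_bounded (M := M / r) (hgi j) hr (fun z' hz' => ?_) ?_ ?_
    · refine hmeas j (fun x => f x / (x - z')) ((hf.continuousOn.mono (hKΩ j)).div
        (continuousOn_id.sub continuousOn_const) ?_)
      rintro _ ⟨t, ht, rfl⟩
      exact hne t ht z' hz'
    · filter_upwards [hmem] with t ht
      exact (differentiableOn_const _).div ((differentiableOn_const _).sub differentiableOn_id)
        (fun z' hz' => hne t ht z' hz')
    · filter_upwards [hmem] with t ht z' hz'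
      rw [norm_div]
      have := hM _ ⟨t, ht, rfl⟩
      exact div_le_div₀ ((norm_nonneg _).trans this) this hr (hrw z' hz' j t ht)
  have heq : ∀ z ∈ Ω, z ∈ Z → h₁ z = h₂ z := fun z hzΩ hz => by
    obtain ⟨r, hr, hrw⟩ := hsep z hz
    have hne : ∀ j, ∀ t ∈ Set.Icc (0 : ℝ) 1, w j t - z ≠ 0 :=
      fun j t ht => norm_pos_iff.1 (hr.trans_le (hrw z (Metric.mem_ball_self hr) j t ht))
    have hcz : ∀ j, ContinuousOn (fun x => (x - z)⁻¹) (w j '' Set.Icc 0 1) := fun j => by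
      refine (continuousOn_id.sub continuousOn_const).inv₀ ?_
      rintro _ ⟨t, ht, rfl⟩; exact hne j t ht
    have hbd : ∀ j (F : ℂ → ℂ), ContinuousOn F (w j '' Set.Icc 0 1) →
        Integrable (fun t => F (w j t) * g j t) μ := fun j F hF => by
      obtain ⟨M, hM⟩ := (hK j).exists_bound_of_continuousOn hF
      exact (hgi j).bdd_mul (hmeas j F hF) (hmem.mono fun t ht => hM _ ⟨t, ht, rfl⟩)
    have key : ∀ j, ∫ t, dslope f (w j t) z * g j t ∂μ =
        ∫ t, f (w j t) / (w j t - z) * g j t ∂μ - f z * ∫ t, g j t / (w j t - z) ∂μ := fun j => by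
      rw [← integral_const_mul, ← integral_sub]
      · refine integral_congr_ae (hmem.mono fun t ht => ?_)
        have h0 := hne j t ht
        have h0' : z - w j t ≠ 0 := by rw [← neg_sub]; exact neg_ne_zero.2 h0
        have hzw : z ≠ w j t := sub_ne_zero.1 h0'
        simp only [dslope_of_ne f hzw, slope_def_field]
        field_simp
        ring
      · exact hbd j (fun x => f x / (x - z)) ((hf.continuousOn.mono (hKΩ j)).mul (hcz j))
      · have := (hbd j (fun x => (x - z)⁻¹) (hcz j)).const_mul (f z)
        refine this.congr (Eventually.of_forall fun t => ?_)
        simp only [div_eq_inv_mul]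
    have h0 := hZ z hz
    simp_rw [hI] at h0
    simp only [hh₁, hh₂, key]
    rw [Finset.sum_sub_distrib, ← Finset.mul_sum, h0, mul_zero, sub_zero]
  -- the two integrals patch together to an entire function
  set H : ℂ → ℂ := fun z => if z ∈ Z then h₂ z else h₁ z with hH
  have hHΩ : ∀ z ∈ Ω, H z = h₁ z := fun z hz => by
    by_cases h : z ∈ Z
    · simp only [hH, if_pos h, heq z hz h]
    · simp only [hH, if_neg h]
  have hHd : Differentiable ℂ H := fun z => by
    by_cases h : z ∈ Z
    · refine (hd₂ z h).congr_of_eventuallyEq ?_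
      filter_upwards [hZo.mem_nhds h] with z' hz'
      simp only [hH, if_pos hz']
    · have hzΩ : z ∈ Ω := hcover h
      refine (hd₁ z hzΩ).congr_of_eventuallyEq ?_
      filter_upwards [hΩ.mem_nhds hzΩ] with z' hz'
      exact hHΩ z' hz'
  have hZcob : ∀ᶠ z in cocompact ℂ, z ∈ Z := by
    rw [← Metric.cobounded_eq_cocompact]
    have := Bornology.isBounded_def.1 hZbdd
    rwa [compl_compl] at this
  -- `z h₂(z)` tends to `-∑ ∫ f gⱼ` at infinity, hence `h₂(z)` tends to `0`
  have hlim : Tendsto (fun z => z * h₂ z) (cocompact ℂ)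
      (𝓝 (∑ j, ∫ t, (-1 : ℂ) * (f (w j t) * g j t) ∂μ)) := by
    simp only [hh₂, Finset.mul_sum]
    refine tendsto_finsetSum _ fun j _ => ?_
    obtain ⟨M, hM⟩ := (hK j).exists_bound_of_continuousOn (hf.continuousOn.mono (hKΩ j))
    obtain ⟨B, hB⟩ := (hK j).isBounded.exists_norm_le
    simp_rw [← integral_const_mul]
    have hbig : ∀ᶠ z in cocompact ℂ, 2 * max B 1 ≤ ‖z‖ :=
      (tendsto_norm_cocompact_atTop (E := ℂ)).eventually_ge_atTop _
    have : (cocompact ℂ).IsCountablyGenerated := by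
      rw [← Metric.cobounded_eq_cocompact, ← comap_norm_atTop]; infer_instance
    refine tendsto_integral_filter_of_dominated_convergence (fun t => 2 * M * ‖g j t‖) ?_ ?_
      ((hgi j).norm.const_mul _) ?_
    · filter_upwards [hZcob] with z hz
      refine ((hmeas j (fun x => f x / (x - z)) ((hf.continuousOn.mono (hKΩ j)).div
        (continuousOn_id.sub continuousOn_const) ?_)).mul (hgi j).aestronglyMeasurable).const_mul z
      rintro _ ⟨t, ht, rfl⟩ h0
      exact hwZ j t ht (by rwa [show w j t = z from sub_eq_zero.1 h0])
    · filter_upwards [hbig] with z hz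
      filter_upwards [hmem] with t ht
      have hM' := hM _ ⟨t, ht, rfl⟩
      have hB' := hB _ ⟨t, ht, rfl⟩
      have h1 : ‖z‖ / 2 ≤ ‖w j t - z‖ := by
        have := norm_sub_norm_le z (w j t)
        rw [norm_sub_rev] at this
        linarith [le_max_left B 1]
      have hz1 : 0 < ‖z‖ := by linarith [le_max_right B 1]
      rw [norm_mul, norm_mul, ← mul_assoc, norm_div]
      refine mul_le_mul_of_nonneg_right ?_ (norm_nonneg _)
      rw [mul_div_assoc', div_le_iff₀ (by linarith)]
      have hM0 := (norm_nonneg _).trans hM'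
      nlinarith
    · filter_upwards [hmem] with t ht
      have h1 : Tendsto (fun z : ℂ => z / (w j t - z)) (cocompact ℂ) (𝓝 (-1)) := by
        have h2 : Tendsto (fun z : ℂ => w j t * (w j t - z)⁻¹ - 1) (cocompact ℂ) (𝓝 (w j t * 0 - 1)) := by
          refine (Tendsto.const_mul _ ?_).sub_const _
          refine (tendsto_inv₀_cobounded (α := ℂ)).comp ?_
          rw [Metric.cobounded_eq_cocompact]
          exact (Homeomorph.subLeft (w j t)).isClosedEmbedding.tendsto_cocompact
        rw [mul_zero, zero_sub] at h2
        refine h2.congr' ?_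
        filter_upwards [hbig, hZcob] with z hz hzZ
        have : w j t - z ≠ 0 := fun h0 => hwZ j t ht (by rwa [show w j t = z from sub_eq_zero.1 h0])
        field_simp
        ring
      refine (h1.mul_const (f (w j t) * g j t)).congr fun z => ?_
      ring
  have hlim0 : Tendsto H (cocompact ℂ) (𝓝 0) := by
    have hinv : Tendsto (fun z : ℂ => z⁻¹) (cocompact ℂ) (𝓝 0) := by
      rw [← Metric.cobounded_eq_cocompact]; exact tendsto_inv₀_cobounded
    have := hinv.mul hlim
    rw [zero_mul] at this
    refine this.congr' ?_
    have hne : ∀ᶠ z in cocompact ℂ, z ≠ (0 : ℂ) :=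
      ((tendsto_norm_cocompact_atTop (E := ℂ)).eventually_gt_atTop 0).mono fun z hz => norm_pos_iff.1 hz
    filter_upwards [hne, hZcob] with z hz hzZ
    simp only [hH, if_pos hzZ]
    field_simp
  have hzero : ∀ z, H z = 0 := fun z => hHd.apply_eq_of_tendsto_cocompact z hlim0
  have hlim' : Tendsto (fun z => z * h₂ z) (cocompact ℂ) (𝓝 0) := by
    refine tendsto_const_nhds.congr' ?_
    filter_upwards [hZcob] with z hz
    have := hzero z
    simp only [hH, if_pos hz] at this
    rw [this, mul_zero]
  have hfin := tendsto_nhds_unique hlim hlim'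
  simp_rw [integral_const_mul, ← Finset.mul_sum] at hfin
  simp_rw [hI]
  simpa using hfin

/-! ### Closed polygons -/

/-- The position on the polygon with vertices `c 0, …, c n` after the parameter time `u ∈ [0, n]`,
each edge taking unit time. -/
def polyline (c : ℕ → ℂ) (n : ℕ) (u : ℝ) : ℂ :=
  c 0 + ∑ k ∈ Finset.range n, ((max 0 (min 1 (u - k)) : ℝ) : ℂ) * (c (k + 1) - c k)

theorem continuous_polyline (c : ℕ → ℂ) (n : ℕ) : Continuous (polyline c n) := by
  unfold polyline; fun_prop

theorem polyline_eq (c : ℕ → ℂ) {n k : ℕ} (hk : k < n) {u : ℝ} (h₁ : (k : ℝ) ≤ u)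
    (h₂ : u ≤ k + 1) : polyline c n u = c k + ((u - k : ℝ) : ℂ) * (c (k + 1) - c k) := by
  have h : ∀ i ∈ Finset.range n, ((max 0 (min 1 (u - i)) : ℝ) : ℂ) * (c (i + 1) - c i) =
      (if i < k then c (i + 1) - c i else 0) +
        if i = k then ((u - k : ℝ) : ℂ) * (c (k + 1) - c k) else 0 := fun i _ => by
    rcases lt_trichotomy i k with hi | rfl | hi
    · have : (i : ℝ) + 1 ≤ k := by exact_mod_cast hi
      rw [min_eq_left (by linarith), max_eq_right zero_le_one]
      simp [hi, hi.ne]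
    · rw [min_eq_right (by linarith), max_eq_right (by linarith)]
      simp
    · have : (k : ℝ) + 1 ≤ i := by exact_mod_cast hi
      rw [max_eq_left ((min_le_right _ _).trans (by linarith))]
      simp [hi.not_gt, hi.ne']
  rw [polyline, Finset.sum_congr rfl h, Finset.sum_add_distrib, Finset.sum_ite_eq' _ k,
    if_pos (Finset.mem_range.2 hk), ← Finset.sum_filter]
  have : Finset.filter (fun i => i < k) (Finset.range n) = Finset.range k := by
    ext i; simp; omega
  rw [this, Finset.sum_range_sub c]
  ring

/-- `(b - z) / (a - z)` avoids the branch cut of the logarithm when `z` is off the segment. -/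
theorem div_mem_slitPlane_of_notMem_segment {a b z : ℂ} (hz : z ∉ segment ℝ a b) :
    (b - z) / (a - z) ∈ Complex.slitPlane := by
  have ha : a - z ≠ 0 := fun h => hz (by rw [← sub_eq_zero.1 h]; exact left_mem_segment ℝ a b)
  by_contra hn
  rw [Complex.mem_slitPlane_iff] at hn
  push Not at hn
  set q := (b - z) / (a - z) with hq
  have hqr : q = ((q.re : ℝ) : ℂ) := Complex.ext rfl (by simp [hn.2])
  have hb : b - z = q.re * (a - z) := by
    rw [← hqr, hq, div_mul_cancel₀ _ ha]
  refine hz ⟨-q.re / (1 - q.re), 1 / (1 - q.re), div_nonneg (by linarith) (by linarith),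
    div_nonneg zero_le_one (by linarith), ?_, ?_⟩
  · rw [← add_div, div_eq_one_iff_eq (by linarith)]; ring
  · have h1 : (1 - (q.re : ℂ)) ≠ 0 := by
      have : (1 - q.re) ≠ 0 := by linarith
      exact_mod_cast this
    rw [Complex.real_smul, Complex.real_smul]
    push_cast
    field_simp
    linear_combination hb

theorem add_mul_sub_mem_segment {a b : ℂ} {s : ℝ} (h₀ : 0 ≤ s) (h₁ : s ≤ 1) :
    a + (s : ℂ) * (b - a) ∈ segment ℝ a b :=
  ⟨1 - s, s, by linarith, h₀, by ring, by
    rw [Complex.real_smul, Complex.real_smul]; push_cast; ring⟩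

theorem exists_of_mem_segment {a b z : ℂ} (h : z ∈ segment ℝ a b) :
    ∃ s : ℝ, 0 ≤ s ∧ s ≤ 1 ∧ z = a + (s : ℂ) * (b - a) := by
  obtain ⟨x, y, hx, hy, hxy, rfl⟩ := h
  refine ⟨y, hy, by linarith, ?_⟩
  rw [Complex.real_smul, Complex.real_smul, show x = 1 - y by linarith]; push_cast; ring

theorem div_lineMap_mem_slitPlane {a b z : ℂ} (hz : z ∉ segment ℝ a b) {s : ℝ} (h₀ : 0 ≤ s)
    (h₁ : s ≤ 1) : (a + (s : ℂ) * (b - a) - z) / (a - z) ∈ Complex.slitPlane :=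
  div_mem_slitPlane_of_notMem_segment fun h => hz <|
    (convex_segment a b).segment_subset (left_mem_segment ℝ a b) (add_mul_sub_mem_segment h₀ h₁) h

section ClosedPolygon
variable {c : ℕ → ℂ} {n : ℕ}

theorem exists_index_of_mem_Ico (n : ℕ) {t : ℝ} (h : t ∈ Set.Ico (0 : ℝ) 1) (hn : 0 < n) :
    ∃ k < n, (k : ℝ) ≤ n * t ∧ n * t < k + 1 := by
  have hn' : (0 : ℝ) < n := by exact_mod_cast hn
  have h0 : 0 ≤ n * t := mul_nonneg hn'.le h.1
  refine ⟨⌊n * t⌋₊, (Nat.floor_lt h0).2 (by nlinarith [h.2]), Nat.floor_le h0, Nat.lt_floor_add_one _⟩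

theorem exists_Ico_of_mem_Icc (hn : 0 < n) (hc : c n = c 0) {t : ℝ} (h : t ∈ Set.Icc (0 : ℝ) 1) :
    ∃ t' ∈ Set.Ico (0 : ℝ) 1, polyline c n (n * t) = polyline c n (n * t') := by
  rcases h.2.lt_or_eq with h1 | rfl
  · exact ⟨t, ⟨h.1, h1⟩, rfl⟩
  · refine ⟨0, by simp, ?_⟩
    obtain ⟨m, rfl⟩ := Nat.exists_eq_add_of_lt hn
    rw [polyline_eq c (k := 0 + m) (by omega) (by push_cast; linarith) (by push_cast; linarith),
      polyline_eq c (k := 0) hn (by simp) (by simp)]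
    push_cast
    rw [← hc]
    ring_nf

/-- The half-open edges of a closed polygon cover it. -/
theorem exists_edge_of_mem_polyline (hn : 0 < n) (hc : c n = c 0) {z : ℂ}
    (h : z ∈ (fun t : ℝ => polyline c n (n * t)) '' Set.Icc 0 1) :
    ∃ k < n, ∃ s ∈ Set.Ico (0 : ℝ) 1, z = c k + (s : ℂ) * (c (k + 1) - c k) := by
  obtain ⟨t, ht, rfl⟩ := h
  obtain ⟨t', ht', he⟩ := exists_Ico_of_mem_Icc hn hc ht
  obtain ⟨k, hk, h1, h2⟩ := exists_index_of_mem_Ico n ht' hn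
  exact ⟨k, hk, n * t' - k, ⟨by linarith, by linarith⟩, by
    simp only [he]; exact polyline_eq c hk h1 h2.le⟩

theorem image_polyline (hn : 0 < n) (hc : c n = c 0) :
    (fun t : ℝ => polyline c n (n * t)) '' Set.Icc 0 1 =
      ⋃ k ∈ Finset.range n, segment ℝ (c k) (c (k + 1)) := by
  have hn' : (0 : ℝ) < n := by exact_mod_cast hn
  ext z
  constructor
  · intro h
    obtain ⟨k, hk, s, hs, rfl⟩ := exists_edge_of_mem_polyline hn hc h
    exact Set.mem_biUnion (Finset.mem_coe.2 (Finset.mem_range.2 hk)) (add_mul_sub_mem_segment hs.1 hs.2.le)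
  · intro h
    simp only [Set.mem_iUnion, Finset.mem_range] at h
    obtain ⟨k, hk, hz⟩ := h
    obtain ⟨s, h0, h1, rfl⟩ := exists_of_mem_segment hz
    have hk' : (k : ℝ) + 1 ≤ n := by exact_mod_cast hk
    refine ⟨(k + s) / n, ⟨by positivity, ?_⟩, ?_⟩
    · rw [div_le_one hn']; linarith
    · have : (n : ℝ) * ((k + s) / n) = k + s := by field_simp
      simp only [this]
      rw [polyline_eq c hk (by linarith) (by linarith)]
      simp

theorem isPiecewiseC1Jordan_polyline (hn : 0 < n) (hc : c n = c 0)
    (hinj : ∀ k < n, ∀ k' < n, ∀ s ∈ Set.Ico (0 : ℝ) 1, ∀ s' ∈ Set.Ico (0 : ℝ) 1,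
      c k + (s : ℂ) * (c (k + 1) - c k) = c k' + (s' : ℂ) * (c (k' + 1) - c k') →
        k = k' ∧ s = s') :
    IsPiecewiseC1Jordan fun t : ℝ => polyline c n (n * t) := by
  have hn' : (0 : ℝ) < n := by exact_mod_cast hn
  refine ⟨((continuous_polyline c n).comp (by fun_prop)).continuousOn,
    ⟨n, fun k => (k : ℕ) / n, ?_, by simp, by simp [hn'.ne'], fun k => ?_⟩, ?_, ?_⟩
  · intro k k' h
    exact div_lt_div_of_pos_right (by exact_mod_cast h) hn'
  · have : ContDiffOn ℝ 1 (fun t : ℝ => c k + ((n * t - k : ℝ) : ℂ) * (c (k + 1) - c k))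
        (Set.Icc ((k.castSucc : ℕ) / n : ℝ) ((k.succ : ℕ) / n)) := by
      refine ContDiff.contDiffOn ?_
      refine contDiff_const.add (ContDiff.mul (Complex.ofRealCLM.contDiff.comp ?_) contDiff_const)
      exact (contDiff_const.mul contDiff_id).sub contDiff_const
    refine this.congr fun t ht => ?_
    rw [Set.mem_Icc, div_le_iff₀ hn', le_div_iff₀ hn', mul_comm] at ht
    refine polyline_eq c k.2 (by simpa using ht.1) ?_
    have := ht.2
    simp only [Fin.val_succ, Nat.cast_add, Nat.cast_one] at this
    linarith
  · obtain ⟨m, rfl⟩ := Nat.exists_eq_add_of_lt hn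
    rw [polyline_eq c (k := 0 + m) (u := _ * 1) (by omega) (by push_cast; linarith) (by push_cast; linarith),
      polyline_eq c (k := 0) hn (by simp) (by simp)]
    push_cast
    rw [← hc]
    ring_nf
  · intro t ht t' ht' he
    obtain ⟨k, hk, h1, h2⟩ := exists_index_of_mem_Ico n ht hn
    obtain ⟨k', hk', h1', h2'⟩ := exists_index_of_mem_Ico n ht' hn
    simp only [polyline_eq c hk h1 h2.le, polyline_eq c hk' h1' h2'.le] at he
    obtain ⟨rfl, hs⟩ := hinj k hk k' hk' _ ⟨by linarith, by linarith⟩ _ ⟨by linarith, by linarith⟩ he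
    have : (n : ℝ) * t = n * t' := by linarith
    exact mul_left_cancel₀ hn'.ne' this

open MeasureTheory in
theorem integral_polyline (hn : 0 < n) {z : ℂ}
    (hz : ∀ k < n, z ∉ segment ℝ (c k) (c (k + 1))) :
    ∫ t in (0 : ℝ)..1, deriv (fun t : ℝ => polyline c n (n * t)) t / (polyline c n (n * t) - z) =
      ∑ k ∈ Finset.range n, Complex.log ((c (k + 1) - z) / (c k - z)) := by
  have hn' : (0 : ℝ) < n := by exact_mod_cast hn
  set γ : ℝ → ℂ := fun t => polyline c n (n * t) with hγ
  set p : ℕ → ℝ := fun k => k / n with hp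
  have hp0 : p 0 = 0 := by simp [hp]
  have hpn : p n = 1 := by simp [hp, hn'.ne']
  have hple : ∀ k, p k ≤ p (k + 1) := fun k => by
    simp only [hp]; push_cast; gcongr; linarith
  -- on the open `k`-th subinterval the integrand is that of an affine path
  set G : ℕ → ℝ → ℂ := fun k t =>
    (n * (c (k + 1) - c k)) / (c k + ((n * t - k : ℝ) : ℂ) * (c (k + 1) - c k) - z) with hG
  have hmem : ∀ k, ∀ t ∈ Set.Icc (p k) (p (k + 1)), (k : ℝ) ≤ n * t ∧ n * t ≤ k + 1 := by
    intro k t ht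
    simp only [hp, Set.mem_Icc] at ht
    rw [div_le_iff₀ hn', le_div_iff₀ hn', mul_comm] at ht
    push_cast at ht
    exact ⟨ht.1, by linarith [ht.2]⟩
  have hder : ∀ k (t : ℝ), HasDerivAt
      (fun t : ℝ => c k + ((n * t - k : ℝ) : ℂ) * (c (k + 1) - c k)) (n * (c (k + 1) - c k)) t := by
    intro k t
    have h1 : HasDerivAt (fun t : ℝ => n * t - (k : ℝ)) n t := by
      simpa using ((hasDerivAt_id t).const_mul (n : ℝ)).sub_const (k : ℝ)
    have h2 := (h1.ofReal_comp.mul_const (c (k + 1) - c k)).const_add (c k)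
    simpa using h2
  have hEq : ∀ k < n, Set.EqOn (fun t => deriv γ t / (γ t - z)) (G k) (Set.Ioo (p k) (p (k + 1))) := by
    intro k hk t ht
    have hev : γ =ᶠ[nhds t] fun t => c k + ((n * t - k : ℝ) : ℂ) * (c (k + 1) - c k) := by
      filter_upwards [isOpen_Ioo.mem_nhds ht] with t' ht'
      have := hmem k t' (Set.Ioo_subset_Icc_self ht')
      exact polyline_eq c hk this.1 this.2
    simp only [hG]
    rw [hev.deriv_eq, (hder k t).deriv, hev.self_of_nhds]
  have hslit : ∀ k < n, ∀ t ∈ Set.Icc (p k) (p (k + 1)),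
      (c k + ((n * t - k : ℝ) : ℂ) * (c (k + 1) - c k) - z) / (c k - z) ∈ Complex.slitPlane := by
    intro k hk t ht
    have := hmem k t ht
    exact div_lineMap_mem_slitPlane (hz k hk) (by linarith) (by linarith)
  have hne : ∀ k < n, c k - z ≠ 0 := fun k hk h => hz k hk (by
    rw [← sub_eq_zero.1 h]; exact left_mem_segment ℝ _ _)
  have hGc : ∀ k < n, ContinuousOn (G k) (Set.Icc (p k) (p (k + 1))) := by
    intro k hk
    refine continuousOn_const.div (by fun_prop) fun t ht h => ?_
    have := hslit k hk t ht
    rw [h, zero_div] at this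
    exact Complex.zero_notMem_slitPlane this
  have hGi : ∀ k < n, IntervalIntegrable (G k) volume (p k) (p (k + 1)) := fun k hk =>
    ContinuousOn.intervalIntegrable (by rw [Set.uIcc_of_le (hple k)]; exact hGc k hk)
  have hint : ∀ k < n, IntervalIntegrable (fun t => deriv γ t / (γ t - z)) volume (p k) (p (k + 1)) := by
    intro k hk
    refine (hGi k hk).congr_ae ?_
    rw [Filter.EventuallyEq, Set.uIoc_of_le (hple k), ae_restrict_iff' measurableSet_Ioc]
    filter_upwards [Measure.ae_ne volume (p (k + 1))] with t h1 h2
    exact (hEq k hk ⟨h2.1, lt_of_le_of_ne h2.2 h1⟩).symm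
  have hsum := intervalIntegral.sum_integral_adjacent_intervals hint
  rw [hp0, hpn] at hsum
  rw [← hsum]
  refine Finset.sum_congr rfl fun k hk => ?_
  have hk := Finset.mem_range.1 hk
  rw [intervalIntegral.integral_congr_Ioo_of_le (hple k) (hEq k hk)]
  have hprim : ∀ t ∈ Set.uIcc (p k) (p (k + 1)), HasDerivAt (fun t : ℝ => Complex.log
      ((c k + ((n * t - k : ℝ) : ℂ) * (c (k + 1) - c k) - z) / (c k - z))) (G k t) t := by
    intro t ht
    rw [Set.uIcc_of_le (hple k)] at ht
    have hs := hslit k hk t ht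
    have h := (((hder k t).sub_const z).div_const (c k - z)).clog_real hs
    convert h using 1
    simp only [hG]
    have hne' : c k + ((n * t - k : ℝ) : ℂ) * (c (k + 1) - c k) - z ≠ 0 := fun h => by
      rw [h, zero_div] at hs; exact Complex.zero_notMem_slitPlane hs
    have := hne k hk
    field_simp
  rw [intervalIntegral.integral_eq_sub_of_hasDerivAt hprim (hGi k hk)]
  have e1 : (n : ℝ) * p (k + 1) - k = 1 := by simp only [hp]; push_cast; field_simp; ring
  have e2 : (n : ℝ) * p k - k = 0 := by simp only [hp]; field_simp; ring
  simp only [e1, e2]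
  simp [div_self (hne k hk)]

end ClosedPolygon

/-- A finite set of directed edges whose successor map is a permutation and whose half-open edges
are pairwise disjoint decomposes into disjoint closed polygonal Jordan curves, one for each cycle
of the permutation. -/
theorem exists_jordan_family {B : Type*} [Fintype B] [Nonempty B] (σ : Equiv.Perm B) (a : B → ℂ)
    (hinj : ∀ b b' : B, ∀ s ∈ Set.Ico (0 : ℝ) 1, ∀ s' ∈ Set.Ico (0 : ℝ) 1,
      a b + (s : ℂ) * (a (σ b) - a b) = a b' + (s' : ℂ) * (a (σ b') - a b') → b = b' ∧ s = s') :
    ∃ (N : ℕ) (γ : Fin N → ℝ → ℂ), 0 < N ∧ (∀ j, IsPiecewiseC1Jordan (γ j)) ∧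
      (∀ j k, j ≠ k → Disjoint (γ j '' Set.Icc 0 1) (γ k '' Set.Icc 0 1)) ∧
      (⋃ j, γ j '' Set.Icc 0 1) = ⋃ b, segment ℝ (a b) (a (σ b)) ∧
      ∀ z, (∀ b, z ∉ segment ℝ (a b) (a (σ b))) →
        ∑ j, ∫ t in (0 : ℝ)..1, deriv (γ j) t / (γ j t - z) =
          ∑ b, Complex.log ((a (σ b) - z) / (a b - z)) := by
  classical
  let Q := Quotient (Equiv.Perm.SameCycle.setoid σ)
  let _ : Fintype Q := Quotient.fintype _
  have hQ : Nonempty Q := ‹Nonempty B›.map (Quotient.mk _)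
  let r : Q → B := Quotient.out
  let m : Q → ℕ := fun q => Function.minimalPeriod σ (r q)
  have hm : ∀ q, 0 < m q := fun q => Function.minimalPeriod_pos_of_mem_periodicPts
    (Function.Injective.mem_periodicPts σ.injective _)
  let c : Q → ℕ → ℂ := fun q k => a (σ^[k] (r q))
  have hc1 : ∀ q k, c q (k + 1) = a (σ (σ^[k] (r q))) := fun q k => by
    simp only [c, Function.iterate_succ_apply']
  have hcn : ∀ q, c q (m q) = c q 0 := fun q => by
    simp only [c, m, Function.iterate_minimalPeriod, Function.iterate_zero, id]
  have hcls : ∀ q k, (Quotient.mk (Equiv.Perm.SameCycle.setoid σ) (σ^[k] (r q))) = q := fun q k => by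
    conv_rhs => rw [← Quotient.out_eq q]
    refine Quotient.sound (Equiv.Perm.SameCycle.symm ⟨k, ?_⟩)
    rw [zpow_natCast, Equiv.Perm.iterate_eq_pow]
  have hinjk : ∀ q, ∀ k < m q, ∀ k' < m q, σ^[k] (r q) = σ^[k'] (r q) → k = k' := fun q k hk k' hk' h =>
    Function.iterate_injOn_Iio_minimalPeriod (Set.mem_Iio.2 hk) (Set.mem_Iio.2 hk') h
  have hsurj : ∀ b, ∃ q, ∃ k < m q, σ^[k] (r q) = b := fun b => by
    have : Equiv.Perm.SameCycle σ (r (Quotient.mk _ b)) b :=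
      Quotient.mk_out (s := Equiv.Perm.SameCycle.setoid σ) b
    obtain ⟨k, -, -, hk⟩ := this.exists_pow_eq''
    refine ⟨Quotient.mk _ b, k % m _, Nat.mod_lt _ (hm _), ?_⟩
    simp only [m]
    rw [Function.iterate_mod_minimalPeriod_eq, Equiv.Perm.iterate_eq_pow]
    exact hk
  let e : Fin (Fintype.card Q) ≃ Q := (Fintype.equivFin Q).symm
  have hsums : ∀ F : B → ℂ, ∑ b, F b = ∑ q, ∑ k ∈ Finset.range (m q), F (σ^[k] (r q)) := fun F => by
    rw [Finset.sum_sigma']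
    symm
    refine Finset.sum_bij (fun x _ => σ^[x.2] (r x.1)) (fun _ _ => Finset.mem_univ _) ?_ ?_ (fun _ _ => rfl)
    · rintro ⟨q, k⟩ hk ⟨q', k'⟩ hk' h
      simp only [Finset.mem_sigma, Finset.mem_univ, Finset.mem_range, true_and] at hk hk'
      have hq : q = q' := by rw [← hcls q k, ← hcls q' k']; exact congrArg _ h
      subst hq
      rw [hinjk q k hk k' hk' h]
    · intro b _
      obtain ⟨q, k, hk, h⟩ := hsurj b
      exact ⟨⟨q, k⟩, by simpa using hk, h⟩
  refine ⟨Fintype.card Q, fun j t => polyline (c (e j)) (m (e j)) (m (e j) * t), Fintype.card_pos,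
    fun j => ?_, fun j j' hjj => ?_, ?_, fun z hz => ?_⟩
  · refine isPiecewiseC1Jordan_polyline (hm _) (hcn _) fun k hk k' hk' s hs s' hs' h => ?_
    rw [hc1, hc1] at h
    obtain ⟨h1, h2⟩ := hinj _ _ s hs s' hs' h
    exact ⟨hinjk _ k hk k' hk' h1, h2⟩
  · rw [Set.disjoint_left]
    intro z hz hz'
    obtain ⟨k, hk, s, hs, rfl⟩ := exists_edge_of_mem_polyline (hm _) (hcn _) hz
    obtain ⟨k', hk', s', hs', h⟩ := exists_edge_of_mem_polyline (hm _) (hcn _) hz'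
    rw [hc1, hc1] at h
    refine hjj (e.injective ?_)
    rw [← hcls (e j) k, ← hcls (e j') k', (hinj _ _ s hs s' hs' h).1]
  · ext z
    simp only [Set.mem_iUnion]
    constructor
    · rintro ⟨j, hj⟩
      rw [image_polyline (hm _) (hcn _)] at hj
      simp only [Set.mem_iUnion, hc1] at hj
      obtain ⟨k, -, hk⟩ := hj
      exact ⟨_, hk⟩
    · rintro ⟨b, hb⟩
      obtain ⟨q, k, hk, rfl⟩ := hsurj b
      refine ⟨e.symm q, ?_⟩
      rw [image_polyline (hm _) (hcn _)]
      simp only [Set.mem_iUnion, hc1]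
      exact ⟨k, by simpa using hk, by simpa [c] using hb⟩
  · rw [hsums, ← e.sum_comp]
    refine Finset.sum_congr rfl fun j _ => ?_
    rw [integral_polyline (hm _) fun k _ => by rw [hc1]; exact hz _]
    simp only [hc1]
    rfl

/-! ### The hexagonal tiling of the plane -/

/-- The six nearest neighbours of the origin in the hexagonal lattice, in the lattice coordinates
`(p, q) ↦ p + q exp(iπ/3)` and in counterclockwise order. -/
def hexDir : ZMod 6 → ℤ × ℤ :=
  fun i => (![(1, 0), (0, 1), (-1, 1), (-1, 0), (0, -1), (1, -1)] : Fin 6 → ℤ × ℤ) i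

/-- The lattice point `p + q exp(iπ/3)`. -/
def hexPt (t : ℤ × ℤ) : ℂ := ⟨t.1 + t.2 / 2, t.2 * (√3 / 2)⟩

/-- The real linear form `w ↦ 2 Re (w ū)`, where `u` is the lattice point `hexDir i`. -/
def hexForm (i : ZMod 6) : ℂ →L[ℝ] ℝ :=
  (2 * (hexDir i).1 + (hexDir i).2 : ℝ) • Complex.reCLM + ((hexDir i).2 * √3 : ℝ) • Complex.imCLM

theorem hexForm_apply (i : ZMod 6) (w : ℂ) :
    hexForm i w = (2 * (hexDir i).1 + (hexDir i).2) * w.re + (hexDir i).2 * √3 * w.im := by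
  simp [hexForm]

/-- The values of twice the Euclidean inner product on the lattice. -/
def hexDot (s t : ℤ × ℤ) : ℤ := (2 * s.1 + s.2) * t.1 + (s.1 + 2 * s.2) * t.2

theorem hexPt_add (s t : ℤ × ℤ) : hexPt (s + t) = hexPt s + hexPt t := by
  apply Complex.ext <;> simp [hexPt] <;> ring

theorem hexPt_sub (s t : ℤ × ℤ) : hexPt (s - t) = hexPt s - hexPt t := by
  apply Complex.ext <;> simp [hexPt] <;> ring

theorem hexPt_neg (t : ℤ × ℤ) : hexPt (-t) = -hexPt t := by
  rw [← zero_sub, hexPt_sub]; simp [hexPt, Complex.ext_iff]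

theorem hexForm_hexPt (i : ZMod 6) (t : ℤ × ℤ) : hexForm i (hexPt t) = hexDot (hexDir i) t := by
  have h3 : √3 * √3 = (3 : ℝ) := Real.mul_self_sqrt (by norm_num)
  rw [hexForm_apply]
  simp only [hexPt, hexDot]
  push_cast
  linear_combination ((hexDir i).2 * t.2 / 2 : ℝ) * h3

theorem hexDir_add_one (i : ZMod 6) : hexDir (i + 1) = hexDir i + hexDir (i + 2) := by
  revert i; decide

theorem hexDir_add_three (i : ZMod 6) : hexDir (i + 3) = -hexDir i := by
  revert i; decide

theorem hexForm_add_one (i : ZMod 6) (w : ℂ) :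
    hexForm (i + 1) w = hexForm i w + hexForm (i + 2) w := by
  simp only [hexForm_apply, hexDir_add_one i, Prod.fst_add, Prod.snd_add]
  push_cast; ring

theorem hexForm_add_three (i : ZMod 6) (w : ℂ) : hexForm (i + 3) w = -hexForm i w := by
  simp only [hexForm_apply, hexDir_add_three i, Prod.fst_neg, Prod.snd_neg]
  push_cast; ring

theorem add_five_eq_sub_one (i : ZMod 6) : i + 5 = i - 1 := by
  revert i; decide

/-- All six forms in terms of two consecutive ones. -/
theorem hexForm_consecutive (i : ZMod 6) (w : ℂ) :
    hexForm (i + 2) w = hexForm (i + 1) w - hexForm i w ∧ hexForm (i + 3) w = -hexForm i w ∧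
      hexForm (i + 4) w = -hexForm (i + 1) w ∧
      hexForm (i + 5) w = hexForm i w - hexForm (i + 1) w ∧
      hexForm (i - 1) w = hexForm i w - hexForm (i + 1) w := by
  have h1 := hexForm_add_one i w
  have h3 := hexForm_add_three i w
  have h4 := hexForm_add_three (i + 1) w
  have h5 := hexForm_add_three (i + 2) w
  have e4 : i + 1 + 3 = i + 4 := by ring
  have e5 : i + 2 + 3 = i + 5 := by ring
  have e6 : i + 5 = i - 1 := add_five_eq_sub_one i
  rw [e4] at h4
  rw [e5] at h5
  rw [← e6]
  exact ⟨by linarith, h3, h4, by linarith, by linarith⟩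

theorem zmod_six_cases (i j : ZMod 6) :
    j = i ∨ j = i + 1 ∨ j = i + 2 ∨ j = i + 3 ∨ j = i + 4 ∨ j = i + 5 := by
  revert i j; decide

theorem eq_of_hexForm_eq {i : ZMod 6} {w w' : ℂ} (h₀ : hexForm i w = hexForm i w')
    (h₁ : hexForm (i + 1) w = hexForm (i + 1) w') : w = w' := by
  have key : ∀ j, hexForm j w = hexForm j w' := fun j => by
    obtain ⟨a2, a3, a4, a5, -⟩ := hexForm_consecutive i w
    obtain ⟨b2, b3, b4, b5, -⟩ := hexForm_consecutive i w'
    rcases zmod_six_cases i j with rfl | rfl | rfl | rfl | rfl | rfl <;> linarith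
  have e0 := key 0
  have e1 := key 1
  have d0 : hexDir 0 = (1, 0) := rfl
  have d1 : hexDir 1 = (0, 1) := rfl
  simp only [hexForm_apply, d0, d1] at e0 e1
  have h3 : (0 : ℝ) < √3 := by positivity
  have hre : w.re = w'.re := by push_cast at e0; linarith
  refine Complex.ext hre ?_
  push_cast at e1
  rw [hre] at e1
  have : √3 * w.im = √3 * w'.im := by linarith
  exact mul_left_cancel₀ h3.ne' this

/-- A lattice vector all of whose six products are at most `2` is zero or a nearest neighbour. -/
theorem eq_hexDir_of_hexDot_le {t : ℤ × ℤ} (ht : t ≠ 0) (h : ∀ i, hexDot (hexDir i) t ≤ 2) :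
    ∃ i, t = hexDir i := by
  obtain ⟨p, q⟩ := t
  have h0 := h 0; have h1 := h 1; have h2 := h 2; have h3 := h 3; have h4 := h 4; have h5 := h 5
  have e0 : hexDir 0 = (1, 0) := rfl
  have e1 : hexDir 1 = (0, 1) := rfl
  have e2 : hexDir 2 = (-1, 1) := rfl
  have e3 : hexDir 3 = (-1, 0) := rfl
  have e4 : hexDir 4 = (0, -1) := rfl
  have e5 : hexDir 5 = (1, -1) := rfl
  simp only [hexDot, e0, e1, e2, e3, e4, e5] at h0 h1 h2 h3 h4 h5
  have hp : -1 ≤ p ∧ p ≤ 1 := by omega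
  have hq : -1 ≤ q ∧ q ≤ 1 := by omega
  obtain ⟨hp0, hp1⟩ := hp
  obtain ⟨hq0, hq1⟩ := hq
  have hpq : (p, q) ≠ (0, 0) := ht
  interval_cases p <;> interval_cases q <;> first
    | omega | exact absurd rfl hpq
    | exact ⟨0, rfl⟩ | exact ⟨1, rfl⟩ | exact ⟨2, rfl⟩
    | exact ⟨3, rfl⟩ | exact ⟨4, rfl⟩ | exact ⟨5, rfl⟩

section Tiles
variable (δ : ℝ)

/-- The centre of the tile with lattice coordinates `t`. -/
def hexCenter (t : ℤ × ℤ) : ℂ := δ * hexPt t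

/-- The closed hexagonal tile around `hexCenter δ t`. -/
def hexTile (t : ℤ × ℤ) : Set ℂ := {z | ∀ i, hexForm i (z - hexCenter δ t) ≤ δ}

/-- The open hexagonal tile. -/
def hexOpen (t : ℤ × ℤ) : Set ℂ := {z | ∀ i, hexForm i (z - hexCenter δ t) < δ}

/-- The vertex of the tile `t` between its sides `i - 1` and `i`; the side `i` faces the neighbour
in direction `hexDir i` and joins the vertices `i` and `i + 1`. -/
def hexVert (t : ℤ × ℤ) (i : ZMod 6) : ℂ :=
  hexCenter δ t + δ / 3 * (hexPt (hexDir (i - 1)) + hexPt (hexDir i))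

variable {δ}

theorem hexForm_real_mul (i : ZMod 6) (r : ℝ) (w : ℂ) : hexForm i (r * w) = r * hexForm i w := by
  rw [← Complex.real_smul, map_smul, smul_eq_mul]

theorem hexForm_sub_center (i : ZMod 6) (z : ℂ) (t s : ℤ × ℤ) :
    hexForm i (z - hexCenter δ (t + s)) =
      hexForm i (z - hexCenter δ t) - δ * hexDot (hexDir i) s := by
  have : z - hexCenter δ (t + s) = (z - hexCenter δ t) - δ * hexPt s := by
    simp only [hexCenter, hexPt_add]; ring
  rw [this, map_sub, hexForm_real_mul, hexForm_hexPt]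

theorem hexDot_hexDir (i : ZMod 6) : hexDot (hexDir i) (hexDir i) = 2 ∧
    hexDot (hexDir (i + 1)) (hexDir i) = 1 ∧ hexDot (hexDir (i - 1)) (hexDir i) = 1 ∧
    hexDot (hexDir (i + 1)) (hexDir (i - 1)) = -1 ∧ hexDot (hexDir i) (hexDir (i + 1)) = 1 ∧
    hexDot (hexDir i) (hexDir (i - 1)) = 1 ∧ hexDot (hexDir (i + 1)) (hexDir (i + 1)) = 2 := by
  revert i; decide

/-- Coordinates of a point of the side `i`, run through clockwise. -/
theorem hexForm_side (t : ℤ × ℤ) (i : ZMod 6) (s : ℝ) :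
    hexForm i (hexVert δ t (i + 1) + (s : ℂ) * (hexVert δ t i - hexVert δ t (i + 1)) -
        hexCenter δ t) = δ ∧
      hexForm (i + 1) (hexVert δ t (i + 1) + (s : ℂ) * (hexVert δ t i - hexVert δ t (i + 1)) -
        hexCenter δ t) = δ * (1 - s) := by
  have : hexVert δ t (i + 1) + (s : ℂ) * (hexVert δ t i - hexVert δ t (i + 1)) - hexCenter δ t =
      ((δ / 3 : ℝ) : ℂ) * ((hexPt (hexDir i) + hexPt (hexDir (i + 1))) +
        (s : ℂ) * (hexPt (hexDir (i - 1)) - hexPt (hexDir (i + 1)))) := by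
    simp only [hexVert, add_sub_cancel_right]; push_cast; ring
  rw [this]
  simp only [map_add, map_sub, hexForm_hexPt, hexForm_real_mul]
  obtain ⟨h1, h2, h3, h4, h5, h6, h7⟩ := hexDot_hexDir i
  simp only [h1, h2, h4, h5, h6, h7]
  push_cast
  constructor <;> ring

theorem hexOpen_subset (t : ℤ × ℤ) : hexOpen δ t ⊆ hexTile δ t := fun _ h i => (h i).le

theorem isOpen_hexOpen (t : ℤ × ℤ) : IsOpen (hexOpen δ t) := by
  simp only [hexOpen, Set.ofPred_forall]
  exact isOpen_iInter_of_finite fun i => isOpen_lt (by fun_prop) continuous_const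

theorem isClosed_hexTile (t : ℤ × ℤ) : IsClosed (hexTile δ t) := by
  simp only [hexTile, Set.ofPred_forall]
  exact isClosed_iInter fun i => isClosed_le (by fun_prop) continuous_const

theorem hexCenter_mem_hexOpen (hδ : 0 < δ) (t : ℤ × ℤ) : hexCenter δ t ∈ hexOpen δ t := fun i => by
  simpa using hδ

theorem convex_hexOpen (t : ℤ × ℤ) : Convex ℝ (hexOpen δ t) := by
  simp only [hexOpen, Set.ofPred_forall]
  refine convex_iInter fun i x hx y hy a b ha hb hab => ?_
  simp only [Set.mem_ofPred_eq, map_sub, map_add, map_smul, smul_eq_mul] at *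
  have h := convex_Iio (𝕜 := ℝ) (δ + hexForm i (hexCenter δ t))
    (show hexForm i x ∈ Set.Iio _ by rw [Set.mem_Iio]; linarith)
    (show hexForm i y ∈ Set.Iio _ by rw [Set.mem_Iio]; linarith) ha hb hab
  simp only [smul_eq_mul, Set.mem_Iio] at h
  linarith

/-- The segment from the centre to a point of the tile lies in the open tile, up to its endpoint. -/
theorem lineMap_mem_hexOpen (hδ : 0 < δ) {t : ℤ × ℤ} {z : ℂ} (hz : z ∈ hexTile δ t) {s : ℝ}
    (h₀ : 0 ≤ s) (h₁ : s < 1) : hexCenter δ t + (s : ℂ) * (z - hexCenter δ t) ∈ hexOpen δ t := by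
  intro i
  rw [add_sub_cancel_left, hexForm_real_mul]
  nlinarith [hz i]

theorem hexTile_subset_closure (hδ : 0 < δ) (t : ℤ × ℤ) : hexTile δ t ⊆ closure (hexOpen δ t) := by
  intro z hz
  have hcont : Filter.Tendsto (fun s : ℝ => hexCenter δ t + (s : ℂ) * (z - hexCenter δ t))
      (nhdsWithin 1 (Set.Iio 1)) (nhds z) := by
    have : Continuous fun s : ℝ => hexCenter δ t + (s : ℂ) * (z - hexCenter δ t) := by fun_prop
    have h := (this.tendsto 1).mono_left (nhdsWithin_le_nhds (s := Set.Iio 1))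
    simpa using h
  refine mem_closure_of_tendsto hcont ?_
  have h0 : ∀ᶠ s in nhdsWithin (1 : ℝ) (Set.Iio 1), 0 < s :=
    (lt_mem_nhds one_pos).filter_mono nhdsWithin_le_nhds
  filter_upwards [h0, self_mem_nhdsWithin] with s h0 h1
  exact lineMap_mem_hexOpen hδ hz h0.le h1

/-- Two distinct tiles that meet are neighbours, and they meet in the common side. -/
theorem exists_neighbour (hδ : 0 < δ) {t t' : ℤ × ℤ} (hne : t ≠ t') {z : ℂ} (hz : z ∈ hexTile δ t)
    (hz' : z ∈ hexTile δ t') : ∃ i, t' = t + hexDir i ∧ hexForm i (z - hexCenter δ t) = δ := by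
  have ht' : t' = t + (t' - t) := by abel
  have hform : ∀ i, hexForm i (z - hexCenter δ t') =
      hexForm i (z - hexCenter δ t) - δ * hexDot (hexDir i) (t' - t) := fun i => by
    conv_lhs => rw [ht']
    exact hexForm_sub_center i z t _
  have hle : ∀ i, hexDot (hexDir i) (t' - t) ≤ 2 := fun i => by
    have h1 := hz i
    have h2 := hz' (i + 3)
    rw [hexForm_add_three, hform] at h2
    have : δ * (hexDot (hexDir i) (t' - t) : ℝ) ≤ δ * 2 := by linarith
    have := le_of_mul_le_mul_left this hδ
    exact_mod_cast this
  obtain ⟨i, hi⟩ := eq_hexDir_of_hexDot_le (sub_ne_zero.2 hne.symm) hle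
  refine ⟨i, by rw [← hi]; abel, le_antisymm (hz i) ?_⟩
  have h2 := hz' (i + 3)
  rw [hexForm_add_three, hform, hi, (hexDot_hexDir i).1] at h2
  push_cast at h2
  linarith

theorem eq_of_mem_hexOpen (hδ : 0 < δ) {t t' : ℤ × ℤ} {z : ℂ} (hz : z ∈ hexOpen δ t)
    (hz' : z ∈ hexTile δ t') : t = t' := by
  by_contra hne
  obtain ⟨i, -, hi⟩ := exists_neighbour hδ hne (hexOpen_subset t hz) hz'
  exact (hz i).ne hi

/-- A point of a tile where two forms attain their maximum is the vertex between two adjacent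
sides. -/
theorem adjacent_of_hexForm_eq (hδ : 0 < δ) {t : ℤ × ℤ} {z : ℂ} (hz : z ∈ hexTile δ t)
    {i j : ZMod 6} (hij : j ≠ i) (hi : hexForm i (z - hexCenter δ t) = δ)
    (hj : hexForm j (z - hexCenter δ t) = δ) : j = i + 1 ∨ j = i - 1 := by
  have h1 := hz (i + 1)
  have h5 := hz (i - 1)
  obtain ⟨a2, a3, a4, a5, a6⟩ := hexForm_consecutive i (z - hexCenter δ t)
  rcases zmod_six_cases i j with rfl | rfl | rfl | rfl | rfl | rfl
  · exact absurd rfl hij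
  · exact Or.inl rfl
  · linarith
  · linarith
  · linarith
  · exact Or.inr (add_five_eq_sub_one i)

theorem mem_hexTile_iff {t : ℤ × ℤ} {z : ℂ} (i : ZMod 6) : z ∈ hexTile δ t ↔
    |hexForm i (z - hexCenter δ t)| ≤ δ ∧ |hexForm (i + 1) (z - hexCenter δ t)| ≤ δ ∧
      |hexForm i (z - hexCenter δ t) - hexForm (i + 1) (z - hexCenter δ t)| ≤ δ := by
  obtain ⟨a2, a3, a4, a5, -⟩ := hexForm_consecutive i (z - hexCenter δ t)
  simp only [abs_le]
  constructor
  · intro h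
    have h0 := h i; have h1 := h (i + 1); have h2 := h (i + 2); have h3 := h (i + 3)
    have h4 := h (i + 4); have h5 := h (i + 5)
    exact ⟨⟨by linarith, h0⟩, ⟨by linarith, h1⟩, by linarith, by linarith⟩
  · rintro ⟨⟨h1, h2⟩, ⟨h3, h4⟩, h5, h6⟩ j
    rcases zmod_six_cases i j with rfl | rfl | rfl | rfl | rfl | rfl <;> linarith

/-- The side `i` consists of the points of the tile where the form `i` is maximal. -/
theorem segment_hexVert (hδ : 0 < δ) (t : ℤ × ℤ) (i : ZMod 6) :
    segment ℝ (hexVert δ t (i + 1)) (hexVert δ t i) =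
      {z ∈ hexTile δ t | hexForm i (z - hexCenter δ t) = δ} := by
  ext z
  constructor
  · intro h
    obtain ⟨s, h0, h1, rfl⟩ := exists_of_mem_segment h
    obtain ⟨e0, e1⟩ := hexForm_side (δ := δ) t i s
    refine ⟨(mem_hexTile_iff i).2 ?_, e0⟩
    rw [e0, e1]
    simp only [abs_le]
    exact ⟨⟨by linarith, le_rfl⟩, ⟨by nlinarith, by nlinarith⟩, by nlinarith, by nlinarith⟩
  · rintro ⟨hz, hi⟩
    set s : ℝ := 1 - hexForm (i + 1) (z - hexCenter δ t) / δ with hs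
    have h1 := hz (i + 1)
    have h5 := hz (i - 1)
    obtain ⟨-, -, -, -, a6⟩ := hexForm_consecutive i (z - hexCenter δ t)
    have hs0 : 0 ≤ s := by rw [hs, sub_nonneg, div_le_one hδ]; exact h1
    have hs1 : s ≤ 1 := by
      rw [hs]; have : 0 ≤ hexForm (i + 1) (z - hexCenter δ t) / δ := div_nonneg (by linarith) hδ.le
      linarith
    obtain ⟨e0, e1⟩ := hexForm_side (δ := δ) t i s
    have : z - hexCenter δ t = hexVert δ t (i + 1) + (s : ℂ) * (hexVert δ t i - hexVert δ t (i + 1)) -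
        hexCenter δ t := by
      refine eq_of_hexForm_eq (i := i) (hi.trans e0.symm) ?_
      rw [e1, hs]; field_simp; ring
    rw [sub_left_inj] at this
    rw [this]
    exact add_mul_sub_mem_segment hs0 hs1

theorem mem_hexTile_neighbour {t : ℤ × ℤ} {i : ZMod 6} {z : ℂ} (hz : z ∈ hexTile δ t)
    (hi : hexForm i (z - hexCenter δ t) = δ) : z ∈ hexTile δ (t + hexDir i) := by
  rw [mem_hexTile_iff i] at hz ⊢
  simp only [hexForm_sub_center, (hexDot_hexDir i).1, (hexDot_hexDir i).2.1, hi, abs_le] at hz ⊢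
  push_cast
  obtain ⟨⟨h1, h2⟩, ⟨h3, h4⟩, h5, h6⟩ := hz
  exact ⟨⟨by linarith, by linarith⟩, ⟨by linarith, by linarith⟩, by linarith, by linarith⟩

theorem exists_mem_hexTile (hδ : 0 < δ) (z : ℂ) : ∃ t, z ∈ hexTile δ t := by
  have h3 : √3 * √3 = (3 : ℝ) := Real.mul_self_sqrt (by norm_num)
  have h3' : (0 : ℝ) < √3 := by positivity
  -- lattice coordinates of `z / δ`, and their fractional parts
  set y : ℝ := 2 * z.im / (√3 * δ) with hy
  set x : ℝ := z.re / δ - y / 2 with hx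
  have hz0 : ∀ t : ℤ × ℤ, hexForm 0 (z - hexCenter δ t) = δ * (2 * (x - t.1) + (y - t.2)) := fun t => by
    have d0 : hexDir 0 = (1, 0) := rfl
    simp only [hexForm_apply, d0, hexCenter, hexPt, hx, Complex.sub_re, Complex.mul_re,
      Complex.ofReal_re, Complex.ofReal_im]
    push_cast
    field_simp
    ring
  have hz1 : ∀ t : ℤ × ℤ, hexForm 1 (z - hexCenter δ t) = δ * ((x - t.1) + 2 * (y - t.2)) := fun t => by
    have d0 : hexDir 1 = (0, 1) := rfl
    have hyi : √3 * z.im = δ * y * (3 / 2) := by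
      rw [hy]; field_simp; linear_combination z.im * h3
    have hxr : z.re = δ * (x + y / 2) := by rw [hx]; field_simp; ring
    simp only [hexForm_apply, d0, hexCenter, hexPt, Complex.sub_re, Complex.mul_re, Complex.sub_im,
      Complex.mul_im, Complex.ofReal_re, Complex.ofReal_im]
    push_cast
    linear_combination hyi + hxr - δ * t.2 / 2 * h3
  suffices h : ∃ t : ℤ × ℤ, |2 * (x - t.1) + (y - t.2)| ≤ 1 ∧ |(x - t.1) + 2 * (y - t.2)| ≤ 1 ∧
      |(x - t.1) - (y - t.2)| ≤ 1 by
    obtain ⟨t, h0, h1, h2⟩ := h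
    refine ⟨t, (mem_hexTile_iff 0).2 ?_⟩
    rw [zero_add, hz0, hz1, ← mul_sub, abs_mul, abs_mul, abs_mul, abs_of_pos hδ]
    refine ⟨by nlinarith, by nlinarith, ?_⟩
    have : (2 * (x - t.1) + (y - t.2)) - ((x - t.1) + 2 * (y - t.2)) = (x - t.1) - (y - t.2) := by ring
    rw [this]
    nlinarith
  have x0 := Int.floor_le x
  have x1 := Int.lt_floor_add_one x
  have y0 := Int.floor_le y
  have y1 := Int.lt_floor_add_one y
  simp only [abs_le]
  set a := ⌊x⌋
  set b := ⌊y⌋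
  by_cases hA : 2 * (x - a) + (y - b) ≤ 1 ∧ (x - a) + 2 * (y - b) ≤ 1
  · exact ⟨(a, b), ⟨by linarith, by linarith⟩, ⟨by linarith, by linarith⟩, by linarith, by linarith⟩
  by_cases hB : 2 ≤ 2 * (x - a) + (y - b) ∧ 2 ≤ (x - a) + 2 * (y - b)
  · refine ⟨(a + 1, b + 1), ?_⟩
    push_cast
    exact ⟨⟨by linarith, by linarith⟩, ⟨by linarith, by linarith⟩, by linarith, by linarith⟩
  rcases le_total (y - b) (x - a) with h | h
  · have hA' : 1 < 2 * (x - a) + (y - b) := by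
      by_contra hc
      exact hA ⟨by linarith, by linarith⟩
    have hB' : (x - a) + 2 * (y - b) < 2 := by
      by_contra hc
      exact hB ⟨by linarith, by linarith⟩
    refine ⟨(a + 1, b), ?_⟩
    push_cast
    exact ⟨⟨by linarith, by linarith⟩, ⟨by linarith, by linarith⟩, by linarith, by linarith⟩
  · have hA' : 1 < (x - a) + 2 * (y - b) := by
      by_contra hc
      exact hA ⟨by linarith, by linarith⟩
    have hB' : 2 * (x - a) + (y - b) < 2 := by
      by_contra hc
      exact hB ⟨by linarith, by linarith⟩
    refine ⟨(a, b + 1), ?_⟩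
    push_cast
    exact ⟨⟨by linarith, by linarith⟩, ⟨by linarith, by linarith⟩, by linarith, by linarith⟩

theorem norm_sub_hexCenter_le {t : ℤ × ℤ} {z : ℂ} (hz : z ∈ hexTile δ t) :
    ‖z - hexCenter δ t‖ ≤ δ := by
  obtain ⟨h0, h1, h2⟩ := (mem_hexTile_iff 0).1 hz
  set w := z - hexCenter δ t
  have hδ : 0 ≤ δ := (abs_nonneg _).trans h0
  have d0 : hexDir 0 = (1, 0) := rfl
  have d1 : hexDir (0 + 1) = (0, 1) := rfl
  simp only [hexForm_apply, d0, d1, abs_le] at h0 h1 h2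
  push_cast at h0 h1 h2
  have h3 : √3 * √3 = (3 : ℝ) := Real.mul_self_sqrt (by norm_num)
  have hre : w.re ^ 2 ≤ (δ / 2) ^ 2 := sq_le_sq' (by linarith) (by linarith)
  have him : (√3 * w.im) ^ 2 ≤ (3 / 2 * δ) ^ 2 := sq_le_sq' (by linarith) (by linarith)
  have him' : 3 * w.im ^ 2 ≤ (3 / 2 * δ) ^ 2 := by
    calc 3 * w.im ^ 2 = (√3 * w.im) ^ 2 := by linear_combination (-w.im ^ 2) * h3
      _ ≤ _ := him
  have : ‖w‖ ^ 2 ≤ δ ^ 2 := by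
    rw [← Complex.normSq_eq_norm_sq, Complex.normSq_apply]; nlinarith
  exact abs_le_of_sq_le_sq' this hδ |>.2

theorem finite_hexCenter_le (hδ : 0 < δ) (R : ℝ) : {t : ℤ × ℤ | ‖hexCenter δ t‖ ≤ R}.Finite := by
  have hsub : {t : ℤ × ℤ | ‖hexCenter δ t‖ ≤ R} ⊆
      Set.Icc (-⌈4 * (R / δ)⌉) ⌈4 * (R / δ)⌉ ×ˢ Set.Icc (-⌈4 * (R / δ)⌉) ⌈4 * (R / δ)⌉ := by
    rintro ⟨p, q⟩ ht
    simp only [Set.mem_ofPred_eq, hexCenter, norm_mul, Complex.norm_real, Real.norm_eq_abs,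
      abs_of_pos hδ] at ht
    have hn : ‖hexPt (p, q)‖ ≤ R / δ := by rw [le_div_iff₀ hδ]; linarith
    have h1 := (Complex.abs_re_le_norm _).trans hn
    have h2 := (Complex.abs_im_le_norm _).trans hn
    simp only [hexPt, abs_mul] at h1 h2
    have h3 : (1 : ℝ) ≤ √3 := by rw [Real.one_le_sqrt]; norm_num
    have hq : |(q : ℝ)| ≤ 2 * (R / δ) := by
      rw [abs_of_pos (a := √3 / 2) (by positivity)] at h2
      nlinarith [abs_nonneg (q : ℝ)]
    rw [abs_le] at h1 hq
    have hc := Int.le_ceil (4 * (R / δ))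
    simp only [Set.mem_prod, Set.mem_Icc, neg_le]
    have hR : 0 ≤ R / δ := (norm_nonneg _).trans hn
    refine ⟨⟨?_, ?_⟩, ?_, ?_⟩ <;>
    · have : ∀ m : ℤ, (m : ℝ) ≤ 4 * (R / δ) → m ≤ ⌈4 * (R / δ)⌉ := fun m hm => by
        exact_mod_cast hm.trans hc
      refine this _ ?_
      push_cast
      linarith
  exact ((Set.finite_Icc _ _).prod (Set.finite_Icc _ _)).subset hsub

theorem locallyFinite_hexTile (hδ : 0 < δ) : LocallyFinite (hexTile δ) := fun z => by
  refine ⟨Metric.ball z 1, Metric.ball_mem_nhds z one_pos,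
    (finite_hexCenter_le hδ (‖z‖ + 1 + δ)).subset ?_⟩
  rintro t ⟨w, hw, hwz⟩
  have h1 := norm_sub_hexCenter_le hw
  rw [Metric.mem_ball, dist_eq_norm] at hwz
  have h2 := norm_sub_norm_le (hexCenter δ t) w
  have h3 := norm_sub_norm_le w z
  rw [norm_sub_rev] at h2
  simp only [Set.mem_ofPred_eq]
  linarith

theorem isClosed_biUnion_hexTile (hδ : 0 < δ) (P : Set (ℤ × ℤ)) :
    IsClosed (⋃ t ∈ P, hexTile δ t) := by
  rw [Set.biUnion_eq_iUnion]
  exact ((locallyFinite_hexTile hδ).comp_injective Subtype.val_injective).isClosed_iUnion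
    fun t => isClosed_hexTile _

/-- The tile opposite to `t` under complex conjugation. -/
def hexConj (t : ℤ × ℤ) : ℤ × ℤ := (t.1 + t.2, -t.2)

theorem hexConj_hexConj (t : ℤ × ℤ) : hexConj (hexConj t) = t := by
  simp [hexConj]

theorem conj_hexCenter (t : ℤ × ℤ) :
    (starRingEnd ℂ) (hexCenter δ t) = hexCenter δ (hexConj t) := by
  apply Complex.ext
  · simp only [hexCenter, hexPt, hexConj, Complex.conj_re, Complex.mul_re, Complex.ofReal_re,
      Complex.ofReal_im]
    push_cast; ring
  · simp only [hexCenter, hexPt, hexConj, Complex.conj_im, Complex.mul_im, Complex.ofReal_re,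
      Complex.ofReal_im]
    push_cast; ring

theorem conj_mem_hexTile {t : ℤ × ℤ} {z : ℂ} (hz : z ∈ hexTile δ t) :
    (starRingEnd ℂ) z ∈ hexTile δ (hexConj t) := by
  intro i
  rw [← conj_hexCenter, ← map_sub]
  have hd : hexDir (-i) = ((hexDir i).1 + (hexDir i).2, -(hexDir i).2) := by revert i; decide
  have : hexForm i ((starRingEnd ℂ) (z - hexCenter δ t)) = hexForm (-i) (z - hexCenter δ t) := by
    simp only [hexForm_apply, hd, Complex.conj_re, Complex.conj_im]
    push_cast; ring
  rw [this]
  exact hz _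

end Tiles

/-! ### The boundary of a finite union of hexagons -/

/-- The boundary sides of a finite set `S` of tiles: the sides `(t, i)` such that `t` belongs to `S`
and its neighbour across the side `i` does not. -/
@[ext] structure HexDart (S : Finset (ℤ × ℤ)) where
  tile : ℤ × ℤ
  side : ZMod 6
  mem : tile ∈ S
  notMem : tile + hexDir side ∉ S

namespace HexDart
variable {S : Finset (ℤ × ℤ)} {δ : ℝ}

instance : Finite (HexDart S) := by
  have : Finite ((S : Set (ℤ × ℤ)) ×ˢ (Set.univ : Set (ZMod 6)) : Set ((ℤ × ℤ) × ZMod 6)) :=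
    (S.finite_toSet.prod Set.finite_univ).to_subtype
  refine Finite.of_injective (β := ((S : Set (ℤ × ℤ)) ×ˢ (Set.univ : Set (ZMod 6)) : Set _))
    (fun b => ⟨(b.tile, b.side), b.mem, trivial⟩) fun b b' h => ?_
  have h := congrArg Subtype.val h
  exact HexDart.ext (congrArg Prod.fst h) (congrArg Prod.snd h)

instance : Fintype (HexDart S) := Fintype.ofFinite _

theorem hexDir_sub_one_add (i : ZMod 6) : hexDir (i - 1) + hexDir (i + 1) = hexDir i := by
  revert i; decide

open Classical in
/-- The next boundary side in clockwise order. At the end of the side `(t, i)` three tiles meet: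
`t`, its neighbour across the side `i`, which is not in `S`, and the neighbour of `t` across the
side `i - 1`. The boundary turns around `t` or passes to that last tile, according to whether the
latter belongs to `S`. -/
def next (b : HexDart S) : HexDart S :=
  if h : b.tile + hexDir (b.side - 1) ∈ S then
    ⟨b.tile + hexDir (b.side - 1), b.side + 1, h, by
      rw [add_assoc, hexDir_sub_one_add]; exact b.notMem⟩
  else ⟨b.tile, b.side - 1, b.mem, h⟩

open Classical in
/-- The previous boundary side in clockwise order. -/
def prev (b : HexDart S) : HexDart S :=
  if h : b.tile + hexDir (b.side + 1) ∈ S then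
    ⟨b.tile + hexDir (b.side + 1), b.side - 1, h, by
      rw [add_assoc, add_comm (hexDir _), hexDir_sub_one_add]; exact b.notMem⟩
  else ⟨b.tile, b.side + 1, b.mem, h⟩

theorem hexDir_add_neg (i : ZMod 6) : hexDir (i - 1) + hexDir (i + 1 + 1) = 0 := by
  revert i; decide

theorem hexDir_add_neg' (i : ZMod 6) : hexDir (i + 1) + hexDir (i - 1 - 1) = 0 := by
  revert i; decide

theorem prev_next (b : HexDart S) : prev (next b) = b := by
  by_cases h : b.tile + hexDir (b.side - 1) ∈ S
  · have e : b.tile + hexDir (b.side - 1) + hexDir (b.side + 1 + 1) = b.tile := by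
      rw [add_assoc, hexDir_add_neg, add_zero]
    rw [next, dif_pos h, prev, dif_pos (by rw [e]; exact b.mem)]
    exact HexDart.ext e (add_sub_cancel_right _ _)
  · rw [next, dif_neg h, prev, dif_neg (by rw [sub_add_cancel]; exact b.notMem)]
    exact HexDart.ext rfl (sub_add_cancel _ _)

theorem next_prev (b : HexDart S) : next (prev b) = b := by
  by_cases h : b.tile + hexDir (b.side + 1) ∈ S
  · have e : b.tile + hexDir (b.side + 1) + hexDir (b.side - 1 - 1) = b.tile := by
      rw [add_assoc, hexDir_add_neg', add_zero]
    rw [prev, dif_pos h, next, dif_pos (by rw [e]; exact b.mem)]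
    exact HexDart.ext e (sub_add_cancel _ _)
  · rw [prev, dif_neg h, next, dif_neg (by rw [add_sub_cancel_right]; exact b.notMem)]
    exact HexDart.ext rfl (add_sub_cancel_right _ _)

/-- The successor permutation of the boundary sides. -/
def perm (S : Finset (ℤ × ℤ)) : Equiv.Perm (HexDart S) := ⟨next, prev, prev_next, next_prev⟩

variable (δ) in
/-- The starting point of a boundary side in clockwise order. -/
def start (b : HexDart S) : ℂ := hexVert δ b.tile (b.side + 1)

theorem start_perm (b : HexDart S) : start δ (perm S b) = hexVert δ b.tile b.side := by
  change start δ (next b) = _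
  by_cases h : b.tile + hexDir (b.side - 1) ∈ S
  · rw [next, dif_pos h]
    have e1 : hexDir (b.side + 1 + 1) = -hexDir (b.side - 1) :=
      eq_neg_of_add_eq_zero_right (hexDir_add_neg _)
    have e2 : hexDir (b.side + 1) = hexDir b.side - hexDir (b.side - 1) :=
      eq_sub_of_add_eq' (hexDir_sub_one_add _)
    simp only [start, hexVert, hexCenter, add_sub_cancel_right]
    rw [e1, e2, hexPt_add, hexPt_sub, hexPt_neg]
    ring
  · rw [next, dif_neg h, start, sub_add_cancel]

/-- The half-open boundary sides are pairwise disjoint, since at every vertex only three tiles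
meet. -/
theorem eq_of_start_add_eq (hδ : 0 < δ) (b b' : HexDart S) (s : ℝ) (hs : s ∈ Set.Ico (0 : ℝ) 1)
    (s' : ℝ) (hs' : s' ∈ Set.Ico (0 : ℝ) 1)
    (h : start δ b + (s : ℂ) * (start δ (perm S b) - start δ b) =
      start δ b' + (s' : ℂ) * (start δ (perm S b') - start δ b')) : b = b' ∧ s = s' := by
  rw [start_perm, start_perm] at h
  obtain ⟨t, i, ht, hti⟩ := b
  obtain ⟨t', i', ht', hti'⟩ := b'
  simp only [start] at h ht hti ht' hti'
  set z := hexVert δ t (i + 1) + (s : ℂ) * (hexVert δ t i - hexVert δ t (i + 1)) with hz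
  have hzt := (segment_hexVert hδ t i).subset (add_mul_sub_mem_segment hs.1 hs.2.le)
  have hzt' := (segment_hexVert hδ t' i').subset (add_mul_sub_mem_segment hs'.1 hs'.2.le)
  rw [← h] at hzt'
  rw [← hz] at hzt
  obtain ⟨hm, hf⟩ := hzt
  obtain ⟨hm', hf'⟩ := hzt'
  obtain ⟨-, e⟩ := hexForm_side (δ := δ) t i s
  obtain ⟨-, e'⟩ := hexForm_side (δ := δ) t' i' s'
  rw [← hz] at e
  rw [← h] at e'
  have ha := (hexForm_consecutive i (z - hexCenter δ t)).2.2.2.2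
  have ha' := (hexForm_consecutive i' (z - hexCenter δ t')).2.2.2.2
  -- the end point of a side does not belong to the half-open side
  have hprev : hexForm (i - 1) (z - hexCenter δ t) ≠ δ := fun h0 => by nlinarith [hs.2]
  have hprev' : hexForm (i' - 1) (z - hexCenter δ t') ≠ δ := fun h0 => by nlinarith [hs'.2]
  by_cases htt : t = t'
  · subst htt
    by_cases hii : i' = i
    · subst hii
      refine ⟨rfl, ?_⟩
      have : δ * (1 - s) = δ * (1 - s') := e.symm.trans e'
      have := mul_left_cancel₀ hδ.ne' this
      linarith
    · exfalso
      rcases adjacent_of_hexForm_eq hδ hm hii hf hf' with rfl | rfl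
      · exact hprev' (by rwa [add_sub_cancel_right])
      · exact hprev hf'
  · exfalso
    obtain ⟨j, rfl, hj⟩ := exists_neighbour hδ htt hm hm'
    have hji : j ≠ i := fun h0 => hti (h0 ▸ ht')
    rcases adjacent_of_hexForm_eq hδ hm hji hf hj with rfl | rfl
    · -- the common point is the vertex of `t`, `t + dᵢ` and `t + dᵢ₊₁`
      have hmn := mem_hexTile_neighbour hm hf
      have hmn' := mem_hexTile_neighbour hm' hf'
      by_cases heq : t + hexDir i = t + hexDir (i + 1) + hexDir i'
      · -- both sides face the same tile
        have hd : hexDir i = hexDir (i + 1) + hexDir i' := by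
          rw [add_assoc] at heq; exact add_left_cancel heq
        have hi' : i' = i - 1 := by
          revert hd; clear * -; revert i i'; decide
        subst hi'
        have h1 := hexForm_sub_center (δ := δ) (i - 1 - 1) z t (hexDir (i + 1))
        have h2 : hexDot (hexDir (i - 1 - 1)) (hexDir (i + 1)) = -2 := by
          clear * -; revert i; decide
        have h3 : hexForm (i - 1 - 1) (z - hexCenter δ t) = -hexForm (i + 1) (z - hexCenter δ t) := by
          have := hexForm_add_three (i + 1) (z - hexCenter δ t)
          have e3 : i + 1 + 3 = i - 1 - 1 := by clear * -; revert i; decide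
          rwa [e3] at this
        rw [h2, h3, hj] at h1
        push_cast at h1
        exact hprev' (by linarith)
      · obtain ⟨k, hk, hkf⟩ := exists_neighbour hδ heq hmn hmn'
        have hne : t ≠ t + hexDir (i + 1) + hexDir i' := fun h0 => hti' (h0 ▸ ht)
        obtain ⟨l, hl, hlf⟩ := exists_neighbour hδ hne hm hmn'
        rw [add_assoc] at hl
        have hl' := add_left_cancel hl
        have hli : l ≠ i := fun h0 => heq (by rw [add_assoc, hl', h0])
        have hli1 : l ≠ i + 1 := fun h0 => by
          rw [h0] at hl'
          have hz0 : hexDir i' = 0 := by simpa using hl'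
          revert hz0; clear * -; revert i'; decide
        rcases adjacent_of_hexForm_eq hδ hm hli hf hlf with h0 | rfl
        · exact hli1 h0
        · exact hprev hlf
    · exact hprev hj

end HexDart

section Index
variable {δ : ℝ}

theorem log_div_of_re_pos {x y : ℂ} (hx : 0 < x.re) (hy : 0 < y.re) :
    Complex.log (x / y) = Complex.log x - Complex.log y := by
  have hx0 : x ≠ 0 := fun h => by simp [h] at hx
  have hy0 : y ≠ 0 := fun h => by simp [h] at hy
  have h1 := abs_lt.1 (Complex.abs_arg_lt_pi_div_two_iff.2 (Or.inl hx))
  have h2 := abs_lt.1 (Complex.abs_arg_lt_pi_div_two_iff.2 (Or.inl hy))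
  have : Complex.log x - Complex.log y = Complex.log (Complex.exp (Complex.log x - Complex.log y)) := by
    rw [Complex.log_exp] <;> rw [Complex.sub_im, Complex.log_im, Complex.log_im] <;> linarith
  rw [this, Complex.exp_sub, Complex.exp_log hx0, Complex.exp_log hy0]

variable (δ) in
/-- `2πi` times the index of the clockwise boundary of the tile `t` about `z`. -/
def hexIndex (t : ℤ × ℤ) (z : ℂ) : ℂ :=
  ∑ i : ZMod 6, Complex.log ((hexVert δ t i - z) / (hexVert δ t (i + 1) - z))

theorem hexVert_mem_hexTile (hδ : 0 < δ) (t : ℤ × ℤ) (i : ZMod 6) : hexVert δ t i ∈ hexTile δ t :=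
  ((segment_hexVert hδ t i).subset (right_mem_segment ℝ _ _)).1

/-- A point outside a tile is separated from it by a line, on one side of which the logarithm is
single-valued. -/
theorem hexIndex_of_notMem (hδ : 0 < δ) {t : ℤ × ℤ} {z : ℂ} (hz : z ∉ hexTile δ t) :
    hexIndex δ t z = 0 := by
  simp only [hexTile, Set.mem_ofPred_eq, not_forall, not_le] at hz
  obtain ⟨j, hj⟩ := hz
  set u : ℂ := -(starRingEnd ℂ) (hexPt (hexDir j)) with hu
  have hre : ∀ w : ℂ, (w * u).re = -(hexForm j w) / 2 := fun w => by
    simp only [hu, hexForm_apply, hexPt, Complex.mul_re, Complex.neg_re, Complex.neg_im,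
      Complex.conj_re, Complex.conj_im]
    ring
  have hpos : ∀ i, 0 < ((hexVert δ t i - z) * u).re := fun i => by
    have := hexVert_mem_hexTile hδ t i j
    rw [hre, show hexVert δ t i - z = (hexVert δ t i - hexCenter δ t) - (z - hexCenter δ t) by ring,
      map_sub]
    linarith
  have hu0 : u ≠ 0 := fun h => by
    have := hpos 0; rw [h] at this; simp at this
  have : ∀ i, Complex.log ((hexVert δ t i - z) / (hexVert δ t (i + 1) - z)) =
      Complex.log ((hexVert δ t i - z) * u) - Complex.log ((hexVert δ t (i + 1) - z) * u) := fun i => by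
    rw [← log_div_of_re_pos (hpos i) (hpos (i + 1)), mul_div_mul_right _ _ hu0]
  simp only [hexIndex, this]
  rw [Finset.sum_sub_distrib, sub_eq_zero]
  exact (Equiv.sum_comp (Equiv.addRight (1 : ZMod 6))
    fun i => Complex.log ((hexVert δ t i - z) * u)).symm

theorem notMem_side_of_mem_hexOpen (hδ : 0 < δ) {t : ℤ × ℤ} {z : ℂ} (hz : z ∈ hexOpen δ t)
    (i : ZMod 6) : z ∉ segment ℝ (hexVert δ t (i + 1)) (hexVert δ t i) := fun h =>
  (hz i).ne ((segment_hexVert hδ t i).subset h).2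

theorem hexIndex_center (hδ : 0 < δ) (t : ℤ × ℤ) :
    hexIndex δ t (hexCenter δ t) = -(2 * Real.pi * Complex.I) := by
  set ω : ℂ := Complex.exp ((Real.pi / 3 : ℝ) * Complex.I) with hω
  have hω' : ω = hexPt (0, 1) := by
    rw [hω, Complex.exp_mul_I, ← Complex.ofReal_cos, ← Complex.ofReal_sin, Real.cos_pi_div_three,
      Real.sin_pi_div_three]
    apply Complex.ext <;> simp [hexPt]
  have h3 : √3 * √3 = (3 : ℝ) := Real.mul_self_sqrt (by norm_num)
  have hrot : ∀ i, hexPt (hexDir (i + 1)) = ω * hexPt (hexDir i) := fun i => by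
    have hd : hexDir (i + 1) = (-(hexDir i).2, (hexDir i).1 + (hexDir i).2) := by
      revert i; decide
    rw [hd, hω']
    apply Complex.ext
    · simp only [hexPt, Complex.mul_re]
      push_cast
      linear_combination ((hexDir i).2 / 4 : ℝ) * h3
    · simp only [hexPt, Complex.mul_im]
      push_cast
      ring
  have hne : ∀ i, hexVert δ t i - hexCenter δ t ≠ 0 := fun i h => by
    have := (segment_hexVert hδ t i).subset (right_mem_segment ℝ _ _)
    have := this.2
    rw [h, map_zero] at this
    exact hδ.ne this
  have hω0 : ω ≠ 0 := Complex.exp_ne_zero _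
  have hterm : ∀ i, Complex.log ((hexVert δ t i - hexCenter δ t) /
      (hexVert δ t (i + 1) - hexCenter δ t)) = -((Real.pi / 3 : ℝ) * Complex.I) := fun i => by
    have hv : hexVert δ t (i + 1) - hexCenter δ t = ω * (hexVert δ t i - hexCenter δ t) := by
      have e := hrot (i - 1)
      rw [sub_add_cancel] at e
      simp only [hexVert, add_sub_cancel_left, add_sub_cancel_right, hrot i]
      nth_rewrite 1 [e]
      ring
    have : (hexVert δ t i - hexCenter δ t) / (ω * (hexVert δ t i - hexCenter δ t)) =
        Complex.exp (-((Real.pi / 3 : ℝ) * Complex.I)) := by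
      rw [Complex.exp_neg, ← hω]
      have := hne i
      field_simp
    rw [hv, this, Complex.log_exp]
    · simp; linarith [Real.pi_pos]
    · simp; linarith [Real.pi_pos]
  simp only [hexIndex, hterm, Finset.sum_const, Finset.card_univ, ZMod.card]
  rw [nsmul_eq_mul]
  push_cast
  ring

/-- The index about the points of the open tile is constant, because its derivative is a
telescoping sum. -/
theorem hexIndex_of_mem (hδ : 0 < δ) {t : ℤ × ℤ} {z : ℂ} (hz : z ∈ hexOpen δ t) :
    hexIndex δ t z = -(2 * Real.pi * Complex.I) := by
  have hne : ∀ w ∈ hexOpen δ t, ∀ i, hexVert δ t i - w ≠ 0 := fun w hw i h =>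
    notMem_side_of_mem_hexOpen hδ hw i (by rw [← sub_eq_zero.1 h]; exact right_mem_segment ℝ _ _)
  have hder : ∀ w ∈ hexOpen δ t, HasDerivAt (hexIndex δ t) 0 w := fun w hw => by
    have h1 : ∀ i ∈ Finset.univ, HasDerivAt
        (fun w => Complex.log ((hexVert δ t i - w) / (hexVert δ t (i + 1) - w)))
        ((hexVert δ t (i + 1) - w)⁻¹ - (hexVert δ t i - w)⁻¹) w := fun i _ => by
      have ha := (hasDerivAt_id w).const_sub (hexVert δ t i)
      have hb := (hasDerivAt_id w).const_sub (hexVert δ t (i + 1))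
      have hslit := div_mem_slitPlane_of_notMem_segment (notMem_side_of_mem_hexOpen hδ hw i)
      have h := (ha.div hb (hne w hw (i + 1))).clog hslit
      refine h.congr_deriv ?_
      have h2 := hne w hw i
      have h3 := hne w hw (i + 1)
      simp only [id, Pi.div_apply]
      field_simp
      ring
    have h2 := HasDerivAt.fun_sum h1
    have h3 : ∑ i : ZMod 6, ((hexVert δ t (i + 1) - w)⁻¹ - (hexVert δ t i - w)⁻¹) = 0 := by
      rw [Finset.sum_sub_distrib, sub_eq_zero]
      exact Equiv.sum_comp (Equiv.addRight (1 : ZMod 6)) fun i => (hexVert δ t i - w)⁻¹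
    rwa [h3] at h2
  rw [← hexIndex_center hδ t]
  refine (isOpen_hexOpen t).is_const_of_deriv_eq_zero (convex_hexOpen t).isPreconnected
    (fun w hw => (hder w hw).differentiableAt.differentiableWithinAt)
    (fun w hw => (hder w hw).deriv) hz (hexCenter_mem_hexOpen hδ t)

theorem hexVert_neighbour (t : ℤ × ℤ) (i : ZMod 6) :
    hexVert δ (t + hexDir i) (i + 3) = hexVert δ t (i + 1) ∧
      hexVert δ (t + hexDir i) (i + 3 + 1) = hexVert δ t i := by
  have e1 : hexDir (i + 3 - 1) = hexDir (i + 1) - hexDir i := by revert i; decide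
  have e2 : hexDir (i + 3) = -hexDir i := hexDir_add_three i
  have e3 : hexDir (i + 3 + 1) = hexDir (i - 1) - hexDir i := by revert i; decide
  constructor
  · simp only [hexVert, hexCenter, e1, e2, hexPt_add, hexPt_sub, hexPt_neg, add_sub_cancel_right]
    ring
  · simp only [hexVert, hexCenter, add_sub_cancel_right, e2, e3, hexPt_add, hexPt_sub, hexPt_neg]
    ring

/-- The interior sides cancel in the sum of the indices of the tiles of `S`. -/
theorem sum_hexDart_log (hδ : 0 < δ) (S : Finset (ℤ × ℤ)) {t₀ : ℤ × ℤ} {z : ℂ}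
    (hz : z ∈ hexOpen δ t₀) :
    ∑ b : HexDart S, Complex.log ((HexDart.start δ (HexDart.perm S b) - z) / (HexDart.start δ b - z)) =
      if t₀ ∈ S then -(2 * Real.pi * Complex.I) else 0 := by
  classical
  set F : (ℤ × ℤ) × ZMod 6 → ℂ := fun x =>
    Complex.log ((hexVert δ x.1 x.2 - z) / (hexVert δ x.1 (x.2 + 1) - z)) with hF
  have hL : ∑ b : HexDart S, Complex.log ((HexDart.start δ (HexDart.perm S b) - z) /
      (HexDart.start δ b - z)) = ∑ x ∈ S ×ˢ Finset.univ with x.1 + hexDir x.2 ∉ S, F x := by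
    symm
    have hmem : ∀ x, x ∈ {x ∈ S ×ˢ (Finset.univ : Finset (ZMod 6)) | x.1 + hexDir x.2 ∉ S} →
        x.1 ∈ S ∧ x.1 + hexDir x.2 ∉ S := fun x hx => by simpa using hx
    refine Finset.sum_bij'
      (fun x hx => (⟨x.1, x.2, (hmem x hx).1, (hmem x hx).2⟩ : HexDart S)) (fun b _ => (b.tile, b.side))
      (fun _ _ => Finset.mem_univ _) (fun b _ => by simpa using ⟨b.mem, b.notMem⟩) (fun _ _ => rfl)
      (fun _ _ => rfl) (fun x hx => ?_)
    rw [HexDart.start_perm]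
    rfl
  have hint : ∑ x ∈ S ×ˢ Finset.univ with x.1 + hexDir x.2 ∈ S, F x = 0 := by
    refine Finset.sum_involution (fun x _ => (x.1 + hexDir x.2, x.2 + 3)) ?_ ?_ ?_ ?_
    · rintro ⟨t, i⟩ -
      simp only [hF, (hexVert_neighbour t i).1, (hexVert_neighbour t i).2]
      have hoff : z ∉ segment ℝ (hexVert δ t (i + 1)) (hexVert δ t i) := fun h => by
        obtain ⟨h1, h2⟩ := (segment_hexVert hδ t i).subset h
        have : t₀ = t := eq_of_mem_hexOpen hδ hz h1
        subst this
        exact (hz i).ne h2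
      have hslit := div_mem_slitPlane_of_notMem_segment hoff
      rw [← inv_div (hexVert δ t i - z), Complex.log_inv _ (Complex.slitPlane_arg_ne_pi hslit)]
      ring
    · rintro ⟨t, i⟩ - - h
      have := congrArg Prod.snd h
      simp only [add_eq_left] at this
      revert this; decide
    · rintro ⟨t, i⟩ hx
      simp only [Finset.mem_filter, Finset.mem_product, Finset.mem_univ, and_true] at hx ⊢
      refine ⟨hx.2, ?_⟩
      rw [hexDir_add_three, add_neg_cancel_right]
      exact hx.1
    · rintro ⟨t, i⟩ hx
      refine Prod.ext ?_ ?_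
      · simp [hexDir_add_three]
      · change i + 3 + 3 = i
        clear * -; revert i; decide
  have hsplit := Finset.sum_filter_add_sum_filter_not (S ×ˢ (Finset.univ : Finset (ZMod 6)))
    (fun x => x.1 + hexDir x.2 ∈ S) F
  rw [hint, zero_add] at hsplit
  rw [hL, hsplit, Finset.sum_product]
  have : ∀ t ∈ S, ∑ i : ZMod 6, F (t, i) = if t = t₀ then -(2 * Real.pi * Complex.I) else 0 := by
    intro t _
    change hexIndex δ t z = _
    split_ifs with h
    · subst h; exact hexIndex_of_mem hδ hz
    · exact hexIndex_of_notMem hδ fun h' => h (eq_of_mem_hexOpen hδ hz h').symm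
  rw [Finset.sum_congr rfl this, Finset.sum_ite_eq']

end Index

/-! ### Existence of Cauchy domains -/

theorem isPreconnected_compl_closedBall {R : ℝ} (hR : 0 < R) :
    IsPreconnected (Metric.closedBall (0 : ℂ) R)ᶜ := by
  have : (Metric.closedBall (0 : ℂ) R)ᶜ = Complex.exp '' {w | Real.log R < w.re} := by
    ext z
    simp only [Set.mem_compl_iff, Metric.mem_closedBall, dist_zero_right, not_le, Set.mem_image,
      Set.mem_ofPred_eq]
    constructor
    · intro h
      have hz : 0 < ‖z‖ := hR.trans h
      exact ⟨Complex.log z, by rw [Complex.log_re]; exact Real.log_lt_log hR h,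
        Complex.exp_log (norm_pos_iff.1 hz)⟩
    · rintro ⟨w, hw, rfl⟩
      rw [Complex.norm_exp]
      exact (Real.log_lt_iff_lt_exp hR).1 hw
  rw [this]
  exact ((convex_halfSpace_re_gt _).isPreconnected).image _ Complex.continuous_exp.continuousOn

/-- A preconnected set that meets `s` but not its boundary lies in `s`. -/
theorem IsPreconnected.subset_of_disjoint_frontier {X : Type*} [TopologicalSpace X] {u s : Set X}
    (hu : IsPreconnected u) (hus : (u ∩ s).Nonempty) (hf : Disjoint u (frontier s)) : u ⊆ s := by
  by_contra hn
  obtain ⟨x, hx, hxs⟩ := Set.not_subset.1 hn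
  obtain ⟨y, hyu, hys⟩ := hus
  have hcov : u ⊆ interior s ∪ interior sᶜ := fun w hw => by
    by_contra hc
    rw [Set.mem_union, not_or, interior_compl] at hc
    refine Set.disjoint_left.1 hf hw ⟨?_, hc.1⟩
    by_contra h
    exact hc.2 h
  have hin : ∀ w ∈ u, w ∈ s → w ∈ interior s := fun w hw hws =>
    (hcov hw).resolve_right fun h => interior_subset h hws
  have hout : ∀ w ∈ u, w ∉ s → w ∈ interior sᶜ := fun w hw hws =>
    (hcov hw).resolve_left fun h => hws (interior_subset h)
  obtain ⟨w, -, h1, h2⟩ := hu _ _ isOpen_interior isOpen_interior hcov ⟨y, hyu, hin y hyu hys⟩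
    ⟨x, hx, hout x hx hxs⟩
  exact interior_subset h2 (interior_subset h1)

/-- An unbounded planar set with bounded boundary contains a neighbourhood of infinity. -/
theorem isBounded_compl_of_isBounded_frontier {D : Set ℂ} (hD : ¬ Bornology.IsBounded D)
    (hf : Bornology.IsBounded (frontier D)) : Bornology.IsBounded Dᶜ := by
  obtain ⟨R, hR, hfR⟩ := hf.subset_closedBall_lt 0 0
  have hmeet : ((Metric.closedBall (0 : ℂ) R)ᶜ ∩ D).Nonempty := by
    by_contra hn
    refine hD (Metric.isBounded_closedBall.subset (s := D) (t := Metric.closedBall 0 R) fun z hz => ?_)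
    by_contra hz'
    exact hn ⟨z, hz', hz⟩
  have := (isPreconnected_compl_closedBall hR).subset_of_disjoint_frontier hmeet
    (Set.disjoint_left.2 fun z hz hz' => hz (hfR hz'))
  refine Metric.isBounded_closedBall.subset (s := Dᶜ) (t := Metric.closedBall 0 R) ?_
  exact Set.compl_subset_comm.1 this

section HexRegion
variable {δ : ℝ}

variable (δ) in
/-- The complement of the union of the closed tiles of `S`. -/
def hexRegion (S : Finset (ℤ × ℤ)) : Set ℂ := (⋃ t ∈ S, hexTile δ t)ᶜ

theorem mem_hexRegion {S : Finset (ℤ × ℤ)} {z : ℂ} :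
    z ∈ hexRegion δ S ↔ ∀ t, z ∈ hexTile δ t → t ∉ S := by
  simp only [hexRegion, Set.mem_compl_iff, Set.mem_iUnion, not_exists]
  exact ⟨fun h t ht hS => h t hS ht, fun h t hS ht => h t ht hS⟩

theorem isOpen_hexRegion (S : Finset (ℤ × ℤ)) : IsOpen (hexRegion δ S) :=
  (S.finite_toSet.isClosed_biUnion fun t _ => isClosed_hexTile t).isOpen_compl

theorem hexOpen_subset_hexRegion (hδ : 0 < δ) {S : Finset (ℤ × ℤ)} {t : ℤ × ℤ} (ht : t ∉ S) :
    hexOpen δ t ⊆ hexRegion δ S := fun _ hz =>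
  mem_hexRegion.2 fun _ hz' => eq_of_mem_hexOpen hδ hz hz' ▸ ht

theorem closure_hexRegion (hδ : 0 < δ) (S : Finset (ℤ × ℤ)) :
    closure (hexRegion δ S) = ⋃ t ∈ (S : Set (ℤ × ℤ))ᶜ, hexTile δ t := by
  refine subset_antisymm (closure_minimal (fun z hz => ?_) (isClosed_biUnion_hexTile hδ _)) ?_
  · obtain ⟨t, ht⟩ := exists_mem_hexTile hδ z
    exact Set.mem_biUnion (show t ∈ (S : Set (ℤ × ℤ))ᶜ from mem_hexRegion.1 hz t ht) ht
  · refine Set.iUnion₂_subset fun t ht => (hexTile_subset_closure hδ t).trans ?_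
    exact closure_mono (hexOpen_subset_hexRegion hδ ht)

theorem frontier_hexRegion (hδ : 0 < δ) (S : Finset (ℤ × ℤ)) :
    frontier (hexRegion δ S) =
      ⋃ b : HexDart S, segment ℝ (HexDart.start δ b) (HexDart.start δ (HexDart.perm S b)) := by
  ext z
  rw [(isOpen_hexRegion S).frontier_eq, closure_hexRegion hδ, Set.mem_sdiff, mem_hexRegion]
  simp only [Set.mem_iUnion, HexDart.start_perm]
  push Not
  constructor
  · rintro ⟨⟨t', ht', hz'⟩, t, hz, ht⟩
    obtain ⟨i, rfl, hi⟩ := exists_neighbour hδ (fun h : t = t' => ht' (h ▸ ht)) hz hz'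
    exact ⟨⟨t, i, ht, ht'⟩, (segment_hexVert hδ t i).superset ⟨hz, hi⟩⟩
  · rintro ⟨b, hb⟩
    obtain ⟨hz, hi⟩ := (segment_hexVert hδ b.tile b.side).subset hb
    exact ⟨⟨_, b.notMem, mem_hexTile_neighbour hz hi⟩, _, hz, b.mem⟩

theorem isBounded_hexTile (t : ℤ × ℤ) : Bornology.IsBounded (hexTile δ t) :=
  Metric.isBounded_closedBall.subset (t := Metric.closedBall (hexCenter δ t) δ) fun z hz => by
    rw [Metric.mem_closedBall, dist_eq_norm]; exact norm_sub_hexCenter_le hz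

theorem isBounded_compl_hexRegion (S : Finset (ℤ × ℤ)) : Bornology.IsBounded (hexRegion δ S)ᶜ := by
  rw [hexRegion, compl_compl]
  exact (Bornology.isBounded_biUnion_finset S).2 fun t _ => isBounded_hexTile t

theorem not_isBounded_hexRegion (S : Finset (ℤ × ℤ)) : ¬ Bornology.IsBounded (hexRegion δ S) := by
  intro h
  have := h.union (isBounded_compl_hexRegion (δ := δ) S)
  rw [Set.union_compl_self] at this
  exact NormedSpace.unbounded_univ ℝ ℂ this

theorem nonempty_hexDart (hδ : 0 < δ) {S : Finset (ℤ × ℤ)} (hS : S.Nonempty) :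
    Nonempty (HexDart S) := by
  have h : (frontier (hexRegion δ S)).Nonempty := by
    refine nonempty_frontier_iff.2 ⟨?_, fun h => ?_⟩
    · rw [Set.nonempty_iff_ne_empty]
      intro h
      exact not_isBounded_hexRegion (δ := δ) S (h ▸ Bornology.isBounded_empty)
    · obtain ⟨t, ht⟩ := hS
      exact mem_hexRegion.1 (h.superset (Set.mem_univ (hexCenter δ t))) t
        (hexOpen_subset t (hexCenter_mem_hexOpen hδ t)) ht
  rw [frontier_hexRegion hδ] at h
  obtain ⟨z, hz⟩ := h
  obtain ⟨b, -⟩ := Set.mem_iUnion.1 hz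
  exact ⟨b⟩

/-- Off the boundary, the index of the boundary depends only on the tile containing the point. -/
theorem sum_hexDart_log_of_notMem_frontier (hδ : 0 < δ) (S : Finset (ℤ × ℤ)) {t : ℤ × ℤ} {z : ℂ}
    (hz : z ∈ hexTile δ t) (hzf : z ∉ frontier (hexRegion δ S)) :
    ∑ b : HexDart S, Complex.log ((HexDart.start δ (HexDart.perm S b) - z) / (HexDart.start δ b - z)) =
      if t ∈ S then -(2 * Real.pi * Complex.I) else 0 := by
  set Φ : ℂ → ℂ := fun z => ∑ b : HexDart S,
    Complex.log ((HexDart.start δ (HexDart.perm S b) - z) / (HexDart.start δ b - z)) with hΦ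
  rw [frontier_hexRegion hδ, Set.mem_iUnion] at hzf
  push Not at hzf
  have hcont : ContinuousAt Φ z := by
    refine tendsto_finsetSum _ fun b _ => ?_
    have hne : HexDart.start δ b - z ≠ 0 := fun h => hzf b (by
      rw [← sub_eq_zero.1 h]; exact left_mem_segment ℝ _ _)
    have hslit := div_mem_slitPlane_of_notMem_segment (hzf b)
    have : ContinuousAt (fun z => (HexDart.start δ (HexDart.perm S b) - z) / (HexDart.start δ b - z)) z :=
      (continuousAt_const.sub continuousAt_id).div (continuousAt_const.sub continuousAt_id) hne
    exact this.clog hslit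
  have hcl := hexTile_subset_closure hδ t hz
  rw [mem_closure_iff_nhdsWithin_neBot] at hcl
  refine tendsto_nhds_unique (hcont.tendsto.mono_left (nhdsWithin_le_nhds (s := hexOpen δ t))) ?_
  refine tendsto_const_nhds.congr' ?_
  filter_upwards [self_mem_nhdsWithin] with w hw
  exact (sum_hexDart_log hδ S hw).symm

theorem exists_isPositiveBoundary_hexRegion (hδ : 0 < δ) {S : Finset (ℤ × ℤ)} (hS : S.Nonempty) :
    ∃ (N : ℕ) (γ : Fin N → ℝ → ℂ), IsPositiveBoundary (hexRegion δ S) γ := by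
  have := nonempty_hexDart hδ hS
  obtain ⟨N, γ, hN, hJ, hdisj, himg, hlog⟩ := exists_jordan_family (HexDart.perm S)
    (HexDart.start δ) (HexDart.eq_of_start_add_eq hδ)
  have hπ : (2 * Real.pi * Complex.I : ℂ) ≠ 0 := by simp [Real.pi_ne_zero]
  have hwind : ∀ t z, z ∈ hexTile δ t → z ∉ frontier (hexRegion δ S) →
      windingNumber γ z = if t ∈ S then -1 else 0 := fun t z hz hzf => by
    have hoff := hzf
    rw [frontier_hexRegion hδ, Set.mem_iUnion] at hoff
    push Not at hoff
    rw [windingNumber, hlog z hoff, sum_hexDart_log_of_notMem_frontier hδ S hz hzf]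
    split_ifs
    · rw [mul_neg, inv_mul_cancel₀ hπ]
    · rw [mul_zero]
  refine ⟨N, γ, ⟨⟨hN, hJ, hdisj, by rw [frontier_hexRegion hδ, himg]⟩, fun z hz => ?_, fun z hz => ?_⟩⟩
  · rw [if_neg (not_isBounded_hexRegion S)]
    obtain ⟨t, ht⟩ := exists_mem_hexTile hδ z
    rw [hwind t z ht fun h => (by
      rw [(isOpen_hexRegion S).frontier_eq] at h; exact h.2 hz), if_neg (mem_hexRegion.1 hz t ht)]
  · rw [if_neg (not_isBounded_hexRegion S)]
    obtain ⟨t, ht⟩ := exists_mem_hexTile hδ z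
    rw [hwind t z ht fun h => hz h.1, if_pos]
    by_contra hS'
    rw [closure_hexRegion hδ] at hz
    exact hz (Set.mem_biUnion (show t ∈ (S : Set (ℤ × ℤ))ᶜ from hS') ht)

theorem connectedComponentIn_eq_center (hδ : 0 < δ) {S : Finset (ℤ × ℤ)} {t : ℤ × ℤ} {z : ℂ}
    (hz : z ∈ hexTile δ t) (hzU : z ∈ hexRegion δ S) :
    connectedComponentIn (hexRegion δ S) z = connectedComponentIn (hexRegion δ S) (hexCenter δ t) := by
  have ht := mem_hexRegion.1 hzU t hz
  have hseg : segment ℝ (hexCenter δ t) z ⊆ hexRegion δ S := fun w hw => by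
    obtain ⟨s, h0, h1, rfl⟩ := exists_of_mem_segment hw
    rcases h1.lt_or_eq with h1 | rfl
    · exact hexOpen_subset_hexRegion hδ ht (lineMap_mem_hexOpen hδ hz h0 h1)
    · simpa using hzU
  refine connectedComponentIn_eq ?_
  exact (convex_segment _ _).isPreconnected.subset_connectedComponentIn
    (right_mem_segment ℝ _ _) hseg (left_mem_segment ℝ _ _)

theorem isCauchyDomain_hexRegion (hδ : 0 < δ) {S : Finset (ℤ × ℤ)} (hS : S.Nonempty) :
    IsCauchyDomain (hexRegion δ S) := by
  set U := hexRegion δ S with hU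
  set C : ℤ × ℤ → Set ℂ := fun t => connectedComponentIn U (hexCenter δ t) with hC
  refine ⟨isOpen_hexRegion S, ?_, ?_, ?_⟩
  · -- all the tiles far from the origin lie in one component
    obtain ⟨R, hR, hUR⟩ := (isBounded_compl_hexRegion (δ := δ) S).subset_closedBall_lt 0 0
    have hout : (Metric.closedBall (0 : ℂ) R)ᶜ ⊆ U := Set.compl_subset_comm.1 hUR
    have hfar : ∀ t t', R < ‖hexCenter δ t‖ → R < ‖hexCenter δ t'‖ → C t = C t' := fun t t' h h' => by
      refine connectedComponentIn_eq ?_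
      exact (isPreconnected_compl_closedBall hR).subset_connectedComponentIn (by simpa using h) hout
        (by simpa using h')
    have hfin : (C '' {t | ‖hexCenter δ t‖ ≤ R}).Finite := (finite_hexCenter_le hδ R).image _
    by_cases hex : ∃ t, R < ‖hexCenter δ t‖
    · obtain ⟨t₁, ht₁⟩ := hex
      refine (hfin.union (Set.finite_singleton (C t₁))).subset ?_
      rintro _ ⟨z, hz, rfl⟩
      obtain ⟨t, ht⟩ := exists_mem_hexTile hδ z
      rw [connectedComponentIn_eq_center hδ ht hz]
      rcases le_or_gt ‖hexCenter δ t‖ R with h | h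
      · exact Or.inl ⟨t, h, rfl⟩
      · exact Or.inr (hfar t t₁ h ht₁)
    · push Not at hex
      refine hfin.subset ?_
      rintro _ ⟨z, hz, rfl⟩
      obtain ⟨t, ht⟩ := exists_mem_hexTile hδ z
      rw [connectedComponentIn_eq_center hδ ht hz]
      exact ⟨t, hex t, rfl⟩
  · have hclos : ∀ z ∈ U, closure (connectedComponentIn U z) ⊆
        ⋃ t ∈ {t | t ∉ S ∧ C t = connectedComponentIn U z}, hexTile δ t := fun z hz => by
      refine closure_minimal (fun w hw => ?_) (isClosed_biUnion_hexTile hδ _)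
      obtain ⟨t, ht⟩ := exists_mem_hexTile hδ w
      have hwU := connectedComponentIn_subset _ _ hw
      refine Set.mem_biUnion (show t ∈ {t | t ∉ S ∧ C t = connectedComponentIn U z} from
        ⟨mem_hexRegion.1 hwU t ht, ?_⟩) ht
      rw [connectedComponentIn_eq hw]
      exact (connectedComponentIn_eq_center hδ ht hwU).symm
    rintro _ ⟨z, hz, rfl⟩ _ ⟨z', hz', rfl⟩ hne
    rw [Set.disjoint_left]
    intro w hw hw'
    obtain ⟨t, ⟨ht, htC⟩, hwt⟩ := Set.mem_iUnion₂.1 (hclos z hz hw)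
    obtain ⟨t', ⟨ht', htC'⟩, hwt'⟩ := Set.mem_iUnion₂.1 (hclos z' hz' hw')
    have htt : t ≠ t' := fun h => hne (by rw [← htC, ← htC', h])
    obtain ⟨i, rfl, hi⟩ := exists_neighbour hδ htt hwt hwt'
    -- the midpoint of the common side connects the two tiles
    set m := hexVert δ t (i + 1) + ((1 / 2 : ℝ) : ℂ) * (hexVert δ t i - hexVert δ t (i + 1)) with hm
    obtain ⟨hmt, hmi⟩ := (segment_hexVert hδ t i).subset
      (add_mul_sub_mem_segment (s := 1 / 2) (by norm_num) (by norm_num))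
    have hm1 := (hexForm_side (δ := δ) t i (1 / 2)).2
    rw [← hm] at hmt hmi hm1
    have hmt' := mem_hexTile_neighbour hmt hmi
    have hmU : m ∈ U := mem_hexRegion.2 fun t'' ht'' => by
      by_cases h : t = t''
      · exact h ▸ ht
      · obtain ⟨j, rfl, hj⟩ := exists_neighbour hδ h hmt ht''
        by_cases hji : j = i
        · exact hji ▸ ht'
        · exfalso
          have h5 := (hexForm_consecutive i (m - hexCenter δ t)).2.2.2.2
          rcases adjacent_of_hexForm_eq hδ hmt hji hmi hj with rfl | rfl
          · linarith
          · linarith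
    refine hne (htC.symm.trans (Eq.trans ?_ htC'))
    simp only [hC]
    rw [← connectedComponentIn_eq_center hδ hmt hmU, ← connectedComponentIn_eq_center hδ hmt' hmU]
  · obtain ⟨N, γ, h⟩ := exists_isPositiveBoundary_hexRegion hδ hS
    exact ⟨N, γ, h.boundary⟩

end HexRegion

/-- Between a compact set `K` and an open neighbourhood `Ω` of it, both symmetric under conjugation,
there is the complement of an unbounded symmetric Cauchy domain. -/
theorem exists_unbounded_cauchyDomain {K Ω : Set ℂ} (hK : IsCompact K) (hKne : K.Nonempty)
    (hΩ : IsOpen Ω) (hKΩ : K ⊆ Ω) (hsymm : ∀ z ∈ K, (starRingEnd ℂ) z ∈ K) :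
    ∃ U : Set ℂ, IsCauchyDomain U ∧ ¬ Bornology.IsBounded U ∧ (∀ z ∈ U, (starRingEnd ℂ) z ∈ U) ∧
      Ωᶜ ⊆ U ∧ Disjoint (closure U) K ∧ ∃ (N : ℕ) (γ : Fin N → ℝ → ℂ), IsPositiveBoundary U γ := by
  obtain ⟨r, hr, hrΩ⟩ := hK.exists_cthickening_subset_open hΩ hKΩ
  set δ := r / 2 with hδr
  have hδ : 0 < δ := half_pos hr
  have hfin : {t : ℤ × ℤ | (hexTile δ t ∩ K).Nonempty}.Finite := by
    obtain ⟨R, hR⟩ := hK.isBounded.exists_norm_le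
    refine (finite_hexCenter_le hδ (R + δ)).subset ?_
    rintro t ⟨z, hz, hzK⟩
    have h1 := norm_sub_hexCenter_le hz
    have h2 := norm_sub_norm_le (hexCenter δ t) z
    rw [norm_sub_rev] at h2
    have := hR z hzK
    rw [Set.mem_ofPred_eq]
    linarith
  set S := hfin.toFinset with hS
  have hmemS : ∀ t, t ∈ S ↔ (hexTile δ t ∩ K).Nonempty := fun t => by simp [hS]
  have hSne : S.Nonempty := by
    obtain ⟨z, hz⟩ := hKne
    obtain ⟨t, ht⟩ := exists_mem_hexTile hδ z
    exact ⟨t, (hmemS t).2 ⟨z, ht, hz⟩⟩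
  have hconj : ∀ t, hexConj t ∈ S → t ∈ S := fun t ht => by
    obtain ⟨z, hz, hzK⟩ := (hmemS _).1 ht
    have := conj_mem_hexTile hz
    rw [hexConj_hexConj] at this
    exact (hmemS t).2 ⟨_, this, hsymm z hzK⟩
  refine ⟨hexRegion δ S, isCauchyDomain_hexRegion hδ hSne, not_isBounded_hexRegion S, fun z hz => ?_,
    fun z hz => ?_, ?_, exists_isPositiveBoundary_hexRegion hδ hSne⟩
  · refine mem_hexRegion.2 fun t ht hS' => ?_
    have h1 := conj_mem_hexTile ht
    rw [Complex.conj_conj] at h1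
    exact mem_hexRegion.1 hz _ h1 (hconj _ (by rwa [hexConj_hexConj]))
  · refine mem_hexRegion.2 fun t ht hS' => hz (hrΩ ?_)
    obtain ⟨w, hw, hwK⟩ := (hmemS t).1 hS'
    refine Metric.mem_cthickening_of_dist_le z w r K hwK ?_
    have h1 := norm_sub_hexCenter_le ht
    have h2 := norm_sub_hexCenter_le hw
    rw [← dist_eq_norm] at h1 h2
    linarith [dist_triangle_right z w (hexCenter δ t)]
  · rw [closure_hexRegion hδ, Set.disjoint_left]
    intro z hz hzK
    obtain ⟨t, ht, hzt⟩ := Set.mem_iUnion₂.1 hz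
    exact ht ((hmemS t).2 ⟨z, hzt, hzK⟩)

/-! ### Pairs of functions satisfying the Cauchy-Riemann equations -/

/-- The stem function `P + i R` of a slice function is holomorphic at `z`: the functions `P` and `R`
with values in a real normed space are real differentiable and satisfy the Cauchy-Riemann
equations. -/
def IsCauchyRiemannAt {E : Type*} [NormedAddCommGroup E] [NormedSpace ℝ E] (P R : ℂ → E) (z : ℂ) :
    Prop :=
  ∃ P' R' : ℂ →L[ℝ] E, HasFDerivAt P P' z ∧ HasFDerivAt R R' z ∧
    P' 1 = R' Complex.I ∧ R' 1 = -P' Complex.I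

/-- The product of two holomorphic stem functions with respect to a real bilinear form. -/
theorem IsCauchyRiemannAt.differentiableAt_bilin {E F : Type*} [NormedAddCommGroup E]
    [NormedSpace ℝ E] [NormedAddCommGroup F] [NormedSpace ℝ F] {P R : ℂ → E} {α β : ℂ → F} {z : ℂ}
    (h : IsCauchyRiemannAt P R z) (h' : IsCauchyRiemannAt α β z) (B : E →L[ℝ] F →L[ℝ] ℝ) :
    DifferentiableAt ℂ (fun z => (((B (P z) (α z) - B (R z) (β z) : ℝ) : ℂ)) +
      ((B (P z) (β z) + B (R z) (α z) : ℝ) : ℂ) * Complex.I) z := by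
  obtain ⟨P', R', hP, hR, e1, e2⟩ := h
  obtain ⟨α', β', hα, hβ, e3, e4⟩ := h'
  have h1 := B.hasFDerivAt_of_bilinear hP hα
  have h2 := B.hasFDerivAt_of_bilinear hR hβ
  have h3 := B.hasFDerivAt_of_bilinear hP hβ
  have h4 := B.hasFDerivAt_of_bilinear hR hα
  have hre := Complex.ofRealCLM.hasFDerivAt.comp z (h1.sub h2)
  have him := (Complex.ofRealCLM.hasFDerivAt.comp z (h3.add h4)).mul_const Complex.I
  have htot := hre.add him
  rw [differentiableAt_complex_iff_differentiableAt_real]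
  refine ⟨htot.differentiableAt, ?_⟩
  rw [show (fun z => (((B (P z) (α z) - B (R z) (β z) : ℝ) : ℂ)) +
      ((B (P z) (β z) + B (R z) (α z) : ℝ) : ℂ) * Complex.I) = _ from rfl] at *
  have hfd := htot.fderiv
  have hI : P' Complex.I = -R' 1 := by rw [e2, neg_neg]
  have hI' : α' Complex.I = -β' 1 := by rw [e4, neg_neg]
  refine (congrArg (fun L => L Complex.I) hfd).trans ?_
  refine Eq.trans ?_ (congrArg (fun L => Complex.I • L 1) hfd).symm
  apply Complex.ext <;>
    simp [ContinuousLinearMap.precompR, ContinuousLinearMap.precompL, ← e1, ← e3, hI, hI'] <;> ring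

/-- The Cauchy-Riemann equations for the resolvent follow from the algebraic relations between `Q`
and `Y = T Q` and the derivatives `dQ = Q D`, `dY = Y D`. -/
theorem isCauchyRiemannAt_of_hasFDerivAt {R : Type*} [NormedRing R] [NormedAlgebra ℝ R] {q y : ℂ → R}
    {w : ℂ} {D : ℂ →L[ℝ] R} (hq : HasFDerivAt q (q w • D) w) (hy : HasFDerivAt y (y w • D) w)
    (h₁ : D 1 = (2 : ℝ) • y w - (2 * w.re) • q w) (h₂ : D Complex.I = -((2 * w.im) • q w))
    (hc : q w * y w = y w * q w)
    (hs : y w * y w = q w + (2 * w.re) • (y w * q w) - ‖w‖ ^ 2 • (q w * q w)) :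
    IsCauchyRiemannAt (fun z => z.re • q z - y z) (fun z => -(z.im • q z)) w := by
  have hre : HasFDerivAt (fun z : ℂ => z.re) Complex.reCLM w := Complex.reCLM.hasFDerivAt
  have him : HasFDerivAt (fun z : ℂ => z.im) Complex.imCLM w := Complex.imCLM.hasFDerivAt
  have hn : ‖w‖ ^ 2 = w.re * w.re + w.im * w.im := by
    rw [← Complex.normSq_eq_norm_sq, Complex.normSq_apply]
  refine ⟨_, _, (hre.smul hq).sub hy, (him.smul hq).neg, ?_, ?_⟩
  · simp [h₁, h₂, mul_sub, hc, hs, hn]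
    module
  · simp [h₁, h₂, mul_sub, hc]
    module

/-! ### The resolvent in the complex parameter plane -/

section Resolvent
variable {V : Type*} [NormedAddCommGroup V] [NormedSpace ℝ V]

/-- `Q` is the bounded inverse of `T² - 2 Re(z) T + |z|²`, and `Y = T Q`. -/
structure IsPlanarResolvent (T : V →ₗ.[ℝ] V) (z : ℂ) (Q Y : V →L[ℝ] V) : Prop where
  apply_left : ∀ v, ∃ h : Q v ∈ T.domain, T ⟨Q v, h⟩ = Y v
  apply_right : ∀ v, ∃ h : Y v ∈ T.domain,
    T ⟨Y v, h⟩ = v + (2 * z.re) • Y v - ‖z‖ ^ 2 • Q v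
  left_inv : ∀ (u : V) (h : u ∈ T.domain) (h' : T ⟨u, h⟩ ∈ T.domain),
    Q (T ⟨T ⟨u, h⟩, h'⟩ - (2 * z.re) • T ⟨u, h⟩ + ‖z‖ ^ 2 • u) = u

namespace IsPlanarResolvent
variable {T : V →ₗ.[ℝ] V} {z w : ℂ} {Q Y Q' Y' : V →L[ℝ] V}

theorem pmap_congr {T : V →ₗ.[ℝ] V} {u v : V} (h : u = v) (hu : u ∈ T.domain) (hv : v ∈ T.domain) :
    T ⟨u, hu⟩ = T ⟨v, hv⟩ := by subst h; rfl

theorem unique (h : IsPlanarResolvent T z Q Y) (h' : IsPlanarResolvent T z Q' Y') :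
    Q' = Q ∧ Y' = Y := by
  have hQ : Q' = Q := by
    ext v
    obtain ⟨h1, e1⟩ := h'.apply_left v
    obtain ⟨h2, e2⟩ := h'.apply_right v
    have := h.left_inv (Q' v) h1 (by rw [e1]; exact h2)
    rw [pmap_congr e1 _ h2, e2, e1] at this
    rw [← this]
    congr 1
    abel
  refine ⟨hQ, ?_⟩
  ext v
  obtain ⟨h1, e1⟩ := h.apply_left v
  obtain ⟨h1', e1'⟩ := h'.apply_left v
  rw [← e1, ← e1']
  exact pmap_congr (by rw [hQ]) _ _

/-- `Q T ⊆ T Q`. -/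
theorem apply_map (h : IsPlanarResolvent T z Q Y) (v : V) (hv : v ∈ T.domain) :
    Q (T ⟨v, hv⟩) = Y v := by
  obtain ⟨h1, e1⟩ := h.apply_left v
  obtain ⟨h2, e2⟩ := h.apply_right v
  have hmem : v + (2 * z.re) • Y v - ‖z‖ ^ 2 • Q v ∈ T.domain :=
    sub_mem (add_mem hv (T.domain.smul_mem _ h2)) (T.domain.smul_mem _ h1)
  have h3 : T ⟨Y v, h2⟩ ∈ T.domain := by rw [e2]; exact hmem
  have key := h.left_inv (Y v) h2 h3
  have e3 : T ⟨T ⟨Y v, h2⟩, h3⟩ = T ⟨v, hv⟩ + (2 * z.re) • T ⟨Y v, h2⟩ - ‖z‖ ^ 2 • Y v := by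
    rw [pmap_congr e2 h3 hmem]
    have : (⟨v + (2 * z.re) • Y v - ‖z‖ ^ 2 • Q v, hmem⟩ : T.domain) =
        ⟨v, hv⟩ + (2 * z.re) • ⟨Y v, h2⟩ - ‖z‖ ^ 2 • ⟨Q v, h1⟩ := rfl
    rw [this, LinearPMap.map_sub, LinearPMap.map_add, LinearPMap.map_smul, LinearPMap.map_smul, e1]
  rw [e3] at key
  rw [← key]
  congr 1
  abel

theorem mul_comm' (h : IsPlanarResolvent T z Q Y) : Q * Y = Y * Q := by
  ext v
  obtain ⟨h1, e1⟩ := h.apply_left v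
  rw [mul_apply_eq_comp, mul_apply_eq_comp, ← e1, h.apply_map]

theorem mul_self_eq (h : IsPlanarResolvent T z Q Y) :
    Y * Y = Q + (2 * z.re) • (Y * Q) - ‖z‖ ^ 2 • (Q * Q) := by
  ext v
  obtain ⟨h1, e1⟩ := h.apply_left (Y v)
  obtain ⟨h2, e2⟩ := h.apply_right (Q v)
  have hc : Q (Y v) = Y (Q v) := congrArg (fun L : V →L[ℝ] V => L v) h.mul_comm'
  change Y (Y v) = Q v + (2 * z.re) • Y (Q v) - ‖z‖ ^ 2 • Q (Q v)
  rw [← e1, ← e2]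
  exact pmap_congr hc _ _

/-- The relative perturbation of `T² - 2 Re(w) T + |w|²` when `w` is replaced by `z`. -/
def perturbation (w : ℂ) (Q Y : V →L[ℝ] V) (z : ℂ) : V →L[ℝ] V :=
  (-(2 * (z.re - w.re))) • Y + (‖z‖ ^ 2 - ‖w‖ ^ 2) • Q

theorem of_isUnit (h : IsPlanarResolvent T w Q Y) (hu : IsUnit (1 + perturbation w Q Y z)) :
    IsPlanarResolvent T z (Q * Ring.inverse (1 + perturbation w Q Y z))
      (Y * Ring.inverse (1 + perturbation w Q Y z)) := by
  set J := Ring.inverse (1 + perturbation w Q Y z) with hJ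
  have hJ1 : ∀ v, v = J v + ((-(2 * (z.re - w.re))) • Y (J v) + (‖z‖ ^ 2 - ‖w‖ ^ 2) • Q (J v)) := fun v => by
    have := congrArg (fun L : V →L[ℝ] V => L v) (Ring.mul_inverse_cancel _ hu)
    exact this.symm
  have hJ2 : ∀ v, J (v + ((-(2 * (z.re - w.re))) • Y v + (‖z‖ ^ 2 - ‖w‖ ^ 2) • Q v)) = v := fun v => by
    exact congrArg (fun L : V →L[ℝ] V => L v) (Ring.inverse_mul_cancel _ hu)
  refine ⟨fun v => h.apply_left (J v), fun v => ?_, fun u h1 h2 => ?_⟩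
  · obtain ⟨h1, e1⟩ := h.apply_right (J v)
    refine ⟨h1, ?_⟩
    change T ⟨Y (J v), h1⟩ = v + (2 * z.re) • Y (J v) - ‖z‖ ^ 2 • Q (J v)
    rw [e1]
    nth_rewrite 4 [hJ1 v]
    module
  · set y := T ⟨T ⟨u, h1⟩, h2⟩ - (2 * w.re) • T ⟨u, h1⟩ + ‖w‖ ^ 2 • u with hy
    have hQy : Q y = u := h.left_inv u h1 h2
    have hYy : Y y = T ⟨u, h1⟩ := by
      obtain ⟨h3, e3⟩ := h.apply_left y
      rw [← e3]
      exact pmap_congr hQy _ _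
    have : T ⟨T ⟨u, h1⟩, h2⟩ - (2 * z.re) • T ⟨u, h1⟩ + ‖z‖ ^ 2 • u =
        y + ((-(2 * (z.re - w.re))) • Y y + (‖z‖ ^ 2 - ‖w‖ ^ 2) • Q y) := by
      rw [hQy, hYy, hy]; module
    rw [mul_apply_eq_comp, this, hJ2, hQy]

theorem perturbation_self : perturbation w Q Y w = 0 := by simp [perturbation]

theorem hasFDerivAt_perturbation : HasFDerivAt (perturbation w Q Y)
    ((-2 : ℝ) • Complex.reCLM.smulRight Y +
      ((2 * w.re) • Complex.reCLM + (2 * w.im) • Complex.imCLM).smulRight Q) w := by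
  have hre : HasFDerivAt (fun z : ℂ => z.re) Complex.reCLM w := Complex.reCLM.hasFDerivAt
  have him : HasFDerivAt (fun z : ℂ => z.im) Complex.imCLM w := Complex.imCLM.hasFDerivAt
  have h1 : HasFDerivAt (fun z : ℂ => -(2 * (z.re - w.re))) (-(2 : ℝ) • Complex.reCLM) w := by
    have := ((hre.sub_const w.re).const_mul (2 : ℝ)).neg
    rwa [← neg_smul] at this
  have h2 : HasFDerivAt (fun z : ℂ => ‖z‖ ^ 2 - ‖w‖ ^ 2)
      ((2 * w.re) • Complex.reCLM + (2 * w.im) • Complex.imCLM) w := by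
    have := (((hre.mul hre).add (him.mul him)).sub_const (‖w‖ ^ 2))
    refine (this.congr_fderiv ?_).congr_of_eventuallyEq (Filter.Eventually.of_forall fun z => ?_)
    · ext h; simp; ring
    · simp [← Complex.normSq_eq_norm_sq, Complex.normSq_apply]
  refine ((h1.smul_const Y).add (h2.smul_const Q)).congr_fderiv ?_
  ext h; simp [mul_smul, two_smul]

variable [CompleteSpace V]

theorem eventually_isUnit : ∀ᶠ z in nhds w, IsUnit (1 + perturbation w Q Y z) := by
  have hc : ContinuousAt (fun z => 1 + perturbation w Q Y z) w :=
    continuousAt_const.add hasFDerivAt_perturbation.continuousAt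
  refine hc.eventually (p := fun L => IsUnit L) (Units.isOpen.mem_nhds ?_)
  simp only [perturbation_self, add_zero]
  exact isUnit_one

/-- The derivatives of `Q` and `Y`, from the Neumann series at `w`. -/
theorem hasFDerivAt_inverse : HasFDerivAt (fun z => Ring.inverse (1 + perturbation w Q Y z))
    (-((-2 : ℝ) • Complex.reCLM.smulRight Y +
      ((2 * w.re) • Complex.reCLM + (2 * w.im) • Complex.imCLM).smulRight Q)) w := by
  have h1 : HasFDerivAt (fun z => 1 + perturbation w Q Y z) _ w :=
    hasFDerivAt_perturbation.const_add 1
  have h2 : HasFDerivAt Ring.inverse _ ((1 : (V →L[ℝ] V)ˣ) : V →L[ℝ] V) := hasFDerivAt_ringInverse (𝕜 := ℝ) 1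
  have h3 : (1 + perturbation w Q Y w) = ((1 : (V →L[ℝ] V)ˣ) : V →L[ℝ] V) := by
    rw [perturbation_self, add_zero, Units.val_one]
  rw [← h3] at h2
  refine (h2.comp w h1).congr_fderiv ?_
  ext h v; simp [add_comm]

/-- A locally defined resolvent family is real differentiable, and `x₀ Q - Y` and `-x₁ Q` satisfy
the Cauchy-Riemann equations. -/
theorem isCauchyRiemannAt {q y : ℂ → V →L[ℝ] V}
    (h : ∀ᶠ z in nhds w, IsPlanarResolvent T z (q z) (y z)) :
    IsCauchyRiemannAt (fun z => z.re • q z - y z) (fun z => -(z.im • q z)) w := by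
  have hw := h.self_of_nhds
  have hev : ∀ᶠ z in nhds w,
      q z = q w * Ring.inverse (1 + perturbation w (q w) (y w) z) ∧
        y z = y w * Ring.inverse (1 + perturbation w (q w) (y w) z) := by
    filter_upwards [h, eventually_isUnit (w := w) (Q := q w) (Y := y w)] with z hz hu
    exact (hw.of_isUnit hu).unique hz
  set D : ℂ →L[ℝ] (V →L[ℝ] V) := -((-2 : ℝ) • Complex.reCLM.smulRight (y w) +
      ((2 * w.re) • Complex.reCLM + (2 * w.im) • Complex.imCLM).smulRight (q w)) with hD
  have hi := hasFDerivAt_inverse (w := w) (Q := q w) (Y := y w)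
  have hq : HasFDerivAt q (q w • D) w :=
    (hi.const_mul (q w)).congr_of_eventuallyEq (hev.mono fun z hz => hz.1)
  have hy : HasFDerivAt y (y w • D) w :=
    (hi.const_mul (y w)).congr_of_eventuallyEq (hev.mono fun z hz => hz.2)
  have hc := hw.mul_comm'
  have hs := hw.mul_self_eq
  refine isCauchyRiemannAt_of_hasFDerivAt hq hy ?_ ?_ hc hs
  · simp [hD, sub_eq_add_neg, add_comm]
  · simp [hD]

end IsPlanarResolvent
end Resolvent

/-! ### Integrals over positively oriented boundaries -/

open MeasureTheory in
theorem IsPiecewiseC1Jordan.intervalIntegrable_deriv {γ : ℝ → ℂ} (h : IsPiecewiseC1Jordan γ) :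
    IntervalIntegrable (deriv γ) volume 0 1 := by
  obtain ⟨m, p, hp, hp0, hp1, hC⟩ := h.piecewise
  let a : ℕ → ℝ := fun k => p ⟨min k m, by omega⟩
  have key : ∀ k < m, IntervalIntegrable (deriv γ) volume (a k) (a (k + 1)) := fun k hk => by
    have ea : a k = p (Fin.castSucc ⟨k, hk⟩) := congrArg p (Fin.ext (by simp; omega))
    have eb : a (k + 1) = p (Fin.succ ⟨k, hk⟩) := congrArg p (Fin.ext (by simp; omega))
    have hlt : a k < a (k + 1) := by rw [ea, eb]; exact hp Fin.castSucc_lt_succ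
    have hc := hC ⟨k, hk⟩
    rw [← ea, ← eb] at hc
    have hcd := (hc.continuousOn_derivWithin (uniqueDiffOn_Icc hlt) le_rfl).intervalIntegrable_of_Icc
      hlt.le (μ := volume)
    refine hcd.congr_ae ?_
    rw [Filter.EventuallyEq, Set.uIoc_of_le hlt.le, ae_restrict_iff' measurableSet_Ioc]
    filter_upwards [Measure.ae_ne volume (a (k + 1))] with t h1 h2
    exact derivWithin_of_mem_nhds (Icc_mem_nhds h2.1 (lt_of_le_of_ne h2.2 h1))
  have hfin := IntervalIntegrable.trans_iterate key
  have e0 : a 0 = 0 := by rw [← hp0]; exact congrArg p (Fin.ext (by simp))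
  have e1 : a m = 1 := by rw [← hp1]; exact congrArg p (Fin.ext (by simp))
  rwa [e0, e1] at hfin

section Boundary
variable {U : Set ℂ} {N : ℕ} {γ : Fin N → ℝ → ℂ}

theorem IsPositiveBoundary.mem_frontier (h : IsPositiveBoundary U γ) (j : Fin N) {t : ℝ}
    (ht : t ∈ Set.Icc (0 : ℝ) 1) : γ j t ∈ frontier U := by
  rw [h.boundary.frontier_eq]
  exact Set.mem_iUnion.2 ⟨j, t, ht, rfl⟩

theorem IsPositiveBoundary.isBounded_frontier (h : IsPositiveBoundary U γ) :
    Bornology.IsBounded (frontier U) := by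
  rw [h.boundary.frontier_eq]
  exact Bornology.isBounded_iUnion.2 fun j =>
    (isCompact_Icc.image_of_continuousOn (h.boundary.jordan j).continuous).isBounded

theorem sum_integral_eq_windingNumber (γ : Fin N → ℝ → ℂ) (z : ℂ) :
    ∑ j, ∫ t in (0 : ℝ)..1, deriv (γ j) t / (γ j t - z) =
      2 * Real.pi * Complex.I * windingNumber γ z := by
  have hπ : (2 * Real.pi * Complex.I : ℂ) ≠ 0 := by simp [Real.pi_ne_zero]
  rw [windingNumber, mul_inv_cancel_left₀ hπ]

/-- Two unbounded Cauchy domains that contain `K` and have closure in `D` have homologous boundaries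
in `D \ K`. -/
theorem IsPositiveBoundary.sum_integral_eq {U' : Set ℂ} {N' : ℕ} {γ' : Fin N' → ℝ → ℂ}
    (h : IsPositiveBoundary U γ) (h' : IsPositiveBoundary U' γ') (hU : IsOpen U) (hU' : IsOpen U')
    (hb : ¬ Bornology.IsBounded U) (hb' : ¬ Bornology.IsBounded U') {K D : Set ℂ}
    (hΩ : IsOpen (D \ K)) (hK : K ⊆ U) (hK' : K ⊆ U') (hD : closure U ⊆ D) (hD' : closure U' ⊆ D)
    {f : ℂ → ℂ} (hf : DifferentiableOn ℂ f (D \ K)) :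
    ∑ j, ∫ t in (0 : ℝ)..1, f (γ j t) * deriv (γ j) t =
      ∑ j, ∫ t in (0 : ℝ)..1, f (γ' j t) * deriv (γ' j) t := by
  have hfr : ∀ z ∈ frontier U, z ∈ closure U ∧ z ∉ U := fun z hz => by
    rwa [hU.frontier_eq] at hz
  have hfr' : ∀ z ∈ frontier U', z ∈ closure U' ∧ z ∉ U' := fun z hz => by
    rwa [hU'.frontier_eq] at hz
  have key := sum_integral_eq_zero_of_index_eq_zero (ι := Fin N ⊕ Fin N') (w := Sum.elim γ γ')
    (g := Sum.elim (fun j => deriv (γ j)) fun j t => -deriv (γ' j) t)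
    (Z := (U ∩ U') ∪ (closure U ∪ closure U')ᶜ) (f := f) (Ω := D \ K) ?_ ?_ hΩ ?_ ?_ ?_ ?_ ?_ ?_ hf
  · rw [Fintype.sum_sum_type] at key
    simp only [Sum.elim_inl, Sum.elim_inr, mul_neg, intervalIntegral.integral_neg,
      Finset.sum_neg_distrib] at key
    exact sub_eq_zero.1 (by rw [sub_eq_add_neg]; exact key)
  · rintro (j | j)
    · exact (h.boundary.jordan j).continuous
    · exact (h'.boundary.jordan j).continuous
  · rintro (j | j)
    · exact (h.boundary.jordan j).intervalIntegrable_deriv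
    · exact (h'.boundary.jordan j).intervalIntegrable_deriv.neg
  · rintro (j | j) t ht
    · have := hfr _ (h.mem_frontier j ht)
      exact ⟨hD this.1, fun hk => this.2 (hK hk)⟩
    · have := hfr' _ (h'.mem_frontier j ht)
      exact ⟨hD' this.1, fun hk => this.2 (hK' hk)⟩
  · exact (hU.inter hU').union (isClosed_closure.union isClosed_closure).isOpen_compl
  · intro z hz
    rw [Set.compl_union, compl_compl] at hz
    exact ⟨hz.2.elim (fun h => hD h) (fun h => hD' h), fun hk => hz.1 ⟨hK hk, hK' hk⟩⟩
  · have h1 := (isBounded_compl_of_isBounded_frontier hb h.isBounded_frontier).union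
      (isBounded_compl_of_isBounded_frontier hb' h'.isBounded_frontier)
    refine h1.subset ?_
    rw [← Set.compl_inter]
    exact Set.compl_subset_compl.2 Set.subset_union_left
  · rintro (j | j) t ht hz
    · have := hfr _ (h.mem_frontier j ht)
      exact hz.elim (fun hz => this.2 hz.1) fun hz => hz (Or.inl this.1)
    · have := hfr' _ (h'.mem_frontier j ht)
      exact hz.elim (fun hz => this.2 hz.2) fun hz => hz (Or.inr this.1)
  · intro z hz
    rw [Fintype.sum_sum_type]
    simp only [Sum.elim_inl, Sum.elim_inr, neg_div, intervalIntegral.integral_neg,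
      Finset.sum_neg_distrib, sum_integral_eq_windingNumber]
    rcases hz with hz | hz
    · rw [h.winding_inside z hz.1, h'.winding_inside z hz.2, if_neg hb, if_neg hb']
      simp
    · rw [Set.mem_compl_iff, Set.mem_union, not_or] at hz
      rw [h.winding_outside z hz.1, h'.winding_outside z hz.2, if_neg hb, if_neg hb']
      simp

open MeasureTheory in
theorem intervalIntegral_conj (F : ℝ → ℂ) :
    ∫ t in (0 : ℝ)..1, (starRingEnd ℂ) (F t) = (starRingEnd ℂ) (∫ t in (0 : ℝ)..1, F t) := by
  rw [intervalIntegral.integral_of_le zero_le_one, intervalIntegral.integral_of_le zero_le_one,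
    integral_conj]

/-- The boundary of a symmetric Cauchy domain is homologous to its reversed conjugate. Hence the
integral of a function with `f(z̄) = conj f(z)` is purely imaginary. -/
theorem IsPositiveBoundary.sum_integral_re_eq_zero (h : IsPositiveBoundary U γ) (hU : IsOpen U)
    (hb : ¬ Bornology.IsBounded U) (hsymm : ∀ z ∈ U, (starRingEnd ℂ) z ∈ U) {K D : Set ℂ}
    (hΩ : IsOpen (D \ K)) (hK : K ⊆ U) (hD : closure U ⊆ D)
    {f : ℂ → ℂ} (hf : DifferentiableOn ℂ f (D \ K))
    (hΩsymm : ∀ z ∈ D \ K, (starRingEnd ℂ) z ∈ D \ K)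
    (hfsymm : ∀ z ∈ D \ K, f ((starRingEnd ℂ) z) = (starRingEnd ℂ) (f z)) :
    (∑ j, ∫ t in (0 : ℝ)..1, f (γ j t) * deriv (γ j) t).re = 0 := by
  have hfr : ∀ z ∈ frontier U, z ∈ closure U ∧ z ∉ U := fun z hz => by
    rwa [hU.frontier_eq] at hz
  have hUeq : (starRingEnd ℂ) ⁻¹' U = U := by
    ext z
    refine ⟨fun hz => ?_, hsymm z⟩
    have := hsymm _ hz
    rwa [Complex.conj_conj] at this
  have hcl : ∀ z, (starRingEnd ℂ) z ∈ closure U ↔ z ∈ closure U := fun z => by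
    have h1 : (Complex.conjCLE.toHomeomorph) ⁻¹' closure U =
        closure (Complex.conjCLE.toHomeomorph ⁻¹' U) := Homeomorph.preimage_closure _ _
    have h2 : (Complex.conjCLE.toHomeomorph) ⁻¹' U = U := hUeq
    rw [h2] at h1
    exact Set.ext_iff.1 h1 z
  have hΩj : ∀ j, ∀ t ∈ Set.Icc (0 : ℝ) 1, γ j t ∈ D \ K := fun j t ht => by
    have := hfr _ (h.mem_frontier j ht)
    exact ⟨hD this.1, fun hk => this.2 (hK hk)⟩
  have key := sum_integral_eq_zero_of_index_eq_zero (ι := Fin N ⊕ Fin N)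
    (w := Sum.elim γ fun j t => (starRingEnd ℂ) (γ j t))
    (g := Sum.elim (fun j => deriv (γ j)) fun j t => (starRingEnd ℂ) (deriv (γ j) t))
    (Z := U ∪ (closure U)ᶜ) (f := f) (Ω := D \ K) ?_ ?_ hΩ ?_ ?_ ?_ ?_ ?_ ?_ hf
  · rw [Fintype.sum_sum_type] at key
    simp only [Sum.elim_inl, Sum.elim_inr] at key
    have e : ∀ j, ∫ t in (0 : ℝ)..1, f ((starRingEnd ℂ) (γ j t)) * (starRingEnd ℂ) (deriv (γ j) t) =
        (starRingEnd ℂ) (∫ t in (0 : ℝ)..1, f (γ j t) * deriv (γ j) t) := fun j => by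
      rw [← intervalIntegral_conj]
      refine intervalIntegral.integral_congr fun t ht => ?_
      rw [Set.uIcc_of_le zero_le_one] at ht
      simp only [hfsymm _ (hΩj j t ht), map_mul]
    simp only [e, ← map_sum] at key
    have := congrArg Complex.re key
    rw [Complex.add_re, Complex.conj_re, Complex.zero_re] at this
    linarith
  · rintro (j | j)
    · exact (h.boundary.jordan j).continuous
    · exact Complex.continuous_conj.comp_continuousOn (h.boundary.jordan j).continuous
  · rintro (j | j)
    · exact (h.boundary.jordan j).intervalIntegrable_deriv
    · have := (h.boundary.jordan j).intervalIntegrable_deriv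
      rw [intervalIntegrable_iff] at this ⊢
      exact Complex.conjCLE.toContinuousLinearMap.integrable_comp this
  · rintro (j | j) t ht
    · exact hΩj j t ht
    · exact hΩsymm _ (hΩj j t ht)
  · exact hU.union isClosed_closure.isOpen_compl
  · intro z hz
    rw [Set.compl_union, compl_compl] at hz
    exact ⟨hD hz.2, fun hk => hz.1 (hK hk)⟩
  · exact (isBounded_compl_of_isBounded_frontier hb h.isBounded_frontier).subset
      (Set.compl_subset_compl.2 Set.subset_union_left)
  · rintro (j | j) t ht hz
    · have := hfr _ (h.mem_frontier j ht)
      exact hz.elim (fun hz => this.2 hz) fun hz => hz this.1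
    · have := hfr _ (h.mem_frontier j ht)
      refine hz.elim (fun hz => this.2 ?_) fun hz => hz ((hcl _).2 this.1)
      have := hsymm _ hz
      simpa using this
  · intro z hz
    have e : ∀ j, ∫ t in (0 : ℝ)..1, (starRingEnd ℂ) (deriv (γ j) t) / ((starRingEnd ℂ) (γ j t) - z) =
        (starRingEnd ℂ) (∫ t in (0 : ℝ)..1, deriv (γ j) t / (γ j t - (starRingEnd ℂ) z)) := fun j => by
      rw [← intervalIntegral_conj]
      simp
    rw [Fintype.sum_sum_type]
    simp only [Sum.elim_inl, Sum.elim_inr, e, ← map_sum, sum_integral_eq_windingNumber]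
    rcases hz with hz | hz
    · rw [h.winding_inside z hz, h.winding_inside _ (hsymm z hz), if_neg hb]
      simp
    · rw [h.winding_outside z hz, h.winding_outside _ (fun h' => hz ((hcl z).1 h')), if_neg hb]
      simp [map_ofNat]
end Boundary

/-! ### Cauchy integrals of products of stem functions -/

section Stem
variable {E F G : Type*} [NormedAddCommGroup E] [NormedSpace ℝ E] [NormedAddCommGroup F]
  [NormedSpace ℝ F] [NormedAddCommGroup G] [NormedSpace ℝ G]

/-- The value on the tangent vector `w` of the differential form `-i dz (P + i R)(α + i β)`, where
the real part of the product is formed with the bilinear map `B₁` and its imaginary part, which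
carries the imaginary unit `I` between the two factors, with `B₂`. -/
def stemForm (B₁ B₂ : E →L[ℝ] F →L[ℝ] G) (P R : ℂ → E) (α β : ℂ → F) (z w : ℂ) : G :=
  w.im • ((B₁ (P z) (α z) - B₁ (R z) (β z)) + (B₂ (P z) (β z) + B₂ (R z) (α z))) +
    w.re • ((B₁ (P z) (β z) + B₁ (R z) (α z)) - (B₂ (P z) (α z) - B₂ (R z) (β z)))

/-- The complex function `ℓ((P + i R)(α + i β))` for a real functional `ℓ`. -/
def stemProd (B : E →L[ℝ] F →L[ℝ] G) (ℓ : G →L[ℝ] ℝ) (P R : ℂ → E) (α β : ℂ → F) (z : ℂ) : ℂ :=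
  ((ℓ (B (P z) (α z)) - ℓ (B (R z) (β z)) : ℝ) : ℂ) +
    ((ℓ (B (P z) (β z)) + ℓ (B (R z) (α z)) : ℝ) : ℂ) * Complex.I

variable {P R : ℂ → E} {α β : ℂ → F} {Ω : Set ℂ} {B₁ B₂ B : E →L[ℝ] F →L[ℝ] G}

theorem differentiableOn_stemProd (hPR : ∀ z ∈ Ω, IsCauchyRiemannAt P R z)
    (hαβ : ∀ z ∈ Ω, IsCauchyRiemannAt α β z) (ℓ : G →L[ℝ] ℝ) :
    DifferentiableOn ℂ (stemProd B ℓ P R α β) Ω := fun z hz =>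
  ((hPR z hz).differentiableAt_bilin (hαβ z hz)
    ((ContinuousLinearMap.compL ℝ F G ℝ ℓ).comp B)).differentiableWithinAt

theorem apply_stemForm (ℓ : G →L[ℝ] ℝ) (z w : ℂ) : ℓ (stemForm B₁ B₂ P R α β z w) =
    (stemProd B₁ ℓ P R α β z * w).im - (stemProd B₂ ℓ P R α β z * w).re := by
  simp only [stemForm, stemProd, map_add, map_sub, map_smul, smul_eq_mul, Complex.mul_im,
    Complex.mul_re, Complex.add_re, Complex.add_im, Complex.ofReal_re, Complex.ofReal_im,
    Complex.I_re, Complex.I_im]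
  ring

theorem IsCauchyRiemannAt.continuousAt {P R : ℂ → E} {z : ℂ} (h : IsCauchyRiemannAt P R z) :
    ContinuousAt P z ∧ ContinuousAt R z := by
  obtain ⟨P', R', h1, h2, -⟩ := h
  exact ⟨h1.continuousAt, h2.continuousAt⟩

theorem IsPiecewiseC1Jordan.continuousOn_comp {γ : ℝ → ℂ} (hγ : IsPiecewiseC1Jordan γ)
    (hγΩ : ∀ t ∈ Set.Icc (0 : ℝ) 1, γ t ∈ Ω) {u : ℂ → E} (hu : ∀ z ∈ Ω, ContinuousAt u z) :
    ContinuousOn (fun t => u (γ t)) (Set.uIcc 0 1) := by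
  rw [Set.uIcc_of_le zero_le_one]
  exact ContinuousOn.comp (t := Ω) (fun z hz => (hu z hz).continuousWithinAt) hγ.continuous hγΩ

open MeasureTheory in
theorem intervalIntegrable_stemForm (hPR : ∀ z ∈ Ω, IsCauchyRiemannAt P R z)
    (hαβ : ∀ z ∈ Ω, IsCauchyRiemannAt α β z) {γ : ℝ → ℂ} (hγ : IsPiecewiseC1Jordan γ)
    (hγΩ : ∀ t ∈ Set.Icc (0 : ℝ) 1, γ t ∈ Ω) :
    IntervalIntegrable (fun t => stemForm B₁ B₂ P R α β (γ t) (deriv γ t)) volume 0 1 := by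
  have hP := hγ.continuousOn_comp hγΩ fun z hz => (hPR z hz).continuousAt.1
  have hR := hγ.continuousOn_comp hγΩ fun z hz => (hPR z hz).continuousAt.2
  have hα := hγ.continuousOn_comp hγΩ fun z hz => (hαβ z hz).continuousAt.1
  have hβ := hγ.continuousOn_comp hγΩ fun z hz => (hαβ z hz).continuousAt.2
  have hd := hγ.intervalIntegrable_deriv
  have him : IntervalIntegrable (fun t => (deriv γ t).im) volume 0 1 := by
    rw [intervalIntegrable_iff] at hd ⊢
    exact Complex.imCLM.integrable_comp hd
  have hre : IntervalIntegrable (fun t => (deriv γ t).re) volume 0 1 := by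
    rw [intervalIntegrable_iff] at hd ⊢
    exact Complex.reCLM.integrable_comp hd
  have hB : ∀ (B : E →L[ℝ] F →L[ℝ] G) {u : ℝ → E} {v : ℝ → F}, ContinuousOn u (Set.uIcc 0 1) →
      ContinuousOn v (Set.uIcc 0 1) → ContinuousOn (fun t => B (u t) (v t)) (Set.uIcc 0 1) :=
    fun B u v hu hv => (B.continuous.comp_continuousOn hu).clm_apply hv
  refine (him.smul_continuousOn ?_).add (hre.smul_continuousOn ?_)
  · exact ((hB B₁ hP hα).sub (hB B₁ hR hβ)).add ((hB B₂ hP hβ).add (hB B₂ hR hα))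
  · exact ((hB B₁ hP hβ).add (hB B₁ hR hα)).sub ((hB B₂ hP hα).sub (hB B₂ hR hβ))

/-- For symmetric stem functions the part of the integral that contains the imaginary unit
vanishes. -/
theorem apply_sum_integral_stemForm [CompleteSpace G] {K D : Set ℂ} (hΩ : IsOpen (D \ K))
    (hΩsymm : ∀ z ∈ D \ K, (starRingEnd ℂ) z ∈ D \ K)
    (hPR : ∀ z ∈ D \ K, IsCauchyRiemannAt P R z) (hαβ : ∀ z ∈ D \ K, IsCauchyRiemannAt α β z)
    (hPs : ∀ z ∈ D \ K, P ((starRingEnd ℂ) z) = P z ∧ R ((starRingEnd ℂ) z) = -R z)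
    (hαs : ∀ z ∈ D \ K, α ((starRingEnd ℂ) z) = α z ∧ β ((starRingEnd ℂ) z) = -β z)
    {U : Set ℂ} {N : ℕ} {γ : Fin N → ℝ → ℂ} (h : IsPositiveBoundary U γ) (hU : IsOpen U)
    (hb : ¬ Bornology.IsBounded U) (hsymm : ∀ z ∈ U, (starRingEnd ℂ) z ∈ U)
    (hK : K ⊆ U) (hD : closure U ⊆ D) (ℓ : G →L[ℝ] ℝ) :
    ℓ (∑ j, ∫ t in (0 : ℝ)..1, stemForm B₁ B₂ P R α β (γ j t) (deriv (γ j) t)) =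
      (∑ j, ∫ t in (0 : ℝ)..1, stemProd B₁ ℓ P R α β (γ j t) * deriv (γ j) t).im := by
  have hγΩ : ∀ j, ∀ t ∈ Set.Icc (0 : ℝ) 1, γ j t ∈ D \ K := fun j t ht => by
    have := h.mem_frontier j ht
    rw [hU.frontier_eq] at this
    exact ⟨hD this.1, fun hk => this.2 (hK hk)⟩
  have hint : ∀ B : E →L[ℝ] F →L[ℝ] G, ∀ j, IntervalIntegrable
      (fun t => stemProd B ℓ P R α β (γ j t) * deriv (γ j) t) MeasureTheory.volume 0 1 := fun B j => by
    refine (h.boundary.jordan j).intervalIntegrable_deriv.continuousOn_mul ?_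
    rw [Set.uIcc_of_le zero_le_one]
    exact (differentiableOn_stemProd hPR hαβ ℓ).continuousOn.comp (h.boundary.jordan j).continuous
      (hγΩ j)
  have hzero : (∑ j, ∫ t in (0 : ℝ)..1, stemProd B₂ ℓ P R α β (γ j t) * deriv (γ j) t).re = 0 := by
    refine h.sum_integral_re_eq_zero hU hb hsymm hΩ hK hD (differentiableOn_stemProd hPR hαβ ℓ)
      hΩsymm fun z hz => ?_
    simp only [stemProd, (hPs z hz).1, (hPs z hz).2, (hαs z hz).1, (hαs z hz).2]
    apply Complex.ext <;> simp
    ring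
  have e : ∀ j, ℓ (∫ t in (0 : ℝ)..1, stemForm B₁ B₂ P R α β (γ j t) (deriv (γ j) t)) =
      (∫ t in (0 : ℝ)..1, stemProd B₁ ℓ P R α β (γ j t) * deriv (γ j) t).im -
        (∫ t in (0 : ℝ)..1, stemProd B₂ ℓ P R α β (γ j t) * deriv (γ j) t).re := fun j => by
    rw [← ℓ.intervalIntegral_comp_comm
      (intervalIntegrable_stemForm hPR hαβ (h.boundary.jordan j) (hγΩ j))]
    have e1 := Complex.imCLM.intervalIntegral_comp_comm (hint B₁ j)
    have e2 := Complex.reCLM.intervalIntegral_comp_comm (hint B₂ j)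
    simp only [Complex.imCLM_apply, Complex.reCLM_apply] at e1 e2
    rw [← e1, ← e2, ← intervalIntegral.integral_sub]
    · simp only [apply_stemForm]
    · have := hint B₁ j
      rw [intervalIntegrable_iff] at this ⊢
      exact Complex.imCLM.integrable_comp this
    · have := hint B₂ j
      rw [intervalIntegrable_iff] at this ⊢
      exact Complex.reCLM.integrable_comp this
  rw [map_sum]
  simp only [e]
  rw [Finset.sum_sub_distrib, ← Complex.im_sum, ← Complex.re_sum, hzero, sub_zero]

/-- The integral of the product of two symmetric holomorphic stem functions is independent of the
Cauchy domain and of the bilinear map `B₂`, that is, of the imaginary unit. -/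
theorem sum_integral_stemForm_eq [CompleteSpace G] {K D : Set ℂ} (hΩ : IsOpen (D \ K))
    (hΩsymm : ∀ z ∈ D \ K, (starRingEnd ℂ) z ∈ D \ K)
    (hPR : ∀ z ∈ D \ K, IsCauchyRiemannAt P R z) (hαβ : ∀ z ∈ D \ K, IsCauchyRiemannAt α β z)
    (hPs : ∀ z ∈ D \ K, P ((starRingEnd ℂ) z) = P z ∧ R ((starRingEnd ℂ) z) = -R z)
    (hαs : ∀ z ∈ D \ K, α ((starRingEnd ℂ) z) = α z ∧ β ((starRingEnd ℂ) z) = -β z)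
    {U : Set ℂ} {N : ℕ} {γ : Fin N → ℝ → ℂ} (h : IsPositiveBoundary U γ) (hU : IsOpen U)
    (hb : ¬ Bornology.IsBounded U) (hsymm : ∀ z ∈ U, (starRingEnd ℂ) z ∈ U)
    (hK : K ⊆ U) (hD : closure U ⊆ D)
    {U' : Set ℂ} {N' : ℕ} {γ' : Fin N' → ℝ → ℂ} (h' : IsPositiveBoundary U' γ') (hU' : IsOpen U')
    (hb' : ¬ Bornology.IsBounded U') (hsymm' : ∀ z ∈ U', (starRingEnd ℂ) z ∈ U')
    (hK' : K ⊆ U') (hD' : closure U' ⊆ D) (B₃ : E →L[ℝ] F →L[ℝ] G) :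
    ∑ j, ∫ t in (0 : ℝ)..1, stemForm B₁ B₂ P R α β (γ j t) (deriv (γ j) t) =
      ∑ j, ∫ t in (0 : ℝ)..1, stemForm B₁ B₃ P R α β (γ' j t) (deriv (γ' j) t) := by
  refine (SeparatingDual.eq_iff_forall_dual_eq (R := ℝ)).2 fun ℓ => ?_
  rw [apply_sum_integral_stemForm hΩ hΩsymm hPR hαβ hPs hαs h hU hb hsymm hK hD,
    apply_sum_integral_stemForm hΩ hΩsymm hPR hαβ hPs hαs h' hU' hb' hsymm' hK' hD',
    h.sum_integral_eq h' hU hU' hb hb' hΩ hK hK' hD hD' (differentiableOn_stemProd hPR hαβ ℓ)]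

end Stem

/-! ### Slices of axially symmetric sets -/

section SliceAlgebra
variable {A : Type*} [NormedAddCommGroup A] [NormedSpace ℝ A] [Mul A] [One A] [ParavectorData A]

variable (A) in
/-- The properties shared by `ℍ` and `ℝₙ`, `n ≥ 1`, on which the functional calculus rests. The norm
of `A` need not be submultiplicative; of the product only the multiplications by imaginary units
are needed, and that they have square `-1`. -/
structure IsSliceAlgebra : Prop where
  toPlane_mem : ∀ I ∈ imagUnits A, ∀ z, toPlane I z ∈ paravec A
  rePart_toPlane : ∀ I ∈ imagUnits A, ∀ z, rePart (toPlane I z) = z.re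
  norm_toPlane : ∀ I ∈ imagUnits A, ∀ z, ‖toPlane I z‖ = ‖z‖
  exists_eq_toPlane : ∀ x ∈ paravec A, ∃ I ∈ imagUnits A,
    x = toPlane I ⟨rePart x, ‖x - rePart x • (1 : A)‖⟩
  nonempty : (imagUnits A).Nonempty
  isClosed_paravec : IsClosed (paravec A)
  continuous_rePart : Continuous (rePart : A → ℝ)
  exists_mulLeft : ∀ I ∈ imagUnits A, ∃ M : A →L[ℝ] A, (∀ x, M x = I * x) ∧ ∀ x, M (M x) = -x
  exists_mulRight : ∀ I ∈ imagUnits A, ∃ M : A →L[ℝ] A, (∀ x, M x = x * I) ∧ ∀ x, M (M x) = -x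

theorem toPlane_neg (I : A) (z : ℂ) : toPlane (-I) z = toPlane I ((starRingEnd ℂ) z) := by
  simp [toPlane]

/-- The embedding `ℂ → ℂ_I ⊆ A` as a continuous real linear map. -/
def toPlaneCLM (I : A) : ℂ →L[ℝ] A :=
  Complex.reCLM.smulRight (1 : A) + Complex.imCLM.smulRight I

@[simp] theorem toPlaneCLM_apply (I : A) (z : ℂ) : toPlaneCLM I z = toPlane I z := rfl

theorem continuous_toPlane (I : A) : Continuous (toPlane I) := (toPlaneCLM I).continuous

/-- The point of the closed upper half-plane that corresponds to `x = Re x + x̲`. -/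
def halfPlanePt (x : A) : ℂ := ⟨rePart x, ‖x - rePart x • (1 : A)‖⟩

namespace IsSliceAlgebra
variable (hA : IsSliceAlgebra A) {I J : A} {U D : Set A}
include hA

theorem neg_mem (hI : I ∈ imagUnits A) : -I ∈ imagUnits A := by
  have e : toPlane I (-Complex.I) = -I := by simp [toPlane]
  refine ⟨e ▸ hA.toPlane_mem I hI _, ?_, by rw [norm_neg, hI.2.2]⟩
  rw [← e, hA.rePart_toPlane I hI]
  simp

theorem toPlane_sub (hI : I ∈ imagUnits A) (z : ℂ) :
    ‖toPlane I z - rePart (toPlane I z) • (1 : A)‖ = |z.im| := by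
  rw [hA.rePart_toPlane I hI, toPlane, add_sub_cancel_left, norm_smul, hI.2.2, mul_one,
    Real.norm_eq_abs]

theorem halfPlanePt_toPlane (hI : I ∈ imagUnits A) (z : ℂ) :
    halfPlanePt (toPlane I z) = ⟨z.re, |z.im|⟩ := by
  rw [halfPlanePt, hA.toPlane_sub hI, hA.rePart_toPlane I hI]

theorem conjPara_toPlane (hI : I ∈ imagUnits A) (z : ℂ) :
    conjPara (toPlane I z) = toPlane I ((starRingEnd ℂ) z) := by
  rw [conjPara, hA.rePart_toPlane I hI, toPlane, toPlane]
  simp only [Complex.conj_re, Complex.conj_im]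
  module

theorem continuous_halfPlanePt : Continuous (halfPlanePt : A → ℂ) := by
  have h1 := hA.continuous_rePart
  have h2 : Continuous fun x : A => ‖x - rePart x • (1 : A)‖ :=
    (continuous_id.sub (h1.smul continuous_const)).norm
  exact Complex.equivRealProdCLM.symm.continuous.comp (h1.prodMk h2)

theorem isUnbounded_of_isUnbounded_planeSlice (hI : I ∈ imagUnits A)
    (h : ¬ Bornology.IsBounded (planeSlice I U)) : ¬ Bornology.IsBounded U := by
  intro hb
  obtain ⟨C, hC⟩ := isBounded_iff_forall_norm_le.1 hb
  refine h (isBounded_iff_forall_norm_le.2 ⟨C, fun z hz => ?_⟩)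
  rw [← hA.norm_toPlane I hI]
  exact hC _ hz

theorem toPlane_mem_of_symmetric (hU : IsAxiallySymmetric U) (hI : I ∈ imagUnits A)
    (hJ : J ∈ imagUnits A) {z w : ℂ} (hz : toPlane I z ∈ U) (hre : w.re = z.re)
    (him : |w.im| = |z.im|) : toPlane J w ∈ U := by
  have key : ∀ K ∈ imagUnits A, toPlane K ⟨z.re, |z.im|⟩ ∈ U := fun K hK => by
    refine hU.2 _ hz ⟨K, hK, ?_⟩
    rw [hA.toPlane_sub hI, hA.rePart_toPlane I hI]
    rfl
  -- A point with negative imaginary part is a point of the plane of `-J` in the upper half-plane.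
  rcases abs_cases w.im with h | h
  · convert key J hJ using 2
    exact Complex.ext hre (h.1.symm.trans him)
  · have := key (-J) (hA.neg_mem hJ)
    rw [toPlane_neg] at this
    convert this using 2
    refine Complex.ext hre ?_
    rw [Complex.conj_im, ← him, h.1, neg_neg]

theorem conj_mem_planeSlice (hU : IsAxiallySymmetric U) (hI : I ∈ imagUnits A) {z : ℂ}
    (hz : z ∈ planeSlice I U) : (starRingEnd ℂ) z ∈ planeSlice I U :=
  hA.toPlane_mem_of_symmetric hU hI hI hz (by simp) (by simp)

theorem planeSlice_congr (hU : IsAxiallySymmetric U) (hI : I ∈ imagUnits A)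
    (hJ : J ∈ imagUnits A) : planeSlice I U = planeSlice J U := by
  ext z
  exact ⟨fun h => hA.toPlane_mem_of_symmetric hU hI hJ h rfl rfl,
    fun h => hA.toPlane_mem_of_symmetric hU hJ hI h rfl rfl⟩

theorem isUnbounded_planeSlice (hU : IsAxiallySymmetric U) (hI : I ∈ imagUnits A)
    (h : ¬ Bornology.IsBounded U) : ¬ Bornology.IsBounded (planeSlice I U) := by
  intro hb
  obtain ⟨C, hC⟩ := isBounded_iff_forall_norm_le.1 hb
  refine h (isBounded_iff_forall_norm_le.2 ⟨C, fun x hx => ?_⟩)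
  obtain ⟨J, hJ, e⟩ := hA.exists_eq_toPlane x (hU.1 hx)
  rw [e] at hx ⊢
  rw [hA.norm_toPlane J hJ]
  exact hC _ (hA.toPlane_mem_of_symmetric hU hJ hI hx rfl rfl)

theorem isOpen_planeSlice (hD : IsOpenInParavec D) (hI : I ∈ imagUnits A) :
    IsOpen (planeSlice I D) := by
  obtain ⟨O, hO, rfl⟩ := hD
  have : planeSlice I (O ∩ paravec A) = toPlane I ⁻¹' O := by
    ext z
    exact ⟨fun h => h.1, fun h => ⟨h, hA.toPlane_mem I hI z⟩⟩
  rw [this]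
  exact hO.preimage (continuous_toPlane I)

/-- The limit at infinity is unique, since `𝔽₀` is unbounded. -/
theorem neBot_infinity :
    (Bornology.cobounded A ⊓ Filter.principal (paravec A)).NeBot := by
  obtain ⟨I, hI⟩ := hA.nonempty
  have h : Filter.Tendsto (fun r : ℝ => toPlane I (r : ℂ)) Filter.atTop
      (Bornology.cobounded A ⊓ Filter.principal (paravec A)) := by
    refine Filter.tendsto_inf.2 ⟨?_, Filter.tendsto_principal.2
      (Filter.Eventually.of_forall fun r => hA.toPlane_mem I hI _)⟩
    rw [← tendsto_norm_atTop_iff_cobounded]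
    simp only [hA.norm_toPlane I hI, Complex.norm_real]
    exact tendsto_norm_atTop_atTop
  exact h.neBot

/-- A symmetric Cauchy domain in `ℂ` is the common slice of a slice Cauchy domain. -/
theorem exists_planeSlice_eq {U' : Set ℂ} (hU' : ∀ z ∈ U', (starRingEnd ℂ) z ∈ U') :
    ∃ U : Set A, IsAxiallySymmetric U ∧ (∀ I ∈ imagUnits A, planeSlice I U = U') ∧
      ∀ x, x ∈ U ↔ x ∈ paravec A ∧ halfPlanePt x ∈ U' := by
  have habs : ∀ z : ℂ, (⟨z.re, |z.im|⟩ : ℂ) ∈ U' ↔ z ∈ U' := fun z => by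
    rcases abs_cases z.im with h | h
    · rw [h.1]
    · rw [h.1]
      have e : (starRingEnd ℂ) ⟨z.re, -z.im⟩ = z := Complex.ext rfl (neg_neg _)
      exact ⟨fun hz => e ▸ hU' _ hz, fun hz => hU' _ hz⟩
  refine ⟨{x | x ∈ paravec A ∧ halfPlanePt x ∈ U'}, ⟨fun x hx => hx.1, ?_⟩, fun I hI => ?_,
    fun x => Iff.rfl⟩
  · rintro x ⟨-, hx⟩ y ⟨I, hI, rfl⟩
    have e : rePart x • (1 : A) + ‖x - rePart x • (1 : A)‖ • I = toPlane I (halfPlanePt x) := rfl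
    refine ⟨e ▸ hA.toPlane_mem I hI _, ?_⟩
    rw [e, hA.halfPlanePt_toPlane hI]
    exact (habs _).2 hx
  · ext z
    refine ⟨fun h => ?_, fun h => ⟨hA.toPlane_mem I hI _, ?_⟩⟩
    · have := h.2
      rw [hA.halfPlanePt_toPlane hI] at this
      exact (habs _).1 this
    · rw [hA.halfPlanePt_toPlane hI]
      exact (habs _).2 h

end IsSliceAlgebra

/-! ### Stem functions of slice hyperholomorphic functions -/

theorem IsCauchyRiemannAt.clm_comp {E F : Type*} [NormedAddCommGroup E] [NormedSpace ℝ E]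
    [NormedAddCommGroup F] [NormedSpace ℝ F] {P R : ℂ → E} {z : ℂ} (h : IsCauchyRiemannAt P R z)
    (L : E →L[ℝ] F) : IsCauchyRiemannAt (fun z => L (P z)) (fun z => L (R z)) z := by
  obtain ⟨P', R', h1, h2, e1, e2⟩ := h
  refine ⟨L.comp P', L.comp R', L.hasFDerivAt.comp z h1, L.hasFDerivAt.comp z h2, ?_, ?_⟩
  · simp [e1]
  · simp [e2]

/-- The pair `(α, β)` is recovered from the values of `α + I β` at `z` and `z̄`, hence is real
differentiable, so that its partial derivatives give the Cauchy-Riemann equations. Here `M` is the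
multiplication by `I`, from the left or from the right. -/
theorem isCauchyRiemannAt_stem {E : Type*} [NormedAddCommGroup E] [NormedSpace ℝ E] {M : E →L[ℝ] E}
    (hM : ∀ x, M (M x) = -x) {g : ℂ → E} {Ω : Set ℂ} (hΩ : IsOpen Ω)
    (hsymm : ∀ z ∈ Ω, (starRingEnd ℂ) z ∈ Ω) (hg : DifferentiableOn ℝ g Ω) {α β : ℝ → ℝ → E}
    (h : ∀ z ∈ Ω, g z = α z.re z.im + M (β z.re z.im) ∧ α z.re (-z.im) = α z.re z.im ∧
      β z.re (-z.im) = -β z.re z.im ∧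
      deriv (fun t => α t z.im) z.re = deriv (fun t => β z.re t) z.im ∧
      deriv (fun t => β t z.im) z.re = -deriv (fun t => α z.re t) z.im) {z : ℂ} (hz : z ∈ Ω) :
    IsCauchyRiemannAt (fun z => α z.re z.im) (fun z => β z.re z.im) z := by
  have hconj : ∀ w ∈ Ω, g ((starRingEnd ℂ) w) = α w.re w.im - M (β w.re w.im) := fun w hw => by
    have h1 := (h _ (hsymm w hw)).1
    have h2 := h w hw
    rw [h1, Complex.conj_re, Complex.conj_im, h2.2.1, h2.2.2.1, map_neg, ← sub_eq_add_neg]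
  have hda : ∀ w ∈ Ω, DifferentiableAt ℝ g w := fun w hw => hg.differentiableAt (hΩ.mem_nhds hw)
  have hdc : DifferentiableAt ℝ (fun w => g ((starRingEnd ℂ) w)) z :=
    (hda _ (hsymm z hz)).comp z Complex.conjCLE.differentiableAt
  have hαd : DifferentiableAt ℝ (fun z : ℂ => α z.re z.im) z := by
    refine (((hda z hz).add hdc).const_smul (2⁻¹ : ℝ)).congr_of_eventuallyEq ?_
    filter_upwards [hΩ.mem_nhds hz] with w hw
    simp only [Pi.add_apply, Pi.smul_apply, hconj w hw, (h w hw).1]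
    module
  have hβd : DifferentiableAt ℝ (fun z : ℂ => β z.re z.im) z := by
    refine (M.differentiableAt.comp z (((hda z hz).sub hdc).const_smul
      (-2⁻¹ : ℝ))).congr_of_eventuallyEq ?_
    filter_upwards [hΩ.mem_nhds hz] with w hw
    have : (-2⁻¹ : ℝ) • (g w - g ((starRingEnd ℂ) w)) = -M (β w.re w.im) := by
      rw [hconj w hw, (h w hw).1]
      module
    simp only [Function.comp_apply, Pi.sub_apply, Pi.smul_apply, this, map_neg, hM, neg_neg]
  -- The partial derivatives of a real differentiable function are the values of its derivative.
  have hline : ∀ (v : ℂ) (u : ℂ → E) (c : ℝ → ℂ) (t₀ : ℝ), c t₀ = z → HasDerivAt c v t₀ →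
      DifferentiableAt ℝ u z → deriv (fun t => u (c t)) t₀ = fderiv ℝ u z v :=
    fun v u c t₀ hc hv hu => by
      subst hc
      exact (hu.hasFDerivAt.comp_hasDerivAt t₀ hv).deriv
  let cx : ℝ → ℂ := fun t => (t : ℂ) + z.im * Complex.I
  let cy : ℝ → ℂ := fun t => (z.re : ℂ) + t * Complex.I
  have hx : HasDerivAt cx 1 z.re :=
    ((hasDerivAt_id z.re).ofReal_comp.add_const (z.im * Complex.I)).congr_deriv (by simp)
  have hy : HasDerivAt cy Complex.I z.im :=
    (((hasDerivAt_id z.im).ofReal_comp.mul_const Complex.I).const_add (z.re : ℂ)).congr_deriv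
      (by simp)
  have hz0 : (z.re : ℂ) + z.im * Complex.I = z := Complex.re_add_im z
  have e1 := hline _ _ (cx) z.re hz0 hx hαd
  have e2 := hline _ _ (cy) z.im hz0 hy hαd
  have e3 := hline _ _ (cx) z.re hz0 hx hβd
  have e4 := hline _ _ (cy) z.im hz0 hy hβd
  simp only [cx, cy, Complex.add_re, Complex.ofReal_re, Complex.mul_re, Complex.I_re, mul_zero,
    Complex.ofReal_im, Complex.I_im, mul_one, sub_self, add_zero, Complex.add_im, Complex.mul_im,
    zero_add] at e1 e2 e3 e4
  refine ⟨_, _, hαd.hasFDerivAt, hβd.hasFDerivAt, ?_, ?_⟩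
  · rw [← e1, ← e4]; exact (h z hz).2.2.2.1
  · rw [← e2, ← e3]; exact (h z hz).2.2.2.2

theorem differentiableOn_comp_toPlane {D : Set A} {f : A → A}
    (hf : DifferentiableOn ℝ f D) (I : A) :
    DifferentiableOn ℝ (fun z => f (toPlane I z)) (planeSlice I D) :=
  hf.comp (toPlaneCLM I).differentiable.differentiableOn fun _ hz => hz

/-- The stem functions of a left slice hyperholomorphic function. -/
theorem IsLeftSliceHyperholomorphic.exists_stem (hA : IsSliceAlgebra A) {D : Set A} {f : A → A}
    (hf : IsLeftSliceHyperholomorphic D f) {I₀ : A} (hI₀ : I₀ ∈ imagUnits A) :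
    ∃ a b : ℂ → A, ∀ z ∈ planeSlice I₀ D, IsCauchyRiemannAt a b z ∧
      a ((starRingEnd ℂ) z) = a z ∧ b ((starRingEnd ℂ) z) = -b z ∧
      ∀ I ∈ imagUnits A, f (toPlane I z) = a z + I * b z := by
  obtain ⟨α, β, h⟩ := hf.slice
  obtain ⟨M, hM, hMM⟩ := hA.exists_mulLeft I₀ hI₀
  refine ⟨fun z => α z.re z.im, fun z => β z.re z.im, fun z hz => ⟨?_, ?_, ?_, fun I hI => ?_⟩⟩
  · refine isCauchyRiemannAt_stem hMM (hA.isOpen_planeSlice hf.isOpen hI₀)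
      (fun w hw => hA.conj_mem_planeSlice hf.symmetric hI₀ hw)
      (differentiableOn_comp_toPlane hf.differentiable I₀) (fun w hw => ?_) hz
    rw [hM]
    exact h w.re w.im I₀ hI₀ hw
  · exact (h z.re z.im I₀ hI₀ hz).2.1
  · exact (h z.re z.im I₀ hI₀ hz).2.2.1
  · rw [hA.planeSlice_congr hf.symmetric hI₀ hI] at hz
    exact (h z.re z.im I hI hz).1

/-- The stem functions of a right slice hyperholomorphic function. -/
theorem IsRightSliceHyperholomorphic.exists_stem (hA : IsSliceAlgebra A) {D : Set A} {f : A → A}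
    (hf : IsRightSliceHyperholomorphic D f) {I₀ : A} (hI₀ : I₀ ∈ imagUnits A) :
    ∃ a b : ℂ → A, ∀ z ∈ planeSlice I₀ D, IsCauchyRiemannAt a b z ∧
      a ((starRingEnd ℂ) z) = a z ∧ b ((starRingEnd ℂ) z) = -b z ∧
      ∀ I ∈ imagUnits A, f (toPlane I z) = a z + b z * I := by
  obtain ⟨α, β, h⟩ := hf.slice
  obtain ⟨M, hM, hMM⟩ := hA.exists_mulRight I₀ hI₀
  refine ⟨fun z => α z.re z.im, fun z => β z.re z.im, fun z hz => ⟨?_, ?_, ?_, fun I hI => ?_⟩⟩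
  · refine isCauchyRiemannAt_stem hMM (hA.isOpen_planeSlice hf.isOpen hI₀)
      (fun w hw => hA.conj_mem_planeSlice hf.symmetric hI₀ hw)
      (differentiableOn_comp_toPlane hf.differentiable I₀) (fun w hw => ?_) hz
    rw [hM]
    exact h w.re w.im I₀ hI₀ hw
  · exact (h z.re z.im I₀ hI₀ hz).2.1
  · exact (h z.re z.im I₀ hI₀ hz).2.2.1
  · rw [hA.planeSlice_congr hf.symmetric hI₀ hI] at hz
    exact (h z.re z.im I hI hz).1

end SliceAlgebra

/-! ### The `S`-resolvent in the complex parameter plane -/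

section PseudoResolvent
variable {A : Type*} [NormedAddCommGroup A] [NormedSpace ℝ A] [Mul A] [One A] [ParavectorData A]
variable {V : Type*} [NormedAddCommGroup V] [NormedSpace ℝ V] [SMul A V] [SMul Aᵐᵒᵖ V]

/-- `L` is the left multiplication of `A` on a two-sided Banach module `V`, with bounded right
multiplications. -/
structure IsLeftAction (L : A →L[ℝ] V →L[ℝ] V) : Prop where
  apply : ∀ a v, L a v = a • v
  map_mul : ∀ a b, L (a * b) = L a * L b
  map_one : L 1 = 1
  smul_comm : ∀ (a b : A) (v : V), a • MulOpposite.op b • v = MulOpposite.op b • a • v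
  exists_right : ∀ b : A, ∃ R : V →L[ℝ] V, ∀ v, R v = MulOpposite.op b • v

variable (A V) in
/-- `ℬ(V)` as a real algebra: the centralizer of the bounded right multiplications. -/
def boundedOpsAlgebra : Subalgebra ℝ (V →L[ℝ] V) :=
  Subalgebra.centralizer ℝ {R | ∃ b : A, ∀ v, R v = MulOpposite.op b • v}

theorem IsLeftAction.mem_boundedOpsAlgebra {L : A →L[ℝ] V →L[ℝ] V} (hL : IsLeftAction L)
    {B : V →L[ℝ] V} : B ∈ boundedOpsAlgebra A V ↔ B ∈ boundedOps A V := by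
  rw [boundedOpsAlgebra, Subalgebra.mem_centralizer_iff]
  constructor
  · intro h v b
    obtain ⟨R, hR⟩ := hL.exists_right b
    have := congrArg (fun L : V →L[ℝ] V => L v) (h R ⟨b, hR⟩)
    simpa [hR] using this.symm
  · rintro h R ⟨b, hR⟩
    ext v
    simp [hR, h v b]

theorem IsLeftAction.apply_mem {L : A →L[ℝ] V →L[ℝ] V} (hL : IsLeftAction L) (a : A) :
    L a ∈ boundedOpsAlgebra A V :=
  hL.mem_boundedOpsAlgebra.2 fun v b => by rw [hL.apply, hL.apply, hL.smul_comm]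

theorem inverse_mem_boundedOpsAlgebra {B : V →L[ℝ] V} (hB : B ∈ boundedOpsAlgebra A V)
    (hu : IsUnit B) : Ring.inverse B ∈ boundedOpsAlgebra A V := by
  obtain ⟨u, rfl⟩ := hu
  rw [Ring.inverse_unit]
  rw [boundedOpsAlgebra, Subalgebra.mem_centralizer_iff] at hB ⊢
  exact fun R hR => (Commute.units_inv_right (hB R hR) : Commute R _)

/-- The integral of right linear operators is right linear. -/
theorem intervalIntegral_mem_boundedOpsAlgebra [CompleteSpace V] {W : ℝ → V →L[ℝ] V}
    (hi : IntervalIntegrable W MeasureTheory.volume 0 1)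
    (hW : ∀ t ∈ Set.Icc (0 : ℝ) 1, W t ∈ boundedOpsAlgebra A V) :
    ∫ t in (0 : ℝ)..1, W t ∈ boundedOpsAlgebra A V := by
  simp only [boundedOpsAlgebra, Subalgebra.mem_centralizer_iff] at hW ⊢
  intro R hR
  let C : (V →L[ℝ] V) →L[ℝ] (V →L[ℝ] V) :=
    ContinuousLinearMap.mul ℝ (V →L[ℝ] V) R - (ContinuousLinearMap.mul ℝ (V →L[ℝ] V)).flip R
  have hC : ∀ B, C B = R * B - B * R := fun B => rfl
  have h := C.intervalIntegral_comp_comm hi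
  rw [hC, intervalIntegral.integral_congr (g := fun _ => 0) fun t ht => ?_,
    intervalIntegral.integral_zero] at h
  · exact (sub_eq_zero.1 h.symm)
  · rw [Set.uIcc_of_le zero_le_one] at ht
    simp [hC, hW t ht R hR]

variable {T : V →ₗ.[ℝ] V} {s : A} {z : ℂ} {Q Y : V →L[ℝ] V}

theorem IsPseudoResolvent.unique {Q' : V →L[ℝ] V} (h : IsPseudoResolvent T s Q)
    (h' : IsPseudoResolvent T s Q') : Q = Q' := by
  ext v
  obtain ⟨hv, e⟩ := h'.2.1 v
  have := h.2.2 ⟨Q' v, hv⟩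
  rwa [e] at this

/-- `𝒬_s(T)⁻¹` depends only on `Re s` and `|s|`, hence only on the point `z` with `s = x₀ + I x₁`. -/
theorem IsPseudoResolvent.isPlanarResolvent (h : IsPseudoResolvent T s Q) (hre : rePart s = z.re)
    (hn : ‖s‖ = ‖z‖) (hY : ∀ v, ∃ h : Q v ∈ T.domain, T ⟨Q v, h⟩ = Y v) :
    IsPlanarResolvent T z Q Y := by
  refine ⟨hY, fun v => ?_, fun u h1 h2 => ?_⟩
  · obtain ⟨⟨h1, h2⟩, e⟩ := h.2.1 v
    obtain ⟨h3, e3⟩ := hY v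
    have h4 : Y v ∈ T.domain := e3 ▸ h2
    refine ⟨h4, ?_⟩
    change T ⟨T ⟨Q v, h1⟩, h2⟩ - (2 * rePart s) • T ⟨Q v, h1⟩ + ‖s‖ ^ 2 • Q v = v at e
    rw [IsPlanarResolvent.pmap_congr e3 h2 h4, e3, hre, hn] at e
    rw [eq_sub_iff_add_eq, ← sub_eq_iff_eq_add, add_sub_right_comm]
    exact e
  · have := h.2.2 ⟨u, h1, h2⟩
    rw [← hre, ← hn]
    exact this

theorem IsPlanarResolvent.isPseudoResolvent (h : IsPlanarResolvent T z Q Y)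
    (hQ : Q ∈ boundedOps A V) (hre : rePart s = z.re) (hn : ‖s‖ = ‖z‖) :
    IsPseudoResolvent T s Q := by
  refine ⟨hQ, fun v => ?_, fun u => ?_⟩
  · obtain ⟨h1, e1⟩ := h.apply_left v
    obtain ⟨h2, e2⟩ := h.apply_right v
    have h3 : T ⟨Q v, h1⟩ ∈ T.domain := e1 ▸ h2
    refine ⟨⟨h1, h3⟩, ?_⟩
    change T ⟨T ⟨Q v, h1⟩, h3⟩ - (2 * rePart s) • T ⟨Q v, h1⟩ + ‖s‖ ^ 2 • Q v = v
    rw [IsPlanarResolvent.pmap_congr e1 h3 h2, e2, e1, hre, hn]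
    abel
  · have := h.left_inv u.1 u.2.1 u.2.2
    rw [← hre, ← hn] at this
    exact this

theorem IsPlanarResolvent.conj (h : IsPlanarResolvent T z Q Y) :
    IsPlanarResolvent T ((starRingEnd ℂ) z) Q Y := by
  refine ⟨h.apply_left, fun v => ?_, fun u h1 h2 => ?_⟩
  · rw [Complex.conj_re, Complex.norm_conj]
    exact h.apply_right v
  · rw [Complex.conj_re, Complex.norm_conj]
    exact h.left_inv u h1 h2

variable (A) in
/-- The points of `ℂ` that correspond to points of the `S`-resolvent set. -/
def planarResolventSet (T : V →ₗ.[ℝ] V) : Set ℂ :=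
  {z | ∃ Q Y : V →L[ℝ] V, IsPlanarResolvent T z Q Y ∧ Q ∈ boundedOps A V}

theorem conj_mem_planarResolventSet (hz : z ∈ planarResolventSet A T) :
    (starRingEnd ℂ) z ∈ planarResolventSet A T := by
  obtain ⟨Q, Y, h, hQ⟩ := hz
  exact ⟨Q, Y, h.conj, hQ⟩

theorem IsPlanarResolvent.mem_boundedOps (h : IsPlanarResolvent T z Q Y)
    (hT : IsRightLinear A T) (hQ : Q ∈ boundedOps A V) : Y ∈ boundedOps A V := by
  intro v a
  obtain ⟨h1, e1⟩ := h.apply_left v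
  obtain ⟨h2, e2⟩ := h.apply_left (MulOpposite.op a • v)
  obtain ⟨h3, e3⟩ := hT ⟨Q v, h1⟩ a
  rw [← e2, ← e1, ← e3]
  exact IsPlanarResolvent.pmap_congr (hQ v a) _ _

theorem isOpen_planarResolventSet [CompleteSpace V] {L : A →L[ℝ] V →L[ℝ] V} (hL : IsLeftAction L)
    (hT : IsRightLinear A T) : IsOpen (planarResolventSet A T) := by
  rw [isOpen_iff_mem_nhds]
  rintro w ⟨Q, Y, h, hQ⟩
  filter_upwards [IsPlanarResolvent.eventually_isUnit (w := w) (Q := Q) (Y := Y)] with z hz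
  have hY := h.mem_boundedOps hT hQ
  rw [← hL.mem_boundedOpsAlgebra] at hQ hY
  refine ⟨_, _, h.of_isUnit hz, hL.mem_boundedOpsAlgebra.1 (mul_mem hQ
    (inverse_mem_boundedOpsAlgebra (add_mem (one_mem _) (add_mem ?_ ?_)) hz))⟩
  · exact Subalgebra.smul_mem _ hY _
  · exact Subalgebra.smul_mem _ hQ _

/-- The stem functions of the `S`-resolvents: `S_L⁻¹(x₀ + I x₁, T) = P + R I` and
`S_R⁻¹(x₀ + I x₁, T) = P + I R`. -/
theorem exists_resolvent_stem [CompleteSpace V] (hA : IsSliceAlgebra A) {L : A →L[ℝ] V →L[ℝ] V}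
    (hL : IsLeftAction L) (hT : IsRightLinear A T) :
    ∃ P R : ℂ → V →L[ℝ] V, ∀ z ∈ planarResolventSet A T, IsCauchyRiemannAt P R z ∧
      P ((starRingEnd ℂ) z) = P z ∧ R ((starRingEnd ℂ) z) = -R z ∧
      P z ∈ boundedOpsAlgebra A V ∧ R z ∈ boundedOpsAlgebra A V ∧
      ∀ I ∈ imagUnits A, ∀ v,
        leftSResolvent T (toPlane I z) v = P z v + R z (L I v) ∧
        rightSResolvent T (toPlane I z) v = P z v + L I (R z v) := by
  have hex : ∀ z, ∃ Q Y : V →L[ℝ] V, z ∈ planarResolventSet A T →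
      IsPlanarResolvent T z Q Y ∧ Q ∈ boundedOps A V := fun z => by
    by_cases hz : z ∈ planarResolventSet A T
    · obtain ⟨Q, Y, h⟩ := hz
      exact ⟨Q, Y, fun _ => h⟩
    · exact ⟨0, 0, fun h => absurd h hz⟩
  choose q y hqy using hex
  have hopen := isOpen_planarResolventSet hL hT
  refine ⟨fun z => z.re • q z - y z, fun z => -(z.im • q z), fun z hz => ?_⟩
  obtain ⟨hz1, hz2⟩ := hqy z hz
  have hy := hz1.mem_boundedOps hT hz2
  have hu := (hqy _ (conj_mem_planarResolventSet hz)).1.unique hz1.conj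
  refine ⟨IsPlanarResolvent.isCauchyRiemannAt (T := T) ?_, ?_, ?_, ?_, ?_, fun I hI v => ?_⟩
  · filter_upwards [hopen.mem_nhds hz] with w hw using (hqy w hw).1
  · simp only [Complex.conj_re, ← hu.1, ← hu.2]
  · simp only [Complex.conj_im, ← hu.1, neg_smul, neg_neg]
  · rw [← hL.mem_boundedOpsAlgebra] at hz2 hy
    exact sub_mem (Subalgebra.smul_mem _ hz2 _) hy
  · rw [← hL.mem_boundedOpsAlgebra] at hz2
    exact neg_mem (Subalgebra.smul_mem _ hz2 _)
  · have hps : IsPseudoResolvent T (toPlane I z) (q z) :=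
      hz1.isPseudoResolvent hz2 (hA.rePart_toPlane I hI z) (hA.norm_toPlane I hI z)
    have hpe : pseudoResolvent T (toPlane I z) = q z := by
      rw [pseudoResolvent, dif_pos ⟨_, hps⟩]
      exact IsPseudoResolvent.unique (Exists.choose_spec _) hps
    have hop : ∀ v, opApply T (q z v) = y z v := fun v => by
      obtain ⟨h1, e1⟩ := hz1.apply_left v
      rw [opApply, dif_pos h1, e1]
    have hcj : ∀ v : V, conjPara (toPlane I z) • v = z.re • v - z.im • L I v := fun v => by
      rw [hA.conjPara_toPlane hI, ← hL.apply, toPlane, map_add, map_smul, map_smul, hL.map_one]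
      simp [sub_eq_add_neg]
    rw [leftSResolvent, rightSResolvent, hpe, hop, hcj, hcj]
    constructor
    · simp only [map_sub, map_smul, sub_apply, smul_apply,
        neg_apply]
      module
    · simp only [map_neg, map_smul, sub_apply, smul_apply,
        neg_apply]
      module

/-! ### Admissible domains -/

/-- The condition that the operators `T 𝒬_s(T)⁻¹` are bounded. -/
def HasBoundedResolventImage (A : Type*) [NormedAddCommGroup A] [NormedSpace ℝ A] [Mul A] [One A]
    [ParavectorData A] [SMul A V] [SMul Aᵐᵒᵖ V] (T : V →ₗ.[ℝ] V) : Prop :=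
  ∀ s ∈ paravec A, ∀ Q : V →L[ℝ] V, IsPseudoResolvent T s Q →
    ∃ Y : V →L[ℝ] V, ∀ v, ∃ h : Q v ∈ T.domain, T ⟨Q v, h⟩ = Y v

theorem toPlane_mem_sResolventSet (hA : IsSliceAlgebra A) (hTQ : HasBoundedResolventImage A T)
    {I : A} (hI : I ∈ imagUnits A) :
    toPlane I z ∈ sResolventSet A T ↔ z ∈ planarResolventSet A T := by
  constructor
  · rintro ⟨hs, Q, hQ⟩
    obtain ⟨Y, hY⟩ := hTQ _ hs Q hQ
    exact ⟨Q, Y, hQ.isPlanarResolvent (hA.rePart_toPlane I hI z) (hA.norm_toPlane I hI z) hY, hQ.1⟩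
  · rintro ⟨Q, Y, h, hQ⟩
    exact ⟨hA.toPlane_mem I hI z, Q,
      h.isPseudoResolvent hQ (hA.rePart_toPlane I hI z) (hA.norm_toPlane I hI z)⟩

theorem compl_planarResolventSet_subset (hA : IsSliceAlgebra A)
    (hTQ : HasBoundedResolventImage A T) {I : A} (hI : I ∈ imagUnits A) {D : Set A}
    (hD : sSpectrum A T ⊆ D) : (planarResolventSet A T)ᶜ ⊆ planeSlice I D := fun z hz =>
  hD ⟨hA.toPlane_mem I hI z, fun h => hz ((toPlane_mem_sResolventSet hA hTQ hI).1 h)⟩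

/-- An unbounded Cauchy domain that contains the complement of the resolvent set and whose closure
avoids both the complement of `D` and a point of the resolvent set gives an admissible domain. The
additional point ensures that the domain has a boundary even if `D` is all of `𝔽₀`. -/
theorem exists_isAdmissibleDomain [CompleteSpace V] (hA : IsSliceAlgebra A)
    {L : A →L[ℝ] V →L[ℝ] V} (hL : IsLeftAction L) (hT : IsRightLinear A T)
    (hTQ : HasBoundedResolventImage A T) (hρ : (sResolventSet A T).Nonempty) {D : Set A}
    (hDo : IsOpenInParavec D) (hDs : IsAxiallySymmetric D) (hD : sSpectrum A T ⊆ D)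
    (hDi : ∃ r > 0, {s ∈ paravec A | r < ‖s‖} ⊆ D) :
    ∃ U, IsAdmissibleDomain (sSpectrum A T) D U ∧ ∀ I ∈ imagUnits A,
      ∃ (N : ℕ) (γ : Fin N → ℝ → ℂ), IsPositiveBoundary (planeSlice I U) γ := by
  obtain ⟨I, hI⟩ := hA.nonempty
  obtain ⟨z₀, hz₀⟩ : (planarResolventSet A T).Nonempty := by
    obtain ⟨s, hs⟩ := hρ
    obtain ⟨J, hJ, e⟩ := hA.exists_eq_toPlane s hs.1
    rw [e] at hs
    exact ⟨_, (toPlane_mem_sResolventSet hA hTQ hJ).1 hs⟩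
  obtain ⟨r, -, hr⟩ := hDi
  have hK0 : IsCompact (planeSlice I D)ᶜ := by
    refine Metric.isCompact_of_isClosed_isBounded (hA.isOpen_planeSlice hDo hI).isClosed_compl
      (isBounded_iff_forall_norm_le.2 ⟨r, fun z hz => ?_⟩)
    by_contra! h
    exact hz (hr ⟨hA.toPlane_mem I hI z, by rwa [hA.norm_toPlane I hI]⟩)
  have hsub : (planeSlice I D)ᶜ ⊆ planarResolventSet A T :=
    Set.compl_subset_comm.1 (compl_planarResolventSet_subset hA hTQ hI hD)
  obtain ⟨U', hU', hb, hs, hΩ, hdisj, N, γ, hγ⟩ := exists_unbounded_cauchyDomain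
    (K := (planeSlice I D)ᶜ ∪ {z₀, (starRingEnd ℂ) z₀}) (Ω := planarResolventSet A T)
    (hK0.union (Set.toFinite _).isCompact) ⟨z₀, by simp⟩ (isOpen_planarResolventSet hL hT)
    (Set.union_subset hsub (by
      rintro z (rfl | rfl)
      exacts [hz₀, conj_mem_planarResolventSet hz₀])) (by
      rintro z (hz | rfl | rfl)
      · refine Or.inl fun h => hz ?_
        simpa using hA.conj_mem_planeSlice hDs hI h
      · simp
      · simp)
  obtain ⟨U, hUs, hUp, hUm⟩ := hA.exists_planeSlice_eq hs
  refine ⟨U, ⟨⟨hUs, fun J hJ => by rwa [hUp J hJ]⟩,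
    hA.isUnbounded_of_isUnbounded_planeSlice hI (by rwa [hUp I hI]), fun x hx => ?_,
    fun x hx => ?_⟩, fun J hJ => ⟨N, γ, by rwa [hUp J hJ]⟩⟩
  · obtain ⟨J, hJ, e⟩ := hA.exists_eq_toPlane x hx.1
    refine (hUm x).2 ⟨hx.1, hΩ fun h => hx.2 ?_⟩
    rw [e]
    exact (toPlane_mem_sResolventSet hA hTQ hJ).2 h
  · have hxp : x ∈ paravec A :=
      hA.isClosed_paravec.closure_subset_iff.2 (fun y hy => ((hUm y).1 hy).1) hx
    obtain ⟨J, hJ, e⟩ := hA.exists_eq_toPlane x hxp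
    have h1 : halfPlanePt x ∈ closure U' :=
      map_mem_closure hA.continuous_halfPlanePt hx fun y hy => ((hUm y).1 hy).2
    have h2 : halfPlanePt x ∈ planeSlice I D := by
      by_contra h
      exact Set.disjoint_left.1 hdisj h1 (Or.inl h)
    rw [hA.planeSlice_congr hDs hI hJ] at h2
    rw [e]
    exact h2

/-! ### The functional calculus -/

/-- If the integrands for the various imaginary units come from the same pair of stem functions,
then their integrals over the boundaries of admissible domains exist and agree. -/
theorem exists_common_integral [CompleteSpace V] (hA : IsSliceAlgebra A)
    {L : A →L[ℝ] V →L[ℝ] V} (hL : IsLeftAction L) (hT : IsRightLinear A T)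
    (hTQ : HasBoundedResolventImage A T) {D : Set A} (hDo : IsOpenInParavec D)
    (hDs : IsAxiallySymmetric D) {I₀ : A} (hI₀ : I₀ ∈ imagUnits A)
    {E F : Type*} [NormedAddCommGroup E] [NormedSpace ℝ E] [NormedAddCommGroup F] [NormedSpace ℝ F]
    {P R : ℂ → E} {α β : ℂ → F} {B : E →L[ℝ] F →L[ℝ] V →L[ℝ] V}
    {C : A → E →L[ℝ] F →L[ℝ] V →L[ℝ] V}
    (hPR : ∀ z ∈ planarResolventSet A T, IsCauchyRiemannAt P R z ∧
      P ((starRingEnd ℂ) z) = P z ∧ R ((starRingEnd ℂ) z) = -R z)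
    (hαβ : ∀ z ∈ planeSlice I₀ D, IsCauchyRiemannAt α β z ∧
      α ((starRingEnd ℂ) z) = α z ∧ β ((starRingEnd ℂ) z) = -β z)
    {Φ : A → ℂ → ℂ → V → V}
    (hΦ : ∀ I ∈ imagUnits A, ∀ z ∈ planeSlice I₀ D, z ∈ planarResolventSet A T → ∀ w,
      ⇑(stemForm B (C I) P R α β z w) = Φ I z w ∧
        stemForm B (C I) P R α β z w ∈ boundedOpsAlgebra A V)
    (hex : ∃ U, IsAdmissibleDomain (sSpectrum A T) D U ∧ ∀ I ∈ imagUnits A,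
      ∃ (N : ℕ) (γ : Fin N → ℝ → ℂ), IsPositiveBoundary (planeSlice I U) γ) :
    ∃ S ∈ boundedOps A V, ∀ U, IsAdmissibleDomain (sSpectrum A T) D U → ∀ I ∈ imagUnits A,
      ∀ (N : ℕ) (γ : Fin N → ℝ → ℂ), IsPositiveBoundary (planeSlice I U) γ →
        HasOperatorIntegral (fun j t => Φ I (γ j t) (deriv (γ j) t)) S := by
  -- All integrals take place in `D' \ K`, where both pairs of stem functions are holomorphic.
  set K : Set ℂ := (planarResolventSet A T)ᶜ with hK
  set D' : Set ℂ := planeSlice I₀ D with hD'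
  have hρo := isOpen_planarResolventSet hL hT
  have hΩ : D' \ K = D' ∩ planarResolventSet A T := by rw [hK, Set.sdiff_compl]
  have hΩo : IsOpen (D' \ K) := by
    rw [hΩ]
    exact (hA.isOpen_planeSlice hDo hI₀).inter hρo
  have hΩs : ∀ z ∈ D' \ K, (starRingEnd ℂ) z ∈ D' \ K := fun z hz => by
    rw [hΩ] at hz ⊢
    exact ⟨hA.conj_mem_planeSlice hDs hI₀ hz.1, conj_mem_planarResolventSet hz.2⟩
  have hρ : ∀ z ∈ D' \ K, z ∈ planarResolventSet A T := fun z hz => by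
    rw [hΩ] at hz
    exact hz.2
  have h1 := fun z hz => (hPR z (hρ z hz)).1
  have h2 := fun z hz => (hPR z (hρ z hz)).2
  have h3 := fun z (hz : z ∈ D' \ K) => (hαβ z hz.1).1
  have h4 := fun z (hz : z ∈ D' \ K) => (hαβ z hz.1).2
  have hsl : ∀ U, IsAdmissibleDomain (sSpectrum A T) D U → ∀ I ∈ imagUnits A,
      IsOpen (planeSlice I U) ∧ ¬ Bornology.IsBounded (planeSlice I U) ∧
      (∀ z ∈ planeSlice I U, (starRingEnd ℂ) z ∈ planeSlice I U) ∧ K ⊆ planeSlice I U ∧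
      closure (planeSlice I U) ⊆ D' := fun U hU I hI => by
    refine ⟨(hU.1.2 I hI).isOpen, hA.isUnbounded_planeSlice hU.1.1 hI hU.2.1,
      fun z hz => hA.conj_mem_planeSlice hU.1.1 hI hz,
      compl_planarResolventSet_subset hA hTQ hI hU.2.2.1, fun z hz => ?_⟩
    rw [hD', hA.planeSlice_congr hDs hI₀ hI]
    exact hU.2.2.2 (map_mem_closure (continuous_toPlane I) hz fun w hw => hw)
  have hγ : ∀ U, IsAdmissibleDomain (sSpectrum A T) D U → ∀ I ∈ imagUnits A,
      ∀ (N : ℕ) (γ : Fin N → ℝ → ℂ), IsPositiveBoundary (planeSlice I U) γ →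
      ∀ j, ∀ t ∈ Set.Icc (0 : ℝ) 1, γ j t ∈ D' \ K := fun U hU I hI N γ h j t ht => by
    obtain ⟨ho, -, -, hk, hd⟩ := hsl U hU I hI
    have hf := h.mem_frontier j ht
    rw [ho.frontier_eq] at hf
    exact ⟨hd hf.1, fun hz => hf.2 (hk hz)⟩
  -- The integral over the boundary of one domain serves as the common value.
  obtain ⟨U₀, hU₀, hb₀⟩ := hex
  obtain ⟨N₀, γ₀, hγ₀⟩ := hb₀ I₀ hI₀
  refine ⟨∑ j, ∫ t in (0 : ℝ)..1, stemForm B (C I₀) P R α β (γ₀ j t) (deriv (γ₀ j) t), ?_,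
    fun U hU I hI N γ h => ?_⟩
  · rw [← hL.mem_boundedOpsAlgebra]
    refine sum_mem fun j _ => intervalIntegral_mem_boundedOpsAlgebra
      (intervalIntegrable_stemForm h1 h3 (hγ₀.boundary.jordan j) (hγ U₀ hU₀ I₀ hI₀ N₀ γ₀ hγ₀ j))
      fun t ht => ?_
    have := hγ U₀ hU₀ I₀ hI₀ N₀ γ₀ hγ₀ j t ht
    exact (hΦ I₀ hI₀ _ this.1 (hρ _ this) _).2
  · refine ⟨fun j t => stemForm B (C I) P R α β (γ j t) (deriv (γ j) t), fun j t ht => ?_,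
      fun j => intervalIntegrable_stemForm h1 h3 (h.boundary.jordan j) (hγ U hU I hI N γ h j), ?_⟩
    · have := hγ U hU I hI N γ h j t ht
      exact (hΦ I hI _ this.1 (hρ _ this) _).1
    · obtain ⟨o, b, s, k, d⟩ := hsl U hU I hI
      obtain ⟨o₀, b₀, s₀, k₀, d₀⟩ := hsl U₀ hU₀ I₀ hI₀
      exact sum_integral_stemForm_eq hΩo hΩs h1 h3 h2 h4 hγ₀ o₀ b₀ s₀ k₀ d₀ h o b s k d (C I)

theorem HasOperatorIntegral.unique {N : ℕ} {Φ : Fin N → ℝ → V → V} {S S' : V →L[ℝ] V}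
    (h : HasOperatorIntegral Φ S) (h' : HasOperatorIntegral Φ S') : S = S' := by
  obtain ⟨W, hW, -, rfl⟩ := h
  obtain ⟨W', hW', -, rfl⟩ := h'
  refine Finset.sum_congr rfl fun j _ => intervalIntegral.integral_congr fun t ht => ?_
  rw [Set.uIcc_of_le zero_le_one] at ht
  exact DFunLike.coe_injective ((hW j t ht).trans (hW' j t ht).symm)

/-- If `S` is the common value of the integrals, then `f(∞) + (2π)⁻¹ S` is the only value of the
functional calculus. -/
theorem existsUnique_calculusValue (hA : IsSliceAlgebra A) {L : A →L[ℝ] V →L[ℝ] V}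
    (hL : IsLeftAction L) {D : Set A} {f : A → A} (hf : ∃ c, HasLimitAtInfinity f c)
    {HasInt : A → ∀ N : ℕ, (Fin N → ℝ → ℂ) → (V →L[ℝ] V) → Prop}
    (huniq : ∀ I N γ S S', HasInt I N γ S → HasInt I N γ S' → S = S')
    (hex : ∃ U, IsAdmissibleDomain (sSpectrum A T) D U ∧ ∀ I ∈ imagUnits A,
      ∃ (N : ℕ) (γ : Fin N → ℝ → ℂ), IsPositiveBoundary (planeSlice I U) γ)
    (hS : ∃ S ∈ boundedOps A V, ∀ U, IsAdmissibleDomain (sSpectrum A T) D U →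
      ∀ I ∈ imagUnits A, ∀ (N : ℕ) (γ : Fin N → ℝ → ℂ), IsPositiveBoundary (planeSlice I U) γ →
        HasInt I N γ S) :
    ∃! F : V →L[ℝ] V, F ∈ boundedOps A V ∧
      ∃ U, IsAdmissibleDomain (sSpectrum A T) D U ∧ ∃ I ∈ imagUnits A,
        ∃ (N : ℕ) (γ : Fin N → ℝ → ℂ) (S : V →L[ℝ] V) (c : A),
          IsPositiveBoundary (planeSlice I U) γ ∧ HasInt I N γ S ∧
          HasLimitAtInfinity f c ∧ ∀ v, F v = c • v + (2 * Real.pi)⁻¹ • S v := by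
  obtain ⟨c, hc⟩ := hf
  obtain ⟨U, hU, hUb⟩ := hex
  obtain ⟨S, hSb, hS⟩ := hS
  obtain ⟨I, hI⟩ := hA.nonempty
  obtain ⟨N, γ, hγ⟩ := hUb I hI
  refine ⟨L c + (2 * Real.pi)⁻¹ • S, ⟨?_, U, hU, I, hI, N, γ, S, c, hγ, hS U hU I hI N γ hγ, hc,
    fun v => ?_⟩, ?_⟩
  · rw [← hL.mem_boundedOpsAlgebra] at hSb ⊢
    exact add_mem (hL.apply_mem c) (Subalgebra.smul_mem _ hSb _)
  · rw [← hL.apply]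
    rfl
  · rintro F ⟨-, U', hU', I', hI', N', γ', S', c', hγ', hS', hc', hF⟩
    have e1 : S' = S := huniq _ _ _ _ _ hS' (hS U' hU' I' hI' N' γ' hγ')
    have e2 : c' = c := by
      have := hA.neBot_infinity
      exact tendsto_nhds_unique hc' hc
    ext v
    rw [hF, e1, e2, ← hL.apply]
    rfl

theorem IsLeftAction.mul_self {L : A →L[ℝ] V →L[ℝ] V} (hL : IsLeftAction L)
    (hA : IsSliceAlgebra A) {I : A} (hI : I ∈ imagUnits A) (v : V) : L I (L I v) = -v := by
  obtain ⟨M, hM, hMM⟩ := hA.exists_mulLeft I hI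
  have h := hMM 1
  rw [hM, hM] at h
  have h2 := congrArg (fun a => L a v) h
  simpa [hL.map_mul, hL.map_one] using h2

/-- The bilinear map `(p, x) ↦ p m x` on a Banach algebra. -/
def mulMiddle {X : Type*} [NormedRing X] [NormedAlgebra ℝ X] (m : X) : X →L[ℝ] X →L[ℝ] X :=
  (ContinuousLinearMap.mul ℝ X).comp ((ContinuousLinearMap.mul ℝ X).flip m)

theorem mulMiddle_apply {X : Type*} [NormedRing X] [NormedAlgebra ℝ X] (m p x : X) :
    mulMiddle m p x = p * m * x := rfl

theorem stemForm_mem {E F : Type*} [NormedAddCommGroup E] [NormedSpace ℝ E]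
    [NormedAddCommGroup F] [NormedSpace ℝ F] {P R : ℂ → E} {α β : ℂ → F}
    {B C : E →L[ℝ] F →L[ℝ] V →L[ℝ] V} {z : ℂ} {s : Set E} {t : Set F} (hP : P z ∈ s) (hR : R z ∈ s)
    (hα : α z ∈ t) (hβ : β z ∈ t) (hB : ∀ p ∈ s, ∀ a ∈ t, B p a ∈ boundedOpsAlgebra A V)
    (hC : ∀ p ∈ s, ∀ a ∈ t, C p a ∈ boundedOpsAlgebra A V) (w : ℂ) :
    stemForm B C P R α β z w ∈ boundedOpsAlgebra A V := by
  refine add_mem (Subalgebra.smul_mem _ (add_mem (sub_mem ?_ ?_) (add_mem ?_ ?_)) _)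
    (Subalgebra.smul_mem _ (sub_mem (add_mem ?_ ?_) (sub_mem ?_ ?_)) _)
  all_goals first
    | exact hB _ ‹_› _ ‹_›
    | exact hC _ ‹_› _ ‹_›

/-- The functional calculus for left slice hyperholomorphic functions. -/
theorem leftSCalculus [CompleteSpace V] (hA : IsSliceAlgebra A) {L : A →L[ℝ] V →L[ℝ] V}
    (hL : IsLeftAction L) (hT : IsRightLinear A T) (hTQ : HasBoundedResolventImage A T)
    (hρ : (sResolventSet A T).Nonempty) {D : Set A} {f : A → A}
    (hf : IsLeftSHWithInfinity (sSpectrum A T) D f) :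
    (∃ U, IsAdmissibleDomain (sSpectrum A T) D U ∧
      ∀ I ∈ imagUnits A, ∃ (N : ℕ) (γ : Fin N → ℝ → ℂ), IsPositiveBoundary (planeSlice I U) γ) ∧
    (∃ S ∈ boundedOps A V, ∀ U, IsAdmissibleDomain (sSpectrum A T) D U →
      ∀ I ∈ imagUnits A, ∀ (N : ℕ) (γ : Fin N → ℝ → ℂ),
        IsPositiveBoundary (planeSlice I U) γ → HasLeftIntegral T f I γ S) ∧
    ∃! F : V →L[ℝ] V, F ∈ boundedOps A V ∧ IsLeftSCalculusValue T D f F := by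
  obtain ⟨hsh, hK, hr, hlim⟩ := hf
  obtain ⟨I₀, hI₀⟩ := hA.nonempty
  have hex := exists_isAdmissibleDomain hA hL hT hTQ hρ hsh.isOpen hsh.symmetric hK hr
  obtain ⟨a, b, hab⟩ := hsh.exists_stem hA hI₀
  obtain ⟨P, R, hPR⟩ := exists_resolvent_stem hA hL hT
  -- `(P + R I) (-I) (w₀ + I w₁) (a + I b)` is expanded with `I² = -1`.
  have hint := exists_common_integral hA hL hT hTQ hsh.isOpen hsh.symmetric hI₀ (P := P) (R := R)
    (α := fun z => L (a z)) (β := fun z => L (b z)) (B := ContinuousLinearMap.mul ℝ _)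
    (C := fun I => mulMiddle (L I))
    (fun z hz => ⟨(hPR z hz).1, (hPR z hz).2.1, (hPR z hz).2.2.1⟩)
    (fun z hz => ⟨(hab z hz).1.clm_comp L, by rw [(hab z hz).2.1],
      by rw [(hab z hz).2.2.1, map_neg]⟩)
    (Φ := fun I z w v => leftSResolvent T (toPlane I z)
      ((-I * toPlane I w * f (toPlane I z)) • v))
    (fun I hI z hz hzρ w => by
      refine ⟨?_, stemForm_mem (hPR z hzρ).2.2.2.1 (hPR z hzρ).2.2.2.2.1 (hL.apply_mem (a z))
        (hL.apply_mem (b z)) (fun p hp x hx => mul_mem hp hx)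
        (fun p hp x hx => mul_mem (mul_mem hp (hL.apply_mem I)) hx) w⟩
      ext v
      rw [((hPR z hzρ).2.2.2.2.2 I hI _).1, (hab z hz).2.2.2 I hI, ← hL.apply]
      simp only [stemForm, mulMiddle_apply, ContinuousLinearMap.mul_apply', hL.map_mul, map_neg,
        map_add, toPlane, map_smul, hL.map_one, add_apply,
        sub_apply, smul_apply, mul_apply_eq_comp,
        neg_apply, one_apply_eq_self, hL.mul_self hA hI]
      module) hex
  exact ⟨hex, hint, existsUnique_calculusValue hA hL hlim
    (fun I N γ S S' h h' => HasOperatorIntegral.unique h h') hex hint⟩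

/-- The functional calculus for right slice hyperholomorphic functions. -/
theorem rightSCalculus [CompleteSpace V] (hA : IsSliceAlgebra A) {L : A →L[ℝ] V →L[ℝ] V}
    (hL : IsLeftAction L) (hT : IsRightLinear A T) (hTQ : HasBoundedResolventImage A T)
    (hρ : (sResolventSet A T).Nonempty) {D : Set A} {f : A → A}
    (hf : IsRightSHWithInfinity (sSpectrum A T) D f) :
    (∃ U, IsAdmissibleDomain (sSpectrum A T) D U ∧
      ∀ I ∈ imagUnits A, ∃ (N : ℕ) (γ : Fin N → ℝ → ℂ), IsPositiveBoundary (planeSlice I U) γ) ∧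
    (∃ S ∈ boundedOps A V, ∀ U, IsAdmissibleDomain (sSpectrum A T) D U →
      ∀ I ∈ imagUnits A, ∀ (N : ℕ) (γ : Fin N → ℝ → ℂ),
        IsPositiveBoundary (planeSlice I U) γ → HasRightIntegral T f I γ S) ∧
    ∃! F : V →L[ℝ] V, F ∈ boundedOps A V ∧ IsRightSCalculusValue T D f F := by
  obtain ⟨hsh, hK, hr, hlim⟩ := hf
  obtain ⟨I₀, hI₀⟩ := hA.nonempty
  have hex := exists_isAdmissibleDomain hA hL hT hTQ hρ hsh.isOpen hsh.symmetric hK hr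
  obtain ⟨a, b, hab⟩ := hsh.exists_stem hA hI₀
  obtain ⟨P, R, hPR⟩ := exists_resolvent_stem hA hL hT
  -- `(a + b I) (-I) (w₀ + I w₁) (P + I R)` is expanded with `I² = -1`.
  have hint := exists_common_integral hA hL hT hTQ hsh.isOpen hsh.symmetric hI₀ (P := P) (R := R)
    (α := fun z => L (a z)) (β := fun z => L (b z)) (B := (ContinuousLinearMap.mul ℝ _).flip)
    (C := fun I => (mulMiddle (L I)).flip)
    (fun z hz => ⟨(hPR z hz).1, (hPR z hz).2.1, (hPR z hz).2.2.1⟩)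
    (fun z hz => ⟨(hab z hz).1.clm_comp L, by rw [(hab z hz).2.1],
      by rw [(hab z hz).2.2.1, map_neg]⟩)
    (Φ := fun I z w v => (f (toPlane I z) * -I * toPlane I w) •
      rightSResolvent T (toPlane I z) v)
    (fun I hI z hz hzρ w => by
      refine ⟨?_, stemForm_mem (hPR z hzρ).2.2.2.1 (hPR z hzρ).2.2.2.2.1 (hL.apply_mem (a z))
        (hL.apply_mem (b z)) (fun p hp x hx => mul_mem hx hp)
        (fun p hp x hx => mul_mem (mul_mem hx (hL.apply_mem I)) hp) w⟩
      ext v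
      rw [((hPR z hzρ).2.2.2.2.2 I hI _).2, (hab z hz).2.2.2 I hI, ← hL.apply]
      simp only [stemForm, mulMiddle_apply, ContinuousLinearMap.mul_apply', hL.map_mul, map_neg,
        ContinuousLinearMap.flip_apply,
        map_add, toPlane, map_smul, hL.map_one, add_apply,
        sub_apply, smul_apply, mul_apply_eq_comp,
        neg_apply, one_apply_eq_self, hL.mul_self hA hI]
      module) hex
  exact ⟨hex, hint, existsUnique_calculusValue hA hL hlim
    (fun I N γ S S' h h' => HasOperatorIntegral.unique h h') hex hint⟩

end PseudoResolvent

/-! ### Closed operators composed with bounded ones -/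

/-- A closed operator composed with a bounded one is bounded if it is everywhere defined. -/
theorem LinearPMap.IsClosed.exists_clm_comp {X E : Type*} [NormedAddCommGroup X] [NormedSpace ℝ X]
    [CompleteSpace X] [NormedAddCommGroup E] [NormedSpace ℝ E] [CompleteSpace E]
    {S : E →ₗ.[ℝ] E} (hS : S.IsClosed) (K : X →L[ℝ] E) (hK : ∀ x, K x ∈ S.domain) :
    ∃ Y : X →L[ℝ] E, ∀ x, Y x = S ⟨K x, hK x⟩ := by
  let g : X →ₗ[ℝ] E := S.toFun ∘ₗ K.toLinearMap.codRestrict S.domain hK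
  have hg : ∀ x, g x = S ⟨K x, hK x⟩ := fun x => rfl
  have hc : Continuous g := by
    refine g.continuous_of_isClosed_graph ?_
    have e : (g.graph : Set (X × E)) = (fun p : X × E => (K p.1, p.2)) ⁻¹' S.graph := by
      ext p
      simp only [SetLike.mem_coe, LinearMap.mem_graph_iff, Set.mem_preimage,
        LinearPMap.mem_graph_iff, hg]
      constructor
      · intro h
        exact ⟨⟨K p.1, hK p.1⟩, rfl, h.symm⟩
      · rintro ⟨y, hy, hy'⟩
        rw [← hy']
        exact congrArg S (Subtype.ext hy)
    rw [e]
    exact hS.preimage ((K.continuous.comp continuous_fst).prodMk continuous_snd)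
  exact ⟨⟨g, hc⟩, hg⟩

/-! ### The quaternionic setting -/

namespace Quaternion

theorem norm_sq_eq (x : Quaternion ℝ) :
    ‖x‖ ^ 2 = x.re ^ 2 + x.imI ^ 2 + x.imJ ^ 2 + x.imK ^ 2 := by
  rw [sq, ← Quaternion.normSq_eq_norm_mul_self, Quaternion.normSq_def']

theorem mul_self_of_mem_imagUnits {I : Quaternion ℝ} (hI : I ∈ imagUnits (Quaternion ℝ)) :
    I * I = -1 := by
  have h0 : I.re = 0 := hI.2.1
  have h1 := norm_sq_eq I
  rw [hI.2.2, h0] at h1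
  ext <;> simp [h0] <;> nlinarith

theorem imagUnits_nonempty : (imagUnits (Quaternion ℝ)).Nonempty := by
  let i : Quaternion ℝ := ⟨0, 1, 0, 0⟩
  have h : ‖i‖ ^ 2 = 1 := by
    rw [norm_sq_eq]
    change (0 : ℝ) ^ 2 + 1 ^ 2 + 0 ^ 2 + 0 ^ 2 = 1
    norm_num
  exact ⟨i, Set.mem_univ _, rfl, by nlinarith [norm_nonneg i]⟩

theorem isSliceAlgebra : IsSliceAlgebra (Quaternion ℝ) where
  toPlane_mem _ _ _ := Set.mem_univ _
  rePart_toPlane I hI z := by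
    have h0 : I.re = 0 := hI.2.1
    change (z.re • (1 : Quaternion ℝ) + z.im • I).re = z.re
    simp [h0]
  norm_toPlane I hI z := by
    have h0 : I.re = 0 := hI.2.1
    have h1 := norm_sq_eq I
    rw [hI.2.2, h0] at h1
    rw [← sq_eq_sq₀ (norm_nonneg _) (norm_nonneg _), norm_sq_eq, ← Complex.normSq_eq_norm_sq,
      Complex.normSq_apply, toPlane]
    simp [h0]
    linear_combination -z.im ^ 2 * h1
  exists_eq_toPlane x _ := by
    have hre : (x - rePart x • (1 : Quaternion ℝ)).re = 0 := by
      change (x - x.re • (1 : Quaternion ℝ)).re = 0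
      simp
    rcases eq_or_ne (x - rePart x • (1 : Quaternion ℝ)) 0 with h | h
    · obtain ⟨I, hI⟩ := imagUnits_nonempty
      refine ⟨I, hI, ?_⟩
      rw [h, norm_zero]
      simpa [toPlane, sub_eq_zero] using h
    · refine ⟨‖x - rePart x • (1 : Quaternion ℝ)‖⁻¹ • (x - rePart x • (1 : Quaternion ℝ)),
        ⟨Set.mem_univ _, ?_, norm_smul_inv_norm h⟩, ?_⟩
      · change (‖x - rePart x • (1 : Quaternion ℝ)‖⁻¹ • (x - rePart x • (1 : Quaternion ℝ))).re = 0
        rw [Quaternion.re_smul, hre, smul_zero]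
      · rw [toPlane, smul_inv_smul₀ (norm_ne_zero_iff.2 h), add_sub_cancel]
  nonempty := imagUnits_nonempty
  isClosed_paravec := isClosed_univ
  continuous_rePart := Quaternion.continuous_re
  exists_mulLeft I hI := ⟨ContinuousLinearMap.mul ℝ (Quaternion ℝ) I, fun _ => rfl, fun x => by
    simp [← mul_assoc, mul_self_of_mem_imagUnits hI]⟩
  exists_mulRight I hI := ⟨(ContinuousLinearMap.mul ℝ (Quaternion ℝ)).flip I, fun _ => rfl,
    fun x => by simp [mul_assoc, mul_self_of_mem_imagUnits hI]⟩

theorem exists_isLeftAction {V : Type*} [NormedAddCommGroup V] [NormedSpace ℝ V]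
    [Module (Quaternion ℝ) V] [Module (Quaternion ℝ)ᵐᵒᵖ V]
    [SMulCommClass (Quaternion ℝ) (Quaternion ℝ)ᵐᵒᵖ V]
    [IsScalarTower ℝ (Quaternion ℝ) V] [IsScalarTower ℝ (Quaternion ℝ)ᵐᵒᵖ V]
    (hl : ∀ (a : Quaternion ℝ) (v : V), ‖a • v‖ = ‖a‖ * ‖v‖)
    (hr : ∀ (a : Quaternion ℝ) (v : V), ‖MulOpposite.op a • v‖ = ‖v‖ * ‖a‖) :
    ∃ L : Quaternion ℝ →L[ℝ] V →L[ℝ] V, IsLeftAction L := by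
  have h1 : SMulCommClass ℝ (Quaternion ℝ) V := IsScalarTower.to_smulCommClass
  have h2 : SMulCommClass ℝ (Quaternion ℝ)ᵐᵒᵖ V := IsScalarTower.to_smulCommClass
  let B : Quaternion ℝ →ₗ[ℝ] V →ₗ[ℝ] V := LinearMap.mk₂ ℝ (fun a v => a • v) add_smul
    (fun r a v => smul_assoc r a v) smul_add (fun r a v => (smul_comm r a v).symm)
  have hB : ∀ a v, B a v = a • v := fun a v => rfl
  let L := B.mkContinuous₂ 1 fun a v => by rw [hB, hl, one_mul]
  have hL : ∀ a v, L a v = a • v := fun a v => rfl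
  refine ⟨L, ⟨hL, fun a b => ?_, ?_, fun a b v => smul_comm _ _ _, fun b => ?_⟩⟩
  · ext v
    simp [hL, mul_smul]
  · ext v
    simp [hL]
  · let R : V →ₗ[ℝ] V :=
      { toFun := fun v => MulOpposite.op b • v
        map_add' := fun v w => smul_add _ v w
        map_smul' := fun r v => (smul_comm r (MulOpposite.op b) v).symm }
    exact ⟨R.mkContinuous ‖b‖ fun v => by rw [mul_comm]; exact (hr b v).le, fun v => rfl⟩

end Quaternion

/-! ### The Clifford setting -/

namespace Cliff
variable {n : ℕ}

instance : FiniteDimensional ℝ (Cliff n) :=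
  inferInstanceAs (FiniteDimensional ℝ (EuclideanSpace ℝ (Finset (Fin n))))

/-- The coefficient `ξ_A` as a continuous linear functional. -/
def coordCLM (A : Finset (Fin n)) : Cliff n →L[ℝ] ℝ :=
  LinearMap.toContinuousLinearMap
    { toFun := fun x => x.coord A
      map_add' := fun x y => coord_add x y A
      map_smul' := fun r x => coord_smul r x A }

@[simp] theorem coordCLM_apply (A : Finset (Fin n)) (x : Cliff n) : coordCLM A x = x.coord A := rfl

theorem norm_sq_eq (x : Cliff n) : ‖x‖ ^ 2 = ∑ A, x.coord A ^ 2 := by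
  have h := EuclideanSpace.norm_sq_eq (𝕜 := ℝ) (n := Finset (Fin n)) x
  simp only [Real.norm_eq_abs, sq_abs] at h
  exact h

theorem coord_vec (v : Fin n → ℝ) (A : Finset (Fin n)) :
    (vec v).coord A = ∑ i, if A = {i} then v i else 0 := by
  rw [vec_apply, ← coordCLM_apply, map_sum]
  simp [coord_e]

theorem coord_vec_singleton (v : Fin n → ℝ) (i : Fin n) : (vec v).coord {i} = v i := by
  simp [coord_vec]

theorem coord_vec_empty (v : Fin n → ℝ) : (vec v).coord ∅ = 0 := by
  rw [coord_vec]
  exact Finset.sum_eq_zero fun i _ => if_neg (Finset.singleton_ne_empty i).symm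

theorem norm_vec_sq (v : Fin n → ℝ) : ‖vec v‖ ^ 2 = ∑ i, v i ^ 2 := by
  rw [norm_sq_eq, ← Finset.sum_subset (Finset.subset_univ
    (Finset.univ.map ⟨fun i : Fin n => ({i} : Finset (Fin n)), Finset.singleton_injective⟩)),
    Finset.sum_map]
  · simp [coord_vec_singleton]
  · intro A _ hA
    rw [coord_vec, Finset.sum_eq_zero fun i _ => if_neg fun h => hA ?_, sq, mul_zero]
    rw [h]
    exact Finset.mem_map_of_mem _ (Finset.mem_univ i)

theorem mem_paravec {x : Cliff n} :
    x ∈ paravec (Cliff n) ↔ ∃ (r : ℝ) (v : Fin n → ℝ), x = r • 1 + vec v := by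
  simp only [vec_apply]
  exact Iff.rfl

theorem rePart_add_vec (r : ℝ) (v : Fin n → ℝ) : rePart (r • (1 : Cliff n) + vec v) = r := by
  change (r • (1 : Cliff n) + vec v).coord ∅ = r
  simp [coord_one, coord_vec_empty]

theorem mem_imagUnits {I : Cliff n} (hI : I ∈ imagUnits (Cliff n)) :
    ∃ v : Fin n → ℝ, I = vec v ∧ ∑ i, v i ^ 2 = 1 := by
  obtain ⟨hp, hre, hn⟩ := hI
  obtain ⟨r, v, rfl⟩ := mem_paravec.1 hp
  rw [rePart_add_vec] at hre
  subst hre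
  rw [zero_smul, zero_add] at hn ⊢
  exact ⟨v, rfl, by rw [← norm_vec_sq, hn, one_pow]⟩

theorem vec_mem_imagUnits {v : Fin n → ℝ} (hv : ‖vec v‖ = 1) : vec v ∈ imagUnits (Cliff n) := by
  have e : vec v = (0 : ℝ) • 1 + vec v := by simp
  exact ⟨mem_paravec.2 ⟨0, v, e⟩, by rw [e, rePart_add_vec], hv⟩

theorem mul_self_of_mem_imagUnits {I : Cliff n} (hI : I ∈ imagUnits (Cliff n)) : I * I = -1 := by
  obtain ⟨v, rfl, hv⟩ := mem_imagUnits hI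
  have h : negForm n v = -1 := by
    rw [← hv, negForm, QuadraticMap.weightedSumSquares_apply, ← Finset.sum_neg_distrib]
    exact Finset.sum_congr rfl fun i _ => by simp [sq]
  rw [vec_sq, h, map_neg, map_one]

theorem norm_smul_one_add_vec_sq (r : ℝ) (v : Fin n → ℝ) :
    ‖r • (1 : Cliff n) + vec v‖ ^ 2 = r ^ 2 + ∑ i, v i ^ 2 := by
  have h : ∀ A, (r • (1 : Cliff n) + vec v).coord A ^ 2 =
      (if A = ∅ then r ^ 2 else 0) + (vec v).coord A ^ 2 := fun A => by
    by_cases hA : A = ∅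
    · subst hA
      simp [coord_one, coord_vec_empty]
    · simp [coord_one, hA]
  rw [norm_sq_eq, Finset.sum_congr rfl fun A _ => h A, Finset.sum_add_distrib, ← norm_sq_eq,
    norm_vec_sq]
  simp

theorem imagUnits_nonempty (hn : 1 ≤ n) : (imagUnits (Cliff n)).Nonempty := by
  refine ⟨vec (Pi.single ⟨0, hn⟩ 1), vec_mem_imagUnits ?_⟩
  rw [← sq_eq_sq₀ (norm_nonneg _) zero_le_one, norm_vec_sq]
  simp [Pi.single_apply]

theorem toPlane_vec (v : Fin n → ℝ) (z : ℂ) :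
    toPlane (vec v) z = z.re • (1 : Cliff n) + vec (z.im • v) := by
  rw [map_smul]
  rfl

theorem isSliceAlgebra (hn : 1 ≤ n) : IsSliceAlgebra (Cliff n) where
  toPlane_mem I hI z := by
    obtain ⟨v, rfl, -⟩ := mem_imagUnits hI
    exact mem_paravec.2 ⟨_, _, toPlane_vec v z⟩
  rePart_toPlane I hI z := by
    obtain ⟨v, rfl, -⟩ := mem_imagUnits hI
    rw [toPlane_vec, rePart_add_vec]
  norm_toPlane I hI z := by
    obtain ⟨v, rfl, hv⟩ := mem_imagUnits hI
    rw [← sq_eq_sq₀ (norm_nonneg _) (norm_nonneg _), toPlane_vec, norm_smul_one_add_vec_sq,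
      ← Complex.normSq_eq_norm_sq, Complex.normSq_apply]
    simp only [Pi.smul_apply, smul_eq_mul, mul_pow, ← Finset.mul_sum, hv]
    ring
  exists_eq_toPlane x hx := by
    obtain ⟨r, v, rfl⟩ := mem_paravec.1 hx
    rw [rePart_add_vec, add_sub_cancel_left]
    rcases eq_or_ne (vec v) 0 with h | h
    · obtain ⟨I, hI⟩ := imagUnits_nonempty hn
      exact ⟨I, hI, by simp [toPlane, h]⟩
    · refine ⟨vec (‖vec v‖⁻¹ • v), vec_mem_imagUnits ?_, ?_⟩
      · rw [map_smul]
        exact norm_smul_inv_norm h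
      · rw [toPlane_vec, smul_inv_smul₀ (norm_ne_zero_iff.2 h)]
  nonempty := imagUnits_nonempty hn
  isClosed_paravec := by
    have e : paravec (Cliff n) = LinearMap.range
        ((LinearMap.toSpanSingleton ℝ (Cliff n) 1).coprod (vec : (Fin n → ℝ) →ₗ[ℝ] Cliff n)) := by
      ext x
      simp only [mem_paravec, SetLike.mem_coe, LinearMap.mem_range, Prod.exists,
        LinearMap.coprod_apply, LinearMap.toSpanSingleton_apply, eq_comm (a := x)]
    rw [e]
    exact Submodule.closed_of_finiteDimensional _
  continuous_rePart := (coordCLM (n := n) ∅).continuous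
  exists_mulLeft I hI := ⟨LinearMap.toContinuousLinearMap (LinearMap.mulLeft ℝ I), fun _ => rfl,
    fun x => by simp [← mul_assoc, mul_self_of_mem_imagUnits hI]⟩
  exists_mulRight I hI := ⟨LinearMap.toContinuousLinearMap (LinearMap.mulRight ℝ I), fun _ => rfl,
    fun x => by simp [mul_assoc, mul_self_of_mem_imagUnits hI]⟩

end Cliff

namespace CliffMod
variable {n : ℕ} {E : Type*} [NormedAddCommGroup E] [NormedSpace ℝ E]

instance [CompleteSpace E] : CompleteSpace (CliffMod n E) :=
  inferInstanceAs (CompleteSpace (PiLp 1 fun _ : Finset (Fin n) => E))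

variable (n E) in
/-- The coordinates `v ↦ (v_A)` as a linear homeomorphism. -/
def coordEquiv : CliffMod n E ≃L[ℝ] (Finset (Fin n) → E) :=
  PiLp.continuousLinearEquiv 1 ℝ fun _ : Finset (Fin n) => E

@[simp] theorem coordEquiv_apply (v : CliffMod n E) (A : Finset (Fin n)) :
    coordEquiv n E v A = v.coord A := rfl

@[simp] theorem coord_coordEquiv_symm (c : Finset (Fin n) → E) (A : Finset (Fin n)) :
    ((coordEquiv n E).symm c).coord A = c A := rfl

/-- The component `v_A` as a continuous linear map. -/
def coordCLM (A : Finset (Fin n)) : CliffMod n E →L[ℝ] E :=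
  (ContinuousLinearMap.proj A).comp (coordEquiv n E).toContinuousLinearMap

@[simp] theorem coordCLM_apply (A : Finset (Fin n)) (v : CliffMod n E) :
    coordCLM A v = v.coord A := rfl

theorem coord_sum {ι : Type*} (s : Finset ι) (F : ι → CliffMod n E) (A : Finset (Fin n)) :
    (∑ i ∈ s, F i).coord A = ∑ i ∈ s, (F i).coord A := map_sum (coordCLM A) F s

/-- The operator with the components `B_A`. -/
def ofComponents {X : Type*} [NormedAddCommGroup X] [NormedSpace ℝ X]
    (B : Finset (Fin n) → X →L[ℝ] E) : X →L[ℝ] CliffMod n E :=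
  (coordEquiv n E).symm.toContinuousLinearMap.comp (ContinuousLinearMap.pi B)

@[simp] theorem coord_ofComponents {X : Type*} [NormedAddCommGroup X] [NormedSpace ℝ X]
    (B : Finset (Fin n) → X →L[ℝ] E) (x : X) (A : Finset (Fin n)) :
    (ofComponents B x).coord A = B A x := rfl

theorem coord_left_smul (a : Cliff n) (v : CliffMod n E) (C : Finset (Fin n)) :
    (a • v).coord C = ∑ A, (cliffSign A (A ∆ C) * a.coord A) • v.coord (A ∆ C) := rfl

theorem coord_right_smul (a : Cliff n) (v : CliffMod n E) (C : Finset (Fin n)) :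
    (MulOpposite.op a • v).coord C =
      ∑ A, (cliffSign A (A ∆ C) * a.coord (A ∆ C)) • v.coord A := rfl

variable (n E) in
/-- The left multiplication `a ↦ (v ↦ a v)`. -/
def leftMul : Cliff n →L[ℝ] CliffMod n E →L[ℝ] CliffMod n E :=
  ∑ A, (Cliff.coordCLM A).smulRight
    (ofComponents fun C => cliffSign A (A ∆ C) • coordCLM (A ∆ C))

theorem leftMul_apply (a : Cliff n) (v : CliffMod n E) : leftMul n E a v = a • v := by
  ext C
  simp [leftMul, coord_left_smul, coord_sum, mul_smul, smul_comm (a.coord _)]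

/-- The right multiplication `v ↦ v a`. -/
def rightMul (a : Cliff n) : CliffMod n E →L[ℝ] CliffMod n E :=
  ofComponents fun C => ∑ A, (cliffSign A (A ∆ C) * a.coord (A ∆ C)) • coordCLM A

theorem rightMul_apply (a : Cliff n) (v : CliffMod n E) :
    rightMul a v = MulOpposite.op a • v := by
  ext C
  simp [rightMul, coord_right_smul]

theorem sum_tmul_e (v : CliffMod n E) : ∑ A, tmul (v.coord A) (Cliff.e A) = v := by
  ext B
  simp [coord_sum, tmul, Cliff.coord_e]

/-- Operators that agree on elementary tensors are equal. -/
theorem clm_ext {X : Type*} [NormedAddCommGroup X] [NormedSpace ℝ X]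
    {B C : CliffMod n E →L[ℝ] X} (h : ∀ x a, B (tmul x a) = C (tmul x a)) : B = C := by
  ext v
  rw [← sum_tmul_e v, map_sum, map_sum]
  exact Finset.sum_congr rfl fun A _ => h _ _

theorem isLeftAction : IsLeftAction (leftMul n E) where
  apply := leftMul_apply
  map_mul a b := clm_ext fun x c => by
    rw [mul_apply_eq_comp]
    simp only [leftMul_apply, left_smul_tmul, mul_assoc]
  map_one := clm_ext fun x c => by
    rw [leftMul_apply, left_smul_tmul, one_mul]
    rfl
  smul_comm a b v := by
    have h : (leftMul n E a).comp (rightMul b) = (rightMul b).comp (leftMul n E a) :=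
      clm_ext fun x c => by
        simp only [ContinuousLinearMap.comp_apply, leftMul_apply, rightMul_apply, left_smul_tmul,
          right_smul_tmul, mul_assoc]
    have := congrArg (fun B : CliffMod n E →L[ℝ] CliffMod n E => B v) h
    simpa only [ContinuousLinearMap.comp_apply, leftMul_apply, rightMul_apply] using this
  exists_right b := ⟨rightMul b, rightMul_apply b⟩

/-- `(S ⊗ 1) v = ∑_A S(v_A) ⊗ e_A`. -/
def mapCoord (S : E →ₗ.[ℝ] E) (v : CliffMod n E) (h : ∀ A, v.coord A ∈ S.domain) : CliffMod n E :=
  ofCoord fun A => S ⟨v.coord A, h A⟩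

@[simp] theorem coord_mapCoord (S : E →ₗ.[ℝ] E) (v : CliffMod n E)
    (h : ∀ A, v.coord A ∈ S.domain) (A : Finset (Fin n)) :
    (mapCoord S v h).coord A = S ⟨v.coord A, h A⟩ := rfl

theorem coord_right_smul_mem {S : E →ₗ.[ℝ] E} {v : CliffMod n E}
    (h : ∀ A, v.coord A ∈ S.domain) (a : Cliff n) (C : Finset (Fin n)) :
    (MulOpposite.op a • v).coord C ∈ S.domain := by
  rw [coord_right_smul]
  exact sum_mem fun A _ => S.domain.smul_mem _ (h A)

theorem mapCoord_right_smul (S : E →ₗ.[ℝ] E) (v : CliffMod n E) (h : ∀ A, v.coord A ∈ S.domain)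
    (a : Cliff n) (h' : ∀ A, (MulOpposite.op a • v).coord A ∈ S.domain) :
    mapCoord S (MulOpposite.op a • v) h' = MulOpposite.op a • mapCoord S v h := by
  ext C
  rw [coord_mapCoord, coord_right_smul a (mapCoord S v h)]
  have e : (⟨(MulOpposite.op a • v).coord C, h' C⟩ : S.domain) =
      ∑ A, (cliffSign A (A ∆ C) * a.coord (A ∆ C)) • (⟨v.coord A, h A⟩ : S.domain) :=
    Subtype.ext (by simp [coord_right_smul])
  rw [e]
  change S.toFun _ = _
  rw [map_sum]
  refine Finset.sum_congr rfl fun A _ => ?_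
  rw [map_smul]
  rfl

variable {T₀ : E →ₗ.[ℝ] E} {T : Fin n → E →ₗ.[ℝ] E}

theorem paravectorOp_apply (v : (paravectorOp T₀ T).domain) :
    paravectorOp T₀ T v = mapCoord T₀ v.1 (fun A => (v.2 A).1) +
      ∑ i, (Cliff.e {i} : Cliff n) • mapCoord (T i) v.1 fun A => (v.2 A).2 i := by
  change ∑ A, tmul (T₀ ⟨v.1.coord A, (v.2 A).1⟩) (Cliff.e A) +
    ∑ i, ∑ A, tmul (T i ⟨v.1.coord A, (v.2 A).2 i⟩) (Cliff.e {i} * Cliff.e A) = _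
  congr 1
  · exact sum_tmul_e (mapCoord T₀ v.1 _)
  · refine Finset.sum_congr rfl fun i _ => ?_
    conv_rhs => rw [← sum_tmul_e (mapCoord (T i) v.1 _), ← leftMul_apply, map_sum]
    simp only [leftMul_apply, left_smul_tmul, coord_mapCoord]

theorem isRightLinear_paravectorOp : IsRightLinear (Cliff n) (paravectorOp T₀ T) := by
  intro v a
  have h : MulOpposite.op a • v.1 ∈ (paravectorOp T₀ T).domain := fun A =>
    ⟨coord_right_smul_mem (fun B => (v.2 B).1) a A,
      fun i => coord_right_smul_mem (fun B => (v.2 B).2 i) a A⟩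
  refine ⟨h, ?_⟩
  rw [paravectorOp_apply, paravectorOp_apply, ← rightMul_apply (v := _ + _), map_add, map_sum]
  simp only [rightMul_apply, ← isLeftAction.smul_comm]
  congr 1
  · exact mapCoord_right_smul _ _ _ _ _
  · exact Finset.sum_congr rfl fun i _ => by rw [mapCoord_right_smul]

/-- Although `T` itself need not be closed, `T 𝒬_s(T)⁻¹` is bounded, since its components are
everywhere defined closed operators. -/
theorem hasBoundedResolventImage_paravectorOp [CompleteSpace E] (h₀ : T₀.IsClosed)
    (h : ∀ i, (T i).IsClosed) : HasBoundedResolventImage (Cliff n) (paravectorOp T₀ T) := by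
  intro s _ Q hQ
  have hd : ∀ v, Q v ∈ (paravectorOp T₀ T).domain := fun v => (hQ.2.1 v).1.1
  choose Y₀ hY₀ using fun A => h₀.exists_clm_comp ((coordCLM A).comp Q) fun v => (hd v A).1
  choose Y hY using fun i A => (h i).exists_clm_comp ((coordCLM A).comp Q) fun v => (hd v A).2 i
  refine ⟨ofComponents Y₀ + ∑ i, (leftMul n E (Cliff.e {i})).comp (ofComponents (Y i)),
    fun v => ⟨hd v, ?_⟩⟩
  have e₀ : ofComponents Y₀ v = mapCoord T₀ (Q v) fun A => (hd v A).1 := by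
    ext A
    exact hY₀ A v
  have e : ∀ i, ofComponents (Y i) v = mapCoord (T i) (Q v) fun A => (hd v A).2 i := fun i => by
    ext A
    exact hY i A v
  rw [paravectorOp_apply]
  simp [e₀, e, leftMul_apply]

end CliffMod

end

theorem mainTheorem1 :
    -- the quaternionic setting
    (∀ (V : Type*) [NormedAddCommGroup V] [NormedSpace ℝ V] [CompleteSpace V]
      [Module (Quaternion ℝ) V] [Module (Quaternion ℝ)ᵐᵒᵖ V]
      [SMulCommClass (Quaternion ℝ) (Quaternion ℝ)ᵐᵒᵖ V]
      [IsScalarTower ℝ (Quaternion ℝ) V] [IsScalarTower ℝ (Quaternion ℝ)ᵐᵒᵖ V]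
      (_ : ∀ (a : Quaternion ℝ) (v : V), ‖a • v‖ = ‖a‖ * ‖v‖)
      (_ : ∀ (a : Quaternion ℝ) (v : V), ‖MulOpposite.op a • v‖ = ‖v‖ * ‖a‖)
      (T : V →ₗ.[ℝ] V) (_ : IsRightLinear (Quaternion ℝ) T) (_ : T.IsClosed)
      (_ : (sResolventSet (Quaternion ℝ) T).Nonempty)
      (D : Set (Quaternion ℝ)) (f : Quaternion ℝ → Quaternion ℝ),
      (IsLeftSHWithInfinity (sSpectrum (Quaternion ℝ) T) D f →
        (∃ U, IsAdmissibleDomain (sSpectrum (Quaternion ℝ) T) D U ∧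
          ∀ I ∈ imagUnits (Quaternion ℝ), ∃ (N : ℕ) (γ : Fin N → ℝ → ℂ),
            IsPositiveBoundary (planeSlice I U) γ) ∧
        (∃ L ∈ boundedOps (Quaternion ℝ) V,
          ∀ U, IsAdmissibleDomain (sSpectrum (Quaternion ℝ) T) D U →
          ∀ I ∈ imagUnits (Quaternion ℝ), ∀ (N : ℕ) (γ : Fin N → ℝ → ℂ),
            IsPositiveBoundary (planeSlice I U) γ → HasLeftIntegral T f I γ L) ∧
        ∃! F : V →L[ℝ] V, F ∈ boundedOps (Quaternion ℝ) V ∧ IsLeftSCalculusValue T D f F) ∧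
      (IsRightSHWithInfinity (sSpectrum (Quaternion ℝ) T) D f →
        (∃ U, IsAdmissibleDomain (sSpectrum (Quaternion ℝ) T) D U ∧
          ∀ I ∈ imagUnits (Quaternion ℝ), ∃ (N : ℕ) (γ : Fin N → ℝ → ℂ),
            IsPositiveBoundary (planeSlice I U) γ) ∧
        (∃ L ∈ boundedOps (Quaternion ℝ) V,
          ∀ U, IsAdmissibleDomain (sSpectrum (Quaternion ℝ) T) D U →
          ∀ I ∈ imagUnits (Quaternion ℝ), ∀ (N : ℕ) (γ : Fin N → ℝ → ℂ),
            IsPositiveBoundary (planeSlice I U) γ → HasRightIntegral T f I γ L) ∧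
        ∃! F : V →L[ℝ] V, F ∈ boundedOps (Quaternion ℝ) V ∧ IsRightSCalculusValue T D f F)) ∧
    -- the Clifford setting
    (∀ (n : ℕ) (_ : 1 ≤ n) (E : Type*) [NormedAddCommGroup E] [NormedSpace ℝ E] [CompleteSpace E]
      (T₀ : E →ₗ.[ℝ] E) (T₁ : Fin n → E →ₗ.[ℝ] E) (_ : T₀.IsClosed) (_ : ∀ i, (T₁ i).IsClosed)
      (T : CliffMod n E →ₗ.[ℝ] CliffMod n E) (_ : T = CliffMod.paravectorOp T₀ T₁)
      (_ : (sResolventSet (Cliff n) T).Nonempty)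
      (D : Set (Cliff n)) (f : Cliff n → Cliff n),
      (IsLeftSHWithInfinity (sSpectrum (Cliff n) T) D f →
        (∃ U, IsAdmissibleDomain (sSpectrum (Cliff n) T) D U ∧
          ∀ I ∈ imagUnits (Cliff n), ∃ (N : ℕ) (γ : Fin N → ℝ → ℂ),
            IsPositiveBoundary (planeSlice I U) γ) ∧
        (∃ L ∈ boundedOps (Cliff n) (CliffMod n E),
          ∀ U, IsAdmissibleDomain (sSpectrum (Cliff n) T) D U →
          ∀ I ∈ imagUnits (Cliff n), ∀ (N : ℕ) (γ : Fin N → ℝ → ℂ),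
            IsPositiveBoundary (planeSlice I U) γ → HasLeftIntegral T f I γ L) ∧
        ∃! F : CliffMod n E →L[ℝ] CliffMod n E,
          F ∈ boundedOps (Cliff n) (CliffMod n E) ∧ IsLeftSCalculusValue T D f F) ∧
      (IsRightSHWithInfinity (sSpectrum (Cliff n) T) D f →
        (∃ U, IsAdmissibleDomain (sSpectrum (Cliff n) T) D U ∧
          ∀ I ∈ imagUnits (Cliff n), ∃ (N : ℕ) (γ : Fin N → ℝ → ℂ),
            IsPositiveBoundary (planeSlice I U) γ) ∧
        (∃ L ∈ boundedOps (Cliff n) (CliffMod n E),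
          ∀ U, IsAdmissibleDomain (sSpectrum (Cliff n) T) D U →
          ∀ I ∈ imagUnits (Cliff n), ∀ (N : ℕ) (γ : Fin N → ℝ → ℂ),
            IsPositiveBoundary (planeSlice I U) γ → HasRightIntegral T f I γ L) ∧
        ∃! F : CliffMod n E →L[ℝ] CliffMod n E,
          F ∈ boundedOps (Cliff n) (CliffMod n E) ∧ IsRightSCalculusValue T D f F)) := by
  refine ⟨fun V _ _ _ _ _ _ _ _ hl hr T hT hTc hρ D f => ?_,
    fun n hn E _ _ _ T₀ T₁ h₀ h₁ T hT hρ D f => ?_⟩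
  · obtain ⟨L, hL⟩ := Quaternion.exists_isLeftAction hl hr
    have hTQ : HasBoundedResolventImage (Quaternion ℝ) T := fun s _ Q hQ => by
      have hd : ∀ v, Q v ∈ T.domain := fun v => (hQ.2.1 v).1.1
      obtain ⟨Y, hY⟩ := hTc.exists_clm_comp Q hd
      exact ⟨Y, fun v => ⟨hd v, (hY v).symm⟩⟩
    exact ⟨leftSCalculus Quaternion.isSliceAlgebra hL hT hTQ hρ,
      rightSCalculus Quaternion.isSliceAlgebra hL hT hTQ hρ⟩
  · subst hT
    have hTQ := CliffMod.hasBoundedResolventImage_paravectorOp h₀ h₁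
    exact ⟨leftSCalculus (Cliff.isSliceAlgebra hn) CliffMod.isLeftAction
        CliffMod.isRightLinear_paravectorOp hTQ hρ,
      rightSCalculus (Cliff.isSliceAlgebra hn) CliffMod.isLeftAction
        CliffMod.isRightLinear_paravectorOp hTQ hρ⟩
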